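/- Let $n\ge 1$ and let $(M^{4n},g_M,J_1,J_2,J_3)$ be a hyperKähler manifold, i.e. $J_1,J_2,J_3$ are integrable almost complex structures with $J_1J_2=J_3=-J_2J_1$ and cyclically, $g_M$ is Hermitian for each $J_i$, and the 2-forms $\sigma_i=g_M(J_i\cdot,\cdot)$ are closed. Below, $t$ is the coordinate on $\mathbb R$, circles have period $2\pi$, connection forms on a principal $\mathbb T^k=(S^1)^k$-bundle are written as $k$ real-valued 1-forms, and forms and metrics on $M$ are pulled back without changing notation. (1) Suppose $[\sigma_1]\in H^2(M,2\pi\mathbb Z)$, let $M_\alpha\to M$ be a principal circle bundle determined by $[\sigma_1]$, and let $\alpha$ be a connection 1-form on it with $d\alpha=\sigma_1$. Then on $P^{4n+2}=\mathbb R_t\times M_\alpha$ $$g_P=dt^2+4e^{4t}\alpha^2+e^{2t}g_M$$ is a Kähler–Einstein metric with Kähler form $\omega_P=2e^{2t}\,dt\wedge\alpha+e^{2t}\sigma_1$. (2) Suppose $[\sigma_1],[-\sigma_2]\in H^2(M,2\pi\mathbb Z)$, let $M_{\alpha,\xi}\to M$ be a principal $\mathbb T^2$-bundle determined by these classes, and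 let $(\alpha,\xi)$ be a connection on it with $d\alpha=\sigma_1$, $d\xi=-\sigma_2$. Then on $L^{4n+3}=\mathbb R_t\times M_{\alpha,\xi}$ $$g_L=dt^2+4e^{4t}(\alpha^2+\xi^2)+e^{2t}g_M$$ is an Einstein metric. (3) Suppose $[\sigma_1],[-\sigma_2],[-\sigma_3]\in H^2(M,2\pi\mathbb Z)$, let $M_{\alpha,\xi,\eta}\to M$ be a principal $\mathbb T^3$-bundle determined by these classes, and let $(\alpha,\xi,\eta)$ be a connection on it with $d\alpha=\sigma_1$, $d\xi=-\sigma_2$, $d\eta=-\sigma_3$. Then on $N^{4n+4}=\mathbb R_t\times M_{\alpha,\xi,\eta}$ $$g_N=dt^2+4e^{4t}(\alpha^2+\xi^2+\eta^2)+e^{2t}g_M$$ is a quaternion-Kähler (in particular Einstein) metric, with quaternion-Kähler 4-form $\Omega_N=\tfrac12(\omega_1\wedge\omega_1+\omega_2\wedge\omega_2+\omega_3\wedge\omega_3)$, where $$\begin{aligned} \omega_1&=e^{2t}\sigma_1+(2e^{2t}\xi)\wedge(2e^{2t}\eta)+dt\wedge(2e^{2t}\alpha),\\ \omega_2&=e^{2t}\sigma_2+(2e^{2t}\xi)\wedge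 dt+(2e^{2t}\alpha)\wedge(2e^{2t}\eta),\\ \omega_3&=e^{2t}\sigma_3+(2e^{2t}\xi)\wedge(2e^{2t}\alpha)+(2e^{2t}\eta)\wedge dt. \end{aligned}$$ Here quaternion-Kähler means that $g_N$ is locally Hermitian for a triple of almost complex structures satisfying the quaternion relations, whose fundamental 2-forms have $\Omega_N$ as half the sum of their squares, that $\Omega_N$ is parallel for the Levi-Civita connection, and that $g_N$ is not Ricci-flat. Furthermore, the endomorphisms $I_i$ defined by $g_N(I_i\cdot,\cdot)=\omega_i$ are $g_N$-orthogonal integrable almost complex structures satisfying the quaternion relations, so that $N$ is hypercomplex. In each of the three cases the metric has negative scalar curvature, and it is complete if and only if $g_M$ is complete. -/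

import Mathlib

open scoped Manifold ContDiff Bundle Topology

namespace HKBundle

section Tensors

variable {E : Type*} [NormedAddCommGroup E] [NormedSpace ℝ E]
  {H : Type*} [TopologicalSpace H] (I : ModelWithCorners ℝ E H)
  (M : Type*) [TopologicalSpace M] [ChartedSpace H M]

/-- Vector fields (not necessarily smooth). -/
abbrev VField := Π x : M, TangentSpace I x

/-- Fields of covectors. -/
abbrev OneForm := Π x : M, TangentSpace I x →L[ℝ] ℝ

/-- Fields of bilinear forms on the tangent spaces; 2-forms and metrics are of this type. -/
abbrev Tensor2 := Π x : M, TangentSpace I x →L[ℝ] TangentSpace I x →L[ℝ] ℝ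

/-- Fields of functions of four tangent vectors; 4-forms are of this type. -/
abbrev Tensor4 := Π x : M,
  TangentSpace I x → TangentSpace I x → TangentSpace I x → TangentSpace I x → ℝ

/-- Fields of endomorphisms of the tangent spaces. -/
abbrev EndField := Π x : M, TangentSpace I x →L[ℝ] TangentSpace I x

/-- Smooth Riemannian metrics. -/
abbrev RiemMetric [IsManifold I 1 M] :=
  Bundle.ContMDiffRiemannianMetric I ∞ E (fun x : M => TangentSpace I x)

/-- Affine connections. -/
abbrev AffineConnection [IsManifold I 1 M] :=
  CovariantDerivative I E (TangentSpace I : M → Type _)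

end Tensors

section General

variable {E : Type*} [NormedAddCommGroup E] [NormedSpace ℝ E]
  {H : Type*} [TopologicalSpace H] {I : ModelWithCorners ℝ E H}
  {M : Type*} [TopologicalSpace M] [ChartedSpace H M]
  {E' : Type*} [NormedAddCommGroup E'] [NormedSpace ℝ E']
  {H' : Type*} [TopologicalSpace H'] {I' : ModelWithCorners ℝ E' H'}
  {M' : Type*} [TopologicalSpace M'] [ChartedSpace H' M']

/-! ### Smoothness -/

/-- `X` is a smooth section of the tangent bundle. -/
noncomputable def IsSmoothVField [IsManifold I 1 M] (X : VField I M) : Prop :=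
  ContMDiff I I.tangent ∞ (fun x => (⟨x, X x⟩ : TangentBundle I M))

/-- `α` is a smooth section of the cotangent bundle. -/
noncomputable def IsSmoothOneForm [IsManifold I 1 M] (α : OneForm I M) : Prop :=
  ContMDiff I (I.prod 𝓘(ℝ, E →L[ℝ] ℝ)) ∞
    (fun x => Bundle.TotalSpace.mk' (E →L[ℝ] ℝ)
      (E := fun x : M => TangentSpace I x →L[ℝ] ℝ) x (α x))

/-- `J` is, over the set `U`, a smooth section of the bundle of endomorphisms of the tangent
bundle. -/
noncomputable def IsSmoothEndOn [IsManifold I 1 M] (J : EndField I M) (U : Set M) : Prop :=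
  ContMDiffOn I (I.prod 𝓘(ℝ, E →L[ℝ] E)) ∞
    (fun x => Bundle.TotalSpace.mk' (E →L[ℝ] E)
      (E := fun x : M => TangentSpace I x →L[ℝ] TangentSpace I x) x (J x)) U

/-! ### Algebra of forms -/

/-- `α ⊗ β`. -/
noncomputable def tensor (α β : OneForm I M) : Tensor2 I M := fun x => (α x).smulRight (β x)

/-- `α ∧ β = α ⊗ β - β ⊗ α`, for 1-forms. -/
noncomputable def wedge (α β : OneForm I M) : Tensor2 I M := tensor α β - tensor β α

/-- `φ ∧ ψ`, for 2-forms: the signed sum over the (2,2)-shuffles. -/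
noncomputable def wedge22 (φ ψ : Tensor2 I M) : Tensor4 I M := fun x a b c d =>
  φ x a b * ψ x c d - φ x a c * ψ x b d + φ x a d * ψ x b c
    + φ x b c * ψ x a d - φ x b d * ψ x a c + φ x c d * ψ x a b

/-- The 2-form `g(J ·, ·)`. -/
noncomputable def fundForm (g : Tensor2 I M) (J : EndField I M) : Tensor2 I M := fun x => (g x).comp (J x)

/-- `½ (φ₀ ∧ φ₀ + φ₁ ∧ φ₁ + φ₂ ∧ φ₂)`. -/
noncomputable def quatForm (φ : Fin 3 → Tensor2 I M) : Tensor4 I M := fun x a b c d =>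
  (1 / 2 : ℝ) * ∑ i, wedge22 (φ i) (φ i) x a b c d

/-- Pullback of a 1-form along a map. -/
noncomputable def pullback₁ (f : M → M') (β : OneForm I' M') : OneForm I M := fun x =>
  (β (f x)).comp (mfderiv I I' f x)

/-- Pullback of a bilinear form along a map. -/
noncomputable def pullback₂ (f : M → M') (β : Tensor2 I' M') : Tensor2 I M := fun x =>
  (ContinuousLinearMap.precomp ℝ (mfderiv I I' f x)).comp ((β (f x)).comp (mfderiv I I' f x))

/-! ### Exterior derivative, through its evaluation on smooth vector fields -/

/-- `dα(X, Y) = X(α(Y)) - Y(α(X)) - α([X, Y])`. -/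
noncomputable def extDeriv₁ (α : OneForm I M) (X Y : VField I M) (x : M) : ℝ :=
  mvfderiv I (fun y => α y (Y y)) x (X x) - mvfderiv I (fun y => α y (X y)) x (Y x)
    - α x (VectorField.mlieBracket I X Y x)

/-- `dα = β`, for a 1-form `α`. -/
noncomputable def HasExtDeriv₁ [IsManifold I 1 M] (α : OneForm I M) (β : Tensor2 I M) : Prop :=
  ∀ X Y : VField I M, IsSmoothVField X → IsSmoothVField Y →
    ∀ x, extDeriv₁ α X Y x = β x (X x) (Y x)

/-- `dφ(X, Y, Z) = X(φ(Y, Z)) - Y(φ(X, Z)) + Z(φ(X, Y))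
- φ([X, Y], Z) + φ([X, Z], Y) - φ([Y, Z], X)`. -/
noncomputable def extDeriv₂ (φ : Tensor2 I M) (X Y Z : VField I M) (x : M) : ℝ :=
  mvfderiv I (fun y => φ y (Y y) (Z y)) x (X x)
    - mvfderiv I (fun y => φ y (X y) (Z y)) x (Y x)
    + mvfderiv I (fun y => φ y (X y) (Y y)) x (Z x)
    - φ x (VectorField.mlieBracket I X Y x) (Z x)
    + φ x (VectorField.mlieBracket I X Z x) (Y x)
    - φ x (VectorField.mlieBracket I Y Z x) (X x)

/-- `dφ = 0`, for a 2-form `φ`. -/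
noncomputable def IsClosedForm₂ [IsManifold I 1 M] (φ : Tensor2 I M) : Prop :=
  ∀ X Y Z : VField I M, IsSmoothVField X → IsSmoothVField Y → IsSmoothVField Z →
    ∀ x, extDeriv₂ φ X Y Z x = 0

/-! ### Almost complex structures -/

/-- The Nijenhuis tensor `[JX, JY] - J[JX, Y] - J[X, JY] - [X, Y]`. -/
noncomputable def nijenhuis (J : EndField I M) (X Y : VField I M) (x : M) : TangentSpace I x :=
  VectorField.mlieBracket I (fun y => J y (X y)) (fun y => J y (Y y)) x
    - J x (VectorField.mlieBracket I (fun y => J y (X y)) Y x)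
    - J x (VectorField.mlieBracket I X (fun y => J y (Y y)) x)
    - VectorField.mlieBracket I X Y x

/-- `J` is an integrable almost complex structure: it is smooth, `J² = -1`, and its Nijenhuis
tensor vanishes. -/
structure IsComplexStructure [IsManifold I 1 M] (J : EndField I M) : Prop where
  smooth : IsSmoothEndOn J Set.univ
  sq : ∀ x v, J x (J x v) = -v
  integrable : ∀ X Y : VField I M, IsSmoothVField X → IsSmoothVField Y →
    ∀ x, nijenhuis J X Y x = 0

/-- The quaternion relations at the point `x`: `Jᵢ² = -1`, and `Jᵢ Jⱼ = Jₖ = -Jⱼ Jᵢ` for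
`(i, j, k)` a cyclic permutation of `(0, 1, 2)`. -/
noncomputable def QuaternionRelations (J : Fin 3 → EndField I M) (x : M) : Prop :=
  ∀ i : Fin 3, ∀ v, J i x (J i x v) = -v ∧ J i x (J (i + 1) x v) = J (i + 2) x v ∧
    J (i + 1) x (J i x v) = -J (i + 2) x v

/-- A hypercomplex structure: three (integrable) complex structures satisfying the quaternion
relations. -/
structure IsHypercomplex [IsManifold I 1 M] (J : Fin 3 → EndField I M) : Prop where
  complex : ∀ i, IsComplexStructure (J i)
  quaternion : ∀ x, QuaternionRelations J x

/-- `(g, J)` is Kähler with Kähler form `φ`: `J` is an integrable almost complex structure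
compatible with `g`, and `φ = g(J ·, ·)` is closed. -/
structure IsKahlerWith [IsManifold I 1 M] (g : RiemMetric I M) (J : EndField I M)
    (φ : Tensor2 I M) : Prop where
  complex : IsComplexStructure J
  compat : ∀ x u v, g.inner x (J x u) (J x v) = g.inner x u v
  form_eq : ∀ x u v, φ x u v = g.inner x (J x u) v
  closed : IsClosedForm₂ φ

/-! ### Curvature -/

/-- `D` is the Levi-Civita connection of `g`: it is compatible with the metric and
torsion-free. -/
structure IsLeviCivita [IsManifold I 1 M] (g : RiemMetric I M) (D : AffineConnection I M) :
    Prop where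
  metric : ∀ X Y Z : VField I M, IsSmoothVField X → IsSmoothVField Y → IsSmoothVField Z →
    ∀ x, mvfderiv I (fun y => g.inner y (Y y) (Z y)) x (X x) =
      g.inner x (D Y x (X x)) (Z x) + g.inner x (Y x) (D Z x (X x))
  torsion_free : ∀ X Y : VField I M, IsSmoothVField X → IsSmoothVField Y →
    ∀ x, D Y x (X x) - D X x (Y x) = VectorField.mlieBracket I X Y x

/-- The curvature `R(X, Y) Z = ∇_X ∇_Y Z - ∇_Y ∇_X Z - ∇_[X, Y] Z`. -/
noncomputable def curvature [IsManifold I 1 M] (D : AffineConnection I M) (X Y Z : VField I M)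
    (x : M) : TangentSpace I x :=
  D (fun y => D Z y (Y y)) x (X x) - D (fun y => D Z y (X y)) x (Y x)
    - D Z x (VectorField.mlieBracket I X Y x)

/-- The basis used to write traces over the tangent space at `x`. -/
noncomputable def tangentBasis [FiniteDimensional ℝ E] (x : M) :
    Module.Basis (Fin (Module.finrank ℝ E)) ℝ (TangentSpace I x) :=
  Module.finBasis ℝ E

/-- The Ricci tensor `Ric(v, w) = tr (u ↦ R(u, v) w)` at `x`; the tangent vectors are extended to
local vector fields that are smooth near `x`. -/
noncomputable def ricci [FiniteDimensional ℝ E] [IsManifold I 1 M] (D : AffineConnection I M)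
    (x : M) (v w : TangentSpace I x) : ℝ :=
  ∑ i, (tangentBasis x).repr (curvature D (FiberBundle.extend E (tangentBasis (I := I) x i))
    (FiberBundle.extend E v) (FiberBundle.extend E w) x) i

/-- The scalar curvature at `x`, the trace `∑ gⁱʲ Ricᵢⱼ` of the Ricci tensor with respect to the
metric. -/
noncomputable def scalarCurvature [FiniteDimensional ℝ E] [IsManifold I 1 M]
    (g : RiemMetric I M) (D : AffineConnection I M) (x : M) : ℝ :=
  Matrix.trace
    ((Matrix.of fun i j => g.inner x (tangentBasis x i) (tangentBasis x j))⁻¹ *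
      Matrix.of fun i j => ricci D x (tangentBasis x i) (tangentBasis x j))

/-- `g` satisfies `Ric = c g`. -/
noncomputable def IsEinsteinWith [FiniteDimensional ℝ E] [IsManifold I 1 M] (g : RiemMetric I M) (c : ℝ) :
    Prop :=
  ∃ D : AffineConnection I M, IsLeviCivita g D ∧ ∀ x v w, ricci D x v w = c * g.inner x v w

/-- `g` is an Einstein metric. -/
noncomputable def IsEinstein [FiniteDimensional ℝ E] [IsManifold I 1 M] (g : RiemMetric I M) : Prop :=
  ∃ c : ℝ, IsEinsteinWith g c

/-- The scalar curvature of `g` is everywhere negative. -/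
noncomputable def HasNegativeScalarCurvature [FiniteDimensional ℝ E] [IsManifold I 1 M] (g : RiemMetric I M) :
    Prop :=
  ∃ D : AffineConnection I M, IsLeviCivita g D ∧ ∀ x, scalarCurvature g D x < 0

/-- The 4-form `Ω` is parallel for the Levi-Civita connection of `g`. -/
noncomputable def IsParallel₄ [IsManifold I 1 M] (g : RiemMetric I M) (Ω : Tensor4 I M) : Prop :=
  ∃ D : AffineConnection I M, IsLeviCivita g D ∧
    ∀ X A B C F : VField I M, IsSmoothVField X → IsSmoothVField A → IsSmoothVField B →
      IsSmoothVField C → IsSmoothVField F → ∀ x,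
      mvfderiv I (fun y => Ω y (A y) (B y) (C y) (F y)) x (X x) =
        Ω x (D A x (X x)) (B x) (C x) (F x) + Ω x (A x) (D B x (X x)) (C x) (F x)
          + Ω x (A x) (B x) (D C x (X x)) (F x) + Ω x (A x) (B x) (C x) (D F x (X x))

/-- `(g, Ω)` is a quaternion-Kähler structure on a manifold of dimension `4m`, `m ≥ 2`: locally
`g` is Hermitian for a triple of smooth almost complex structures satisfying the quaternion
relations, with `Ω = ½ ∑ ωᵢ ∧ ωᵢ` for the associated 2-forms; `Ω` is parallel for the Levi-Civita
connection; and `g` is not Ricci-flat (such a metric is always Einstein, and the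
condition is that the Einstein constant is not zero). -/
structure IsQuaternionKahler [FiniteDimensional ℝ E] [IsManifold I 1 M] (g : RiemMetric I M)
    (Ω : Tensor4 I M) : Prop where
  dim : ∃ m : ℕ, 2 ≤ m ∧ Module.finrank ℝ E = 4 * m
  local_triple : ∀ x₀ : M, ∃ U : Set M, IsOpen U ∧ x₀ ∈ U ∧ ∃ J : Fin 3 → EndField I M,
    (∀ i, IsSmoothEndOn (J i) U) ∧
    (∀ x ∈ U, QuaternionRelations J x) ∧
    (∀ x ∈ U, ∀ i u v, g.inner x (J i x u) (J i x v) = g.inner x u v) ∧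
    (∀ x ∈ U, ∀ a b c d, Ω x a b c d = quatForm (fun i => fundForm g.inner (J i)) x a b c d)
  parallel : IsParallel₄ g Ω
  not_ricci_flat : ∃ c : ℝ, c ≠ 0 ∧ IsEinsteinWith g c

/-! ### Completeness -/

/-- The Riemannian distance of `g`: the infimum of the `g`-lengths of `C¹` paths (infinite
between different components). -/
noncomputable def riemDist [IsManifold I 1 M] (g : RiemMetric I M) (x y : M) : ENNReal :=
  letI : Bundle.RiemannianBundle (fun x : M => TangentSpace I x) := ⟨g.toRiemannianMetric⟩
  Manifold.riemannianEDist I x y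

/-- `g` is complete: every Cauchy sequence for its Riemannian distance converges. -/
noncomputable def IsCompleteMetric [IsManifold I 1 M] (g : RiemMetric I M) : Prop :=
  ∀ u : ℕ → M, (∀ ε : ENNReal, 0 < ε → ∃ K, ∀ m ≥ K, ∀ l ≥ K, riemDist g (u m) (u l) < ε) →
    ∃ x, Filter.Tendsto u Filter.atTop (𝓝 x)

variable (I M) in
/-- A hyperkähler structure on `M`: a hypercomplex structure `J` and a Riemannian metric `g` that
is Hermitian for each `J i`, such that the 2-forms `σᵢ = g(Jᵢ ·, ·)` are closed. -/
structure HyperKahlerStructure [IsManifold I 1 M] where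
  g : RiemMetric I M
  J : Fin 3 → EndField I M
  hypercomplex : IsHypercomplex J
  hermitian : ∀ i x u v, g.inner x (J i x u) (J i x v) = g.inner x u v
  closed : ∀ i, IsClosedForm₂ (fundForm g.inner (J i))

/-- The Kähler forms of a hyperkähler structure. -/
noncomputable def HyperKahlerStructure.σ [IsManifold I 1 M] (S : HyperKahlerStructure I M) (i : Fin 3) :
    Tensor2 I M :=
  fundForm S.g.inner (S.J i)

end General

section TorusBundles

/-- The torus `𝕋ᵏ`, as a product of circles. -/
abbrev Torus (k : ℕ) := Fin k → Circle

/-- The model with corners of `𝕋ᵏ`. -/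
noncomputable abbrev torusModel (k : ℕ) := ModelWithCorners.pi (fun _ : Fin k => 𝓡 1)

variable {k : ℕ} {E : Type*} [NormedAddCommGroup E] [NormedSpace ℝ E]
  {H : Type*} [TopologicalSpace H] (I : ModelWithCorners ℝ E H)
  {M : Type*} [TopologicalSpace M] [ChartedSpace H M]
  {E' : Type*} [NormedAddCommGroup E'] [NormedSpace ℝ E']
  {H' : Type*} [TopologicalSpace H'] (I' : ModelWithCorners ℝ E' H')
  {B : Type*} [TopologicalSpace B] [ChartedSpace H' B] [MulAction (Torus k) B]

/-- `pr : B → M` is a smooth principal `𝕋ᵏ`-bundle: the torus acts along the fibres, and over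
a neighbourhood of each point of `M` there is an equivariant diffeomorphism of `B` with
the product with `𝕋ᵏ`. -/
structure IsPrincipalTorusBundle (k : ℕ) [MulAction (Torus k) B] (pr : B → M) : Prop where
  smooth_proj : ContMDiff I' I ∞ pr
  proj_smul : ∀ (a : Torus k) (b : B), pr (a • b) = pr b
  locally_trivial : ∀ x : M, ∃ U : Set M, IsOpen U ∧ x ∈ U ∧
    ∃ e : OpenPartialHomeomorph B (M × Torus k),
      e.source = pr ⁻¹' U ∧ e.target = U ×ˢ Set.univ ∧
      (∀ b ∈ e.source, (e b).1 = pr b) ∧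
      (∀ b ∈ e.source, ∀ a : Torus k, e (a • b) = ((e b).1, a * (e b).2)) ∧
      ContMDiffOn I' (I.prod (torusModel k)) ∞ e e.source ∧
      ContMDiffOn (I.prod (torusModel k)) I' ∞ e.symm e.target

/-- `θ₁, …, θₖ` are the components of a connection 1-form on a principal `𝕋ᵏ`-bundle: they are
smooth, invariant under the torus, and `θⱼ` takes the value `δᵢⱼ` on the generator of the `i`-th
circle, that is, on the velocity of `s ↦ (1, …, exp(√-1 s), …, 1) • b`. -/
structure IsTorusConnection [IsManifold I' 1 B] (θ : Fin k → OneForm I' B) : Prop where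
  smooth : ∀ j, IsSmoothOneForm (θ j)
  invariant : ∀ (j : Fin k) (a : Torus k), pullback₁ (fun b : B => a • b) (θ j) = θ j
  vertical : ∀ (i j : Fin k) (b : B) (s : ℝ),
    pullback₁ (I := 𝓘(ℝ, ℝ)) (fun s : ℝ => (Pi.mulSingle i (Circle.exp s) : Torus k) • b) (θ j)
      s (1 : ℝ) = if i = j then 1 else 0

end TorusBundles

section TotalSpaces

variable {k : ℕ} {E : Type*} [NormedAddCommGroup E] [NormedSpace ℝ E]
  {H : Type*} [TopologicalSpace H] {I : ModelWithCorners ℝ E H}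
  {M : Type*} [TopologicalSpace M] [ChartedSpace H M] [IsManifold I 1 M]
  {E' : Type*} [NormedAddCommGroup E'] [NormedSpace ℝ E']
  {H' : Type*} [TopologicalSpace H'] {I' : ModelWithCorners ℝ E' H'}
  {B : Type*} [TopologicalSpace B] [ChartedSpace H' B]

/-- The 1-form `dt` on `ℝ × B`. -/
noncomputable def dt : OneForm (𝓘(ℝ, ℝ).prod I') (ℝ × B) := fun p =>
  mvfderiv (𝓘(ℝ, ℝ).prod I') (Prod.fst : ℝ × B → ℝ) p

/-- A 1-form on `B`, pulled back to `ℝ × B`. -/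
noncomputable def liftForm (α : OneForm I' B) : OneForm (𝓘(ℝ, ℝ).prod I') (ℝ × B) :=
  pullback₁ Prod.snd α

/-- The 1-form `2 e^{2t} α` on `ℝ × B`. -/
noncomputable def scaledForm (α : OneForm I' B) : OneForm (𝓘(ℝ, ℝ).prod I') (ℝ × B) := fun p =>
  (2 * Real.exp (2 * p.1)) • liftForm α p

/-- For a bilinear form `β` on `M` and `pr : B → M`, the bilinear form `e^{2t} β` on `ℝ × B`. -/
noncomputable def baseForm (pr : B → M) (β : Tensor2 I M) :
    Tensor2 (𝓘(ℝ, ℝ).prod I') (ℝ × B) := fun p =>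
  Real.exp (2 * p.1) • pullback₂ (I := 𝓘(ℝ, ℝ).prod I') (fun q : ℝ × B => pr q.2) β p

/-- `dt² + 4 e^{4t} (θ₁² + ⋯ + θₖ²) + e^{2t} g_M` on `ℝ × B`. -/
noncomputable def totalMetric (pr : B → M) (gM : RiemMetric I M) (θ : Fin k → OneForm I' B) :
    Tensor2 (𝓘(ℝ, ℝ).prod I') (ℝ × B) := fun p =>
  tensor dt dt p
    + (4 * Real.exp (4 * p.1)) • ∑ j, tensor (liftForm (θ j)) (liftForm (θ j)) p
    + baseForm pr gM.inner p

/-- `ω_P = 2 e^{2t} dt ∧ α + e^{2t} σ₁` on `ℝ × B`. -/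
noncomputable def omegaP (S : HyperKahlerStructure I M) (pr : B → M) (α : OneForm I' B) :
    Tensor2 (𝓘(ℝ, ℝ).prod I') (ℝ × B) :=
  wedge dt (scaledForm α) + baseForm pr (S.σ 0)

/-- The 2-forms on `ℝ × B`
`ω₁ = e^{2t} σ₁ + (2 e^{2t} ξ) ∧ (2 e^{2t} η) + dt ∧ (2 e^{2t} α)`,
`ω₂ = e^{2t} σ₂ + (2 e^{2t} ξ) ∧ dt + (2 e^{2t} α) ∧ (2 e^{2t} η)`,
`ω₃ = e^{2t} σ₃ + (2 e^{2t} ξ) ∧ (2 e^{2t} α) + (2 e^{2t} η) ∧ dt`. -/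
noncomputable def omegaN (S : HyperKahlerStructure I M) (pr : B → M) (α ξ η : OneForm I' B) :
    Fin 3 → Tensor2 (𝓘(ℝ, ℝ).prod I') (ℝ × B) :=
  ![baseForm pr (S.σ 0) + wedge (scaledForm ξ) (scaledForm η) + wedge dt (scaledForm α),
    baseForm pr (S.σ 1) + wedge (scaledForm ξ) dt + wedge (scaledForm α) (scaledForm η),
    baseForm pr (S.σ 2) + wedge (scaledForm ξ) (scaledForm α) + wedge (scaledForm η) dt]

end TotalSpaces

end HKBundle

section Development

set_option linter.unusedSectionVars false
set_option synthInstance.maxHeartbeats 200000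
set_option autoImplicit false
set_option linter.unusedSimpArgs false
set_option maxSynthPendingDepth 3

namespace HKBundle

section Calculus

variable {E : Type*} [NormedAddCommGroup E] [NormedSpace ℝ E]
  {H : Type*} [TopologicalSpace H] {I : ModelWithCorners ℝ E H}
  {M : Type*} [TopologicalSpace M] [ChartedSpace H M]
  {E' : Type*} [NormedAddCommGroup E'] [NormedSpace ℝ E']
  {H' : Type*} [TopologicalSpace H'] {I' : ModelWithCorners ℝ E' H'}
  {M' : Type*} [TopologicalSpace M'] [ChartedSpace H' M']
  {F : Type*} [NormedAddCommGroup F] [NormedSpace ℝ F]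
  {G : Type*} [NormedAddCommGroup G] [NormedSpace ℝ G]
  {p : M}

lemma HasMFDerivAt.mvfderiv_eq {f : M → F} {f' : TangentSpace I p →L[ℝ] F}
    (h : HasMFDerivAt I 𝓘(ℝ, F) f p f') : mvfderiv I f p = f' := by
  ext v
  simp only [mvfderiv, h.mfderiv]
  rfl

lemma hasMFDerivAt_mvfderiv {f : M → F} (h : MDifferentiableAt I 𝓘(ℝ, F) f p) :
    HasMFDerivAt I 𝓘(ℝ, F) f p (mvfderiv I f p) :=
  h.hasMFDerivAt

/-- Chain rule for a map into a normed space followed by a map between normed spaces. -/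
lemma mvfderiv_comp_fderiv {g : F → G} {f : M → F} (hg : DifferentiableAt ℝ g (f p))
    (hf : MDifferentiableAt I 𝓘(ℝ, F) f p) :
    mvfderiv I (fun q => g (f q)) p = (fderiv ℝ g (f p)).comp (mvfderiv I f p) :=
  HasMFDerivAt.mvfderiv_eq
    (HasMFDerivAt.comp p hg.hasFDerivAt.hasMFDerivAt (hasMFDerivAt_mvfderiv hf))

/-- Chain rule for a map of manifolds followed by a map into a normed space. -/
lemma mvfderiv_comp_mfderiv {g : M' → F} {f : M → M'}
    (hg : MDifferentiableAt I' 𝓘(ℝ, F) g (f p)) (hf : MDifferentiableAt I I' f p) :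
    mvfderiv I (fun q => g (f q)) p = (mvfderiv I' g (f p)).comp (mfderiv I I' f p) :=
  HasMFDerivAt.mvfderiv_eq (HasMFDerivAt.comp p (hasMFDerivAt_mvfderiv hg) hf.hasMFDerivAt)

lemma mdifferentiableAt_comp_differentiableAt {g : F → G} {f : M → F}
    (hg : DifferentiableAt ℝ g (f p)) (hf : MDifferentiableAt I 𝓘(ℝ, F) f p) :
    MDifferentiableAt I 𝓘(ℝ, G) (fun q => g (f q)) p :=
  hg.mdifferentiableAt.comp p hf

lemma _root_.Filter.EventuallyEq.mvfderiv_eq {f g : M → F} (h : f =ᶠ[𝓝 p] g) :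
    mvfderiv I f p = mvfderiv I g p := by
  ext v
  simp only [mvfderiv, h.mfderiv_eq]
  rfl

lemma mvfderiv_clm_apply {c : M → F →L[ℝ] G} {u : M → F}
    (hc : MDifferentiableAt I 𝓘(ℝ, F →L[ℝ] G) c p) (hu : MDifferentiableAt I 𝓘(ℝ, F) u p) :
    MDifferentiableAt I 𝓘(ℝ, G) (fun q => c q (u q)) p ∧ ∀ v : TangentSpace I p,
    mvfderiv I (fun q => c q (u q)) p v =
      mvfderiv I c p v (u p) + c p (mvfderiv I u p v) := by
  let dc : E →L[ℝ] F →L[ℝ] G := mvfderiv I c p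
  let du : E →L[ℝ] F := mvfderiv I u p
  let f' : E →L[ℝ] G := (c p).comp du + dc.flip (u p)
  have h1 := (hasMFDerivAt_mvfderiv hc).2.clm_apply (hasMFDerivAt_mvfderiv hu).2
  have h : HasMFDerivAt I 𝓘(ℝ, G) (fun q => c q (u q)) p f' := by
    refine ⟨hc.continuousAt.clm_apply hu.continuousAt, ?_⟩
    have e : f' = (writtenInExtChartAt I 𝓘(ℝ, F →L[ℝ] G) p c (extChartAt I p p)).comp du +
        dc.flip (writtenInExtChartAt I 𝓘(ℝ, F) p u (extChartAt I p p)) := by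
      simp only [f', writtenInExtChartAt, extChartAt_model_space_eq_id, PartialEquiv.refl_coe,
        Function.comp_apply, id_eq, extChartAt_to_inv]
    rw [e]
    exact h1
  refine ⟨h.mdifferentiableAt, fun v => ?_⟩
  rw [HasMFDerivAt.mvfderiv_eq h]
  change c p (du v) + dc v (u p) = dc v (u p) + c p (du v)
  exact add_comm _ _

lemma mvfderiv_clm_apply₂ {c : M → F →L[ℝ] F →L[ℝ] G} {u w : M → F}
    (hc : MDifferentiableAt I 𝓘(ℝ, F →L[ℝ] F →L[ℝ] G) c p)
    (hu : MDifferentiableAt I 𝓘(ℝ, F) u p) (hw : MDifferentiableAt I 𝓘(ℝ, F) w p) :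
    MDifferentiableAt I 𝓘(ℝ, G) (fun q => c q (u q) (w q)) p ∧ ∀ v : TangentSpace I p,
    mvfderiv I (fun q => c q (u q) (w q)) p v =
      mvfderiv I c p v (u p) (w p) + c p (mvfderiv I u p v) (w p)
        + c p (u p) (mvfderiv I w p v) := by
  obtain ⟨h1, h2⟩ := mvfderiv_clm_apply hc hu
  obtain ⟨h3, h4⟩ := mvfderiv_clm_apply h1 hw
  refine ⟨h3, fun v => ?_⟩
  rw [h4, h2]
  simp

end Calculus

section Bracket

variable {E : Type*} [NormedAddCommGroup E] [NormedSpace ℝ E] [CompleteSpace E]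
  {H : Type*} [TopologicalSpace H] {I : ModelWithCorners ℝ E H} [I.Boundaryless]
  {M : Type*} [TopologicalSpace M] [ChartedSpace H M] [IsManifold I ∞ M]
  {F : Type*} [NormedAddCommGroup F] [NormedSpace ℝ F]
  {p : M}

variable (I) in
/-- The derivative of the chart at `p`, with values in the model space. -/
noncomputable abbrev dchart (p q : M) :
    TangentSpace I q →L[ℝ] E :=
  mvfderiv I (extChartAt I p) q

lemma mdifferentiableAt_chart {q : M} (hq : q ∈ (chartAt H p).source) :
    MDifferentiableAt I 𝓘(ℝ, E) (extChartAt I p) q :=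
  mdifferentiableAt_extChartAt hq

variable (I) in
/-- The derivative of the inverse of the chart at `p`. -/
noncomputable def dchartSymm (p q : M) :
    E →L[ℝ] TangentSpace I q :=
  (trivializationAt E (TangentSpace I : M → Type _) p).symmL ℝ q

lemma dchart_eq {q : M} (hq : q ∈ (chartAt H p).source) :
    dchart I p q = (trivializationAt E (TangentSpace I : M → Type _) p).continuousLinearMapAt ℝ q := by
  rw [TangentBundle.continuousLinearMapAt_trivializationAt hq]
  rfl

@[simp] lemma dchart_dchartSymm {q : M} (hq : q ∈ (chartAt H p).source) (v : E) :
    dchart I p q (dchartSymm I p q v) = v := by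
  rw [dchart_eq hq, dchartSymm, Bundle.Trivialization.continuousLinearMapAt_symmL _ (by simpa)]

@[simp] lemma dchartSymm_dchart {q : M} (hq : q ∈ (chartAt H p).source) (v : TangentSpace I q) :
    dchartSymm I p q (dchart I p q v) = v := by
  rw [dchart_eq hq, dchartSymm, Bundle.Trivialization.symmL_continuousLinearMapAt _ (by simpa)]

lemma mdifferentiableAt_section_iff {X : VField I M} :
    MDifferentiableAt I I.tangent (fun x => (⟨x, X x⟩ : TangentBundle I M)) p ↔
      MDifferentiableAt I 𝓘(ℝ, E) (fun q => dchart I p q (X q)) p := by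
  rw [mdifferentiableAt_section]
  refine Filter.EventuallyEq.mdifferentiableAt_iff ?_
  filter_upwards [chart_source_mem_nhds H p] with q hq
  rw [dchart_eq hq, Bundle.Trivialization.continuousLinearMapAt_apply,
    Bundle.Trivialization.linearMapAt_apply, if_pos (by simpa)]

lemma contMDiffAt_section_iff {n : ℕ∞} {X : VField I M} :
    ContMDiffAt I I.tangent n (fun x => (⟨x, X x⟩ : TangentBundle I M)) p ↔
      ContMDiffAt I 𝓘(ℝ, E) n (fun q => dchart I p q (X q)) p := by
  rw [Bundle.contMDiffAt_section]
  refine Filter.EventuallyEq.contMDiffAt_iff ?_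
  filter_upwards [chart_source_mem_nhds H p] with q hq
  rw [dchart_eq hq, Bundle.Trivialization.continuousLinearMapAt_apply,
    Bundle.Trivialization.linearMapAt_apply, if_pos (by simpa)]

lemma mdifferentiableAt_chartSymm {q : M} (hq : q ∈ (chartAt H p).source) :
    MDifferentiableAt 𝓘(ℝ, E) I (extChartAt I p).symm (extChartAt I p q) := by
  have h := mdifferentiableWithinAt_extChartAt_symm (I := I) (x := p)
    (z := extChartAt I p q) ((extChartAt I p).map_source (by simpa using hq))
  rwa [I.range_eq_univ, mdifferentiableWithinAt_univ] at h

lemma contMDiffAt_chartSymm {q : M} (hq : q ∈ (chartAt H p).source) :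
    ContMDiffAt 𝓘(ℝ, E) I ∞ (extChartAt I p).symm (extChartAt I p q) :=
  (contMDiffOn_extChartAt_symm p).contMDiffAt
    ((isOpen_extChartAt_target p).mem_nhds ((extChartAt I p).map_source (by simpa using hq)))

lemma differentiableAt_comp_chartSymm {f : M → F} {q : M} (hq : q ∈ (chartAt H p).source)
    (hf : MDifferentiableAt I 𝓘(ℝ, F) f q) :
    DifferentiableAt ℝ (fun z => f ((extChartAt I p).symm z)) (extChartAt I p q) := by
  have e : (extChartAt I p).symm (extChartAt I p q) = q :=
    (extChartAt I p).left_inv (by simpa using hq)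
  refine MDifferentiableAt.differentiableAt ?_
  exact MDifferentiableAt.comp _ (by rwa [e]) (mdifferentiableAt_chartSymm hq)

lemma contDiffAt_comp_chartSymm {n : ℕ∞} {f : M → F} {q : M} (hq : q ∈ (chartAt H p).source)
    (hf : ContMDiffAt I 𝓘(ℝ, F) n f q) :
    ContDiffAt ℝ n (fun z => f ((extChartAt I p).symm z)) (extChartAt I p q) := by
  have e : (extChartAt I p).symm (extChartAt I p q) = q :=
    (extChartAt I p).left_inv (by simpa using hq)
  refine ContMDiffAt.contDiffAt ?_
  exact ContMDiffAt.comp _ (by rwa [e])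
    ((contMDiffAt_chartSymm hq).of_le (by exact_mod_cast le_top))

lemma mvfderiv_eq_chart {f : M → F} {q : M} (hq : q ∈ (chartAt H p).source)
    (hf : MDifferentiableAt I 𝓘(ℝ, F) f q) :
    mvfderiv I f q =
      (fderiv ℝ (fun z => f ((extChartAt I p).symm z)) (extChartAt I p q)).comp
        (dchart I p q) := by
  rw [← mvfderiv_comp_fderiv (differentiableAt_comp_chartSymm hq hf)
    (mdifferentiableAt_chart hq)]
  refine Filter.EventuallyEq.mvfderiv_eq ?_
  filter_upwards [(chartAt H p).open_source.mem_nhds hq] with z hz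
  rw [(extChartAt I p).left_inv (by simpa using hz)]

@[simp] lemma dchart_self (v : TangentSpace I p) : dchart I p p v = v := by
  have := mfderiv_extChartAt_self (I := I) (x := p)
  change mfderiv I 𝓘(ℝ, E) (extChartAt I p) p v = v
  rw [this]; rfl

/-- The chart expression of the Lie bracket. -/
lemma dchart_mlieBracket {X Y : VField I M}
    (hX : MDifferentiableAt I I.tangent (fun x => (⟨x, X x⟩ : TangentBundle I M)) p)
    (hY : MDifferentiableAt I I.tangent (fun x => (⟨x, Y x⟩ : TangentBundle I M)) p) :
    dchart I p p (VectorField.mlieBracket I X Y p) =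
      mvfderiv I (fun q => dchart I p q (Y q)) p (X p)
        - mvfderiv I (fun q => dchart I p q (X q)) p (Y p) := by
  rw [mdifferentiableAt_section_iff] at hX hY
  have hp := mem_chart_source H p
  have key : ∀ Z : VField I M,
      VectorField.mpullbackWithin 𝓘(ℝ, E) I (extChartAt I p).symm Z (Set.range I)
        =ᶠ[𝓝 (extChartAt I p p)]
          fun z => dchart I p ((extChartAt I p).symm z) (Z ((extChartAt I p).symm z)) := by
    intro Z
    filter_upwards [(isOpen_extChartAt_target (I := I) p).mem_nhds (mem_extChartAt_target p)]
      with z hz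
    rw [VectorField.mpullbackWithin_apply]
    have hz' : (extChartAt I p).symm z ∈ (chartAt H p).source := by
      simpa using (extChartAt I p).map_target hz
    have h1 := mfderiv_extChartAt_comp_mfderivWithin_extChartAt_symm (I := I) (x := p) hz
    have h2 := mfderivWithin_extChartAt_symm_comp_mfderiv_extChartAt (I := I) (x := p) hz
    rw [ContinuousLinearMap.inverse_eq h2 h1]
    rfl
  have h0 : dchart I p p (VectorField.mlieBracket I X Y p) = VectorField.lieBracket ℝ
      (fun z => dchart I p ((extChartAt I p).symm z) (X ((extChartAt I p).symm z)))
      (fun z => dchart I p ((extChartAt I p).symm z) (Y ((extChartAt I p).symm z)))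
      (extChartAt I p p) := by
    rw [← VectorField.mlieBracketWithin_univ, VectorField.mlieBracketWithin_apply]
    rw [← (key X).lieBracket_vectorField_eq (key Y)]
    simp only [Set.preimage_univ, Set.univ_inter]
    rw [I.range_eq_univ]
    exact ((isInvertible_mfderiv_extChartAt
      (mem_extChartAt_source p)).self_apply_inverse _).trans
        (congrFun (VectorField.lieBracketWithin_univ (𝕜 := ℝ) (E := E)) _)
  have e : ∀ Z : VField I M, dchart I p ((extChartAt I p).symm (extChartAt I p p))
      (Z ((extChartAt I p).symm (extChartAt I p p))) = dchart I p p (Z p) := fun Z =>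
    congrArg (fun q => dchart I p q (Z q)) (extChartAt_to_inv p)
  rw [h0, VectorField.lieBracket_eq, mvfderiv_eq_chart hp hX, mvfderiv_eq_chart hp hY]
  simp only [ContinuousLinearMap.comp_apply, e]

/-- `d² = 0` on functions. -/
lemma mvfderiv_mlieBracket {f : M → F} {X Y : VField I M} (hf : ContMDiffAt I 𝓘(ℝ, F) 2 f p)
    (hX : MDifferentiableAt I I.tangent (fun x => (⟨x, X x⟩ : TangentBundle I M)) p)
    (hY : MDifferentiableAt I I.tangent (fun x => (⟨x, Y x⟩ : TangentBundle I M)) p) :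
    mvfderiv I (fun q => mvfderiv I f q (Y q)) p (X p)
      - mvfderiv I (fun q => mvfderiv I f q (X q)) p (Y p)
      = mvfderiv I f p (VectorField.mlieBracket I X Y p) := by
  have hp := mem_chart_source H p
  have hf1 : ∀ᶠ q in 𝓝 p, MDifferentiableAt I 𝓘(ℝ, F) f q := by
    have := hf.of_le (m := 1) (by norm_num)
    filter_upwards [(contMDiffAt_iff_contMDiffAt_nhds (by simp)).1 this] with q hq
    exact hq.mdifferentiableAt (by simp)
  set g := fun z => f ((extChartAt I p).symm z) with hg
  have hg2 : ContDiffAt ℝ 2 g (extChartAt I p p) := contDiffAt_comp_chartSymm (n := 2) hp hf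
  have hg1 : DifferentiableAt ℝ (fderiv ℝ g) (extChartAt I p p) :=
    (hg2.fderiv_right (m := 1) (by norm_num)).differentiableAt (by simp)
  have hr : MDifferentiableAt I 𝓘(ℝ, E →L[ℝ] F) (fun q => fderiv ℝ g (extChartAt I p q)) p :=
    mdifferentiableAt_comp_differentiableAt hg1 (mdifferentiableAt_chart hp)
  have key : ∀ Z : VField I M, (fun q => mvfderiv I f q (Z q)) =ᶠ[𝓝 p]
      fun q => fderiv ℝ g (extChartAt I p q) (dchart I p q (Z q)) := by
    intro Z
    filter_upwards [hf1, chart_source_mem_nhds H p] with q h1 h2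
    rw [mvfderiv_eq_chart h2 h1]
    rfl
  rw [(key X).mvfderiv_eq, (key Y).mvfderiv_eq]
  have hX' := mdifferentiableAt_section_iff.1 hX
  have hY' := mdifferentiableAt_section_iff.1 hY
  rw [(mvfderiv_clm_apply hr hX').2, (mvfderiv_clm_apply hr hY').2,
    mvfderiv_eq_chart hp hf1.self_of_nhds, ContinuousLinearMap.comp_apply,
    dchart_mlieBracket hX hY, mvfderiv_comp_fderiv hg1 (mdifferentiableAt_chart hp)]
  have hs : IsSymmSndFDerivAt ℝ g (extChartAt I p p) := hg2.isSymmSndFDerivAt (by simp)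
  have := hs (dchart I p p (X p)) (dchart I p p (Y p))
  simp only [ContinuousLinearMap.comp_apply, map_sub]
  rw [this]
  abel

end Bracket

section Forms

variable {E : Type*} [NormedAddCommGroup E] [NormedSpace ℝ E] [CompleteSpace E]
  {H : Type*} [TopologicalSpace H] {I : ModelWithCorners ℝ E H} [I.Boundaryless]
  {M : Type*} [TopologicalSpace M] [ChartedSpace H M] [IsManifold I ∞ M]
  {E' : Type*} [NormedAddCommGroup E'] [NormedSpace ℝ E'] [CompleteSpace E']
  {H' : Type*} [TopologicalSpace H'] {I' : ModelWithCorners ℝ E' H'} [I'.Boundaryless]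
  {M' : Type*} [TopologicalSpace M'] [ChartedSpace H' M'] [IsManifold I' ∞ M']
  {F : Type*} [NormedAddCommGroup F] [NormedSpace ℝ F]
  {G : Type*} [NormedAddCommGroup G] [NormedSpace ℝ G]
  {p : M} {n : ℕ∞}

/-- The expression of a 1-form with values in `F` in the chart at `p`. -/
noncomputable def formRep (α : Π q : M, TangentSpace I q →L[ℝ] F) (p q : M) : E →L[ℝ] F :=
  (α q).comp (dchartSymm I p q)

/-- The 1-form `α` with values in `F` is of class `C^n` at `p`. -/
def FormAt (n : ℕ∞) (α : Π q : M, TangentSpace I q →L[ℝ] F) (p : M) : Prop :=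
  ContMDiffAt I 𝓘(ℝ, E →L[ℝ] F) n (formRep α p) p

lemma formRep_dchart (α : Π q : M, TangentSpace I q →L[ℝ] F) {q : M}
    (hq : q ∈ (chartAt H p).source) (v : TangentSpace I q) :
    formRep α p q (dchart I p q v) = α q v := by
  simp [formRep, hq]

lemma FormAt.of_le {m : ℕ∞} {α : Π q : M, TangentSpace I q →L[ℝ] F} (h : FormAt n α p)
    (hm : m ≤ n) : FormAt m α p :=
  ContMDiffAt.of_le h (by exact_mod_cast hm)

lemma FormAt.mdifferentiableAt_apply {α : Π q : M, TangentSpace I q →L[ℝ] F} (h : FormAt 1 α p)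
    {X : VField I M}
    (hX : MDifferentiableAt I I.tangent (fun x => (⟨x, X x⟩ : TangentBundle I M)) p) :
    MDifferentiableAt I 𝓘(ℝ, F) (fun q => α q (X q)) p := by
  have h1 := (mvfderiv_clm_apply (h.mdifferentiableAt (by simp))
    (mdifferentiableAt_section_iff.1 hX)).1
  refine h1.congr_of_eventuallyEq ?_
  filter_upwards [chart_source_mem_nhds H p] with q hq
  rw [formRep_dchart α hq]

lemma FormAt.contMDiffAt_apply {α : Π q : M, TangentSpace I q →L[ℝ] F} (h : FormAt n α p)
    {X : VField I M}
    (hX : ContMDiffAt I I.tangent n (fun x => (⟨x, X x⟩ : TangentBundle I M)) p) :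
    ContMDiffAt I 𝓘(ℝ, F) n (fun q => α q (X q)) p := by
  have h1 := ContMDiffAt.clm_apply h (contMDiffAt_section_iff.1 hX)
  refine h1.congr_of_eventuallyEq ?_
  filter_upwards [chart_source_mem_nhds H p] with q hq
  rw [formRep_dchart α hq]

lemma FormAt.congr {α β : Π q : M, TangentSpace I q →L[ℝ] F} (h : FormAt n α p)
    (e : ∀ᶠ q in 𝓝 p, β q = α q) : FormAt n β p := by
  refine ContMDiffAt.congr_of_eventuallyEq h ?_
  filter_upwards [e] with q hq
  simp [formRep, hq]

/-- A product `c · α` with `c` a function valued in continuous linear maps. -/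
lemma FormAt.clm_comp {α : Π q : M, TangentSpace I q →L[ℝ] F} (h : FormAt n α p)
    {c : M → F →L[ℝ] G} (hc : ContMDiffAt I 𝓘(ℝ, F →L[ℝ] G) n c p) :
    FormAt n (fun q => (c q).comp (α q)) p := by
  have h' : ContMDiffAt I 𝓘(ℝ, E →L[ℝ] F) n (formRep α p) p := h
  exact hc.clm_comp h'

lemma FormAt.const_comp {α : Π q : M, TangentSpace I q →L[ℝ] F} (h : FormAt n α p)
    (c : F →L[ℝ] G) : FormAt n (fun q => c.comp (α q)) p :=
  h.clm_comp contMDiffAt_const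

lemma FormAt.add {α β : Π q : M, TangentSpace I q →L[ℝ] F} (h : FormAt n α p)
    (h' : FormAt n β p) : FormAt n (fun q => α q + β q) p := by
  refine (ContMDiffAt.add h h').congr_of_eventuallyEq (Filter.Eventually.of_forall fun q => ?_)
  ext v; simp [formRep]

lemma FormAt.smul {α : Π q : M, TangentSpace I q →L[ℝ] F} (h : FormAt n α p)
    {c : M → ℝ} (hc : ContMDiffAt I 𝓘(ℝ, ℝ) n c p) : FormAt n (fun q => c q • α q) p := by
  refine (ContMDiffAt.smul hc h).congr_of_eventuallyEq (Filter.Eventually.of_forall fun q => ?_)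
  ext v; simp [formRep]

lemma FormAt.prod {α : Π q : M, TangentSpace I q →L[ℝ] F} {β : Π q : M, TangentSpace I q →L[ℝ] G}
    (h : FormAt n α p) (h' : FormAt n β p) : FormAt n (fun q => (α q).prod (β q)) p := by
  refine ((h.const_comp (.inl ℝ F G)).add (h'.const_comp (.inr ℝ F G))).congr
    (Filter.Eventually.of_forall fun q => ?_)
  ext v <;> simp

lemma FormAt.zero : FormAt n (fun _ => 0 : Π q : M, TangentSpace I q →L[ℝ] F) p := by
  refine (contMDiffAt_const (c := (0 : E →L[ℝ] F))).congr_of_eventuallyEq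
    (Filter.Eventually.of_forall fun q => ?_)
  ext v; simp [formRep]

lemma FormAt.sum {ι : Type*} (s : Finset ι) {α : ι → Π q : M, TangentSpace I q →L[ℝ] F}
    (h : ∀ i, FormAt n (α i) p) : FormAt n (fun q => ∑ i ∈ s, α i q) p := by
  classical
  induction s using Finset.induction_on with
  | empty => simpa using FormAt.zero
  | insert a s ha ih => simpa [Finset.sum_insert ha] using (h a).add ih

lemma FormAt.pi {ι : Type*} [Fintype ι] [DecidableEq ι]
    {α : ι → Π q : M, TangentSpace I q →L[ℝ] ℝ}
    (h : ∀ i, FormAt n (α i) p) : FormAt n (fun q => ContinuousLinearMap.pi fun i => α i q) p := by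
  refine (FormAt.sum Finset.univ fun i => (h i).const_comp
    (ContinuousLinearMap.single ℝ (fun _ : ι => ℝ) i)).congr (Filter.Eventually.of_forall fun q => ?_)
  ext v j
  simp [Pi.single_apply]

lemma eventually_mdifferentiableAt {f : M → F} (hf : ContMDiffAt I 𝓘(ℝ, F) 1 f p) :
    ∀ᶠ q in 𝓝 p, MDifferentiableAt I 𝓘(ℝ, F) f q := by
  filter_upwards [(contMDiffAt_iff_contMDiffAt_nhds (by simp)).1 hf] with q hq
  exact hq.mdifferentiableAt (by simp)

/-- The differential of a `C^(n+1)` function is of class `C^n`. -/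
lemma formAt_mvfderiv {f : M → F} (hf : ContMDiffAt I 𝓘(ℝ, F) (n + 1) f p) :
    FormAt n (mvfderiv I f) p := by
  have hp := mem_chart_source H p
  have h1 := contDiffAt_comp_chartSymm (n := n + 1) hp hf
  have h2 : ContDiffAt ℝ n (fderiv ℝ fun z => f ((extChartAt I p).symm z)) (extChartAt I p p) :=
    h1.fderiv_right (by simp)
  have h3 : ContMDiffAt I 𝓘(ℝ, E →L[ℝ] F) n
      (fun q => fderiv ℝ (fun z => f ((extChartAt I p).symm z)) (extChartAt I p q)) p :=
    h2.contMDiffAt.comp p (contMDiffAt_extChartAt)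
  refine h3.congr_of_eventuallyEq ?_
  filter_upwards [eventually_mdifferentiableAt (hf.of_le (by simp)), chart_source_mem_nhds H p]
    with q h1 h2
  ext v
  rw [formRep, mvfderiv_eq_chart h2 h1]
  simp only [ContinuousLinearMap.comp_apply, dchart_dchartSymm h2]

/-- The exterior derivative of `c · df`. -/
lemma extDeriv_clm_comp_mvfderiv {c : M → F →L[ℝ] G} {f : M → F}
    {α : Π q : M, TangentSpace I q →L[ℝ] G}
    (hα : ∀ᶠ q in 𝓝 p, α q = (c q).comp (mvfderiv I f q))
    (hc : MDifferentiableAt I 𝓘(ℝ, F →L[ℝ] G) c p)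
    (hf : ContMDiffAt I 𝓘(ℝ, F) 2 f p) {X Y : VField I M}
    (hX : MDifferentiableAt I I.tangent (fun x => (⟨x, X x⟩ : TangentBundle I M)) p)
    (hY : MDifferentiableAt I I.tangent (fun x => (⟨x, Y x⟩ : TangentBundle I M)) p) :
    mvfderiv I (fun q => α q (Y q)) p (X p) - mvfderiv I (fun q => α q (X q)) p (Y p)
      - α p (VectorField.mlieBracket I X Y p) =
    mvfderiv I c p (X p) (mvfderiv I f p (Y p)) - mvfderiv I c p (Y p) (mvfderiv I f p (X p)) := by
  have key : ∀ Z : VField I M, (fun q => α q (Z q)) =ᶠ[𝓝 p] fun q => c q (mvfderiv I f q (Z q)) := by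
    intro Z
    filter_upwards [hα] with q hq
    rw [hq]; rfl
  have hd : FormAt 1 (mvfderiv I f) p := formAt_mvfderiv (n := 1) (hf.of_le (by norm_num))
  rw [(key X).mvfderiv_eq, (key Y).mvfderiv_eq,
    (mvfderiv_clm_apply hc (hd.mdifferentiableAt_apply hX)).2,
    (mvfderiv_clm_apply hc (hd.mdifferentiableAt_apply hY)).2, hα.self_of_nhds,
    ContinuousLinearMap.comp_apply, ← mvfderiv_mlieBracket hf hX hY, map_sub]
  abel

/-- The value at `p` of the exterior derivative of a 1-form on two tangent vectors, computed in
the chart at `p`. -/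
noncomputable def dForm (α : Π q : M, TangentSpace I q →L[ℝ] F) (p : M)
    (u v : TangentSpace I p) : F :=
  mvfderiv I (formRep α p) p u (dchart I p p v) - mvfderiv I (formRep α p) p v (dchart I p p u)

lemma formRep_comp_eventually (α : Π q : M, TangentSpace I q →L[ℝ] F) :
    ∀ᶠ q in 𝓝 p, α q = (formRep α p q).comp (mvfderiv I (extChartAt I p) q) := by
  filter_upwards [chart_source_mem_nhds H p] with q hq
  ext v
  exact (formRep_dchart α hq v).symm

lemma extDeriv_eq_dForm {α : Π q : M, TangentSpace I q →L[ℝ] F} (h : FormAt 1 α p)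
    {X Y : VField I M}
    (hX : MDifferentiableAt I I.tangent (fun x => (⟨x, X x⟩ : TangentBundle I M)) p)
    (hY : MDifferentiableAt I I.tangent (fun x => (⟨x, Y x⟩ : TangentBundle I M)) p) :
    mvfderiv I (fun q => α q (Y q)) p (X p) - mvfderiv I (fun q => α q (X q)) p (Y p)
      - α p (VectorField.mlieBracket I X Y p) = dForm α p (X p) (Y p) :=
  extDeriv_clm_comp_mvfderiv (formRep_comp_eventually α) (h.mdifferentiableAt (by simp))
    contMDiffAt_extChartAt hX hY

lemma pullback_eventually {f : M → M'} (hf : ContMDiffAt I I' 1 f p)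
    (α : Π q : M', TangentSpace I' q →L[ℝ] F) :
    ∀ᶠ q in 𝓝 p, (α (f q)).comp (mfderiv I I' f q) =
      (formRep α (f p) (f q)).comp (mvfderiv I (fun z => extChartAt I' (f p) (f z)) q) := by
  have h1 : ∀ᶠ q in 𝓝 p, MDifferentiableAt I I' f q := by
    filter_upwards [(contMDiffAt_iff_contMDiffAt_nhds (by simp)).1 hf] with q hq
    exact hq.mdifferentiableAt (by simp)
  filter_upwards [h1, hf.continuousAt.preimage_mem_nhds (chart_source_mem_nhds H' (f p))]
    with q hq hq'
  rw [mvfderiv_comp_mfderiv (mdifferentiableAt_chart hq') hq]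
  ext v
  exact (formRep_dchart α hq' _).symm

lemma FormAt.pullback {f : M → M'} (hf : ContMDiffAt I I' (n + 1) f p)
    {α : Π q : M', TangentSpace I' q →L[ℝ] F} (h : FormAt n α (f p)) :
    FormAt n (fun q => (α (f q)).comp (mfderiv I I' f q)) p := by
  have h1 : FormAt n (mvfderiv I (fun z => extChartAt I' (f p) (f z))) p :=
    formAt_mvfderiv (contMDiffAt_extChartAt.comp p hf)
  have h2 : ContMDiffAt I 𝓘(ℝ, E' →L[ℝ] F) n (fun q => formRep α (f p) (f q)) p :=
    ContMDiffAt.comp p h (hf.of_le (by exact_mod_cast le_self_add))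
  refine (h1.clm_comp h2).congr (pullback_eventually (hf.of_le (by simp)) α)

/-- Exterior differentiation commutes with pullbacks. -/
lemma extDeriv_pullback {f : M → M'} (hf : ContMDiffAt I I' 2 f p)
    {α : Π q : M', TangentSpace I' q →L[ℝ] F} (h : FormAt 1 α (f p)) {X Y : VField I M}
    (hX : MDifferentiableAt I I.tangent (fun x => (⟨x, X x⟩ : TangentBundle I M)) p)
    (hY : MDifferentiableAt I I.tangent (fun x => (⟨x, Y x⟩ : TangentBundle I M)) p) :
    mvfderiv I (fun q => α (f q) (mfderiv I I' f q (Y q))) p (X p)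
      - mvfderiv I (fun q => α (f q) (mfderiv I I' f q (X q))) p (Y p)
      - α (f p) (mfderiv I I' f p (VectorField.mlieBracket I X Y p)) =
      dForm α (f p) (mfderiv I I' f p (X p)) (mfderiv I I' f p (Y p)) := by
  have hf1 : MDifferentiableAt I I' f p := hf.mdifferentiableAt (by simp)
  have hc : MDifferentiableAt I' 𝓘(ℝ, E' →L[ℝ] F) (formRep α (f p)) (f p) :=
    ContMDiffAt.mdifferentiableAt h (by simp)
  have h2 : ContMDiffAt I 𝓘(ℝ, E') 2 (fun z => extChartAt I' (f p) (f z)) p :=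
    contMDiffAt_extChartAt.comp p hf
  have := extDeriv_clm_comp_mvfderiv (pullback_eventually (hf.of_le (by norm_num)) α)
    (hc.comp p hf1) h2 hX hY
  refine this.trans ?_
  rw [mvfderiv_comp_mfderiv (mdifferentiableAt_chart (mem_chart_source H' (f p))) hf1]
  change (mvfderiv I (fun q => formRep α (f p) (f q)) p (X p)) _ -
    (mvfderiv I (fun q => formRep α (f p) (f q)) p (Y p)) _ = _
  rw [mvfderiv_comp_mfderiv hc hf1]
  rfl

end Forms

section Sections

variable {E : Type*} [NormedAddCommGroup E] [NormedSpace ℝ E] [CompleteSpace E]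
  {H : Type*} [TopologicalSpace H] {I : ModelWithCorners ℝ E H} [I.Boundaryless]
  {M : Type*} [TopologicalSpace M] [ChartedSpace H M] [IsManifold I ∞ M]
  {F : Type*} [NormedAddCommGroup F] [NormedSpace ℝ F]
  {p : M} {n : ℕ∞}

lemma oneForm_smooth_iff {α : OneForm I M} :
    ContMDiffAt I (I.prod 𝓘(ℝ, E →L[ℝ] ℝ)) n
      (fun x => Bundle.TotalSpace.mk' (E →L[ℝ] ℝ)
        (E := fun x : M => TangentSpace I x →L[ℝ] ℝ) x (α x)) p ↔ FormAt n α p := by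
  rw [contMDiffAt_hom_bundle]
  have h : (fun x => ContinuousLinearMap.inCoordinates E (TangentSpace I : M → Type _) ℝ
      (fun _ : M => ℝ) p x p x (α x)) =ᶠ[𝓝 p] formRep α p := by
    filter_upwards [chart_source_mem_nhds H p] with q hq
    rw [ContinuousLinearMap.inCoordinates_eq (by simpa using hq) (by simp)]
    ext v
    simp [formRep, dchartSymm, Bundle.Trivialization.symmL_apply _ (show q ∈ (trivializationAt E (TangentSpace I : M → Type _) p).baseSet by simpa using hq)]
  exact ⟨fun hh => hh.2.congr_of_eventuallyEq h.symm,
    fun hh => ⟨contMDiffAt_id, ContMDiffAt.congr_of_eventuallyEq hh h⟩⟩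

/-- The expression of a field of endomorphisms in the chart at `p`. -/
noncomputable def endRep (J : EndField I M) (p q : M) : E →L[ℝ] E :=
  (dchart I p q).comp ((J q).comp (dchartSymm I p q))

lemma end_smooth_iff {J : EndField I M} :
    ContMDiffAt I (I.prod 𝓘(ℝ, E →L[ℝ] E)) n
      (fun x => Bundle.TotalSpace.mk' (E →L[ℝ] E)
        (E := fun x : M => TangentSpace I x →L[ℝ] TangentSpace I x) x (J x)) p ↔
      ContMDiffAt I 𝓘(ℝ, E →L[ℝ] E) n (endRep J p) p := by
  rw [contMDiffAt_hom_bundle]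
  have h : (fun x => ContinuousLinearMap.inCoordinates E (TangentSpace I : M → Type _) E
      (TangentSpace I : M → Type _) p x p x (J x)) =ᶠ[𝓝 p] endRep J p := by
    filter_upwards [chart_source_mem_nhds H p] with q hq
    ext v
    rw [endRep, dchart_eq hq]
    rfl
  exact ⟨fun hh => hh.2.congr_of_eventuallyEq h.symm,
    fun hh => ⟨contMDiffAt_id, ContMDiffAt.congr_of_eventuallyEq hh h⟩⟩

/-- The expression of a field of bilinear forms in the chart at `p`. -/
noncomputable def tensorRep (g : Tensor2 I M) (p q : M) : E →L[ℝ] E →L[ℝ] ℝ :=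
  (ContinuousLinearMap.precomp ℝ (dchartSymm I p q)).comp ((g q).comp (dchartSymm I p q))

lemma tensorRep_apply (g : Tensor2 I M) (p q : M) (u v : E) :
    tensorRep g p q u v = g q (dchartSymm I p q u) (dchartSymm I p q v) := rfl

lemma tensor_smooth_iff {g : Tensor2 I M} :
    ContMDiffAt I (I.prod 𝓘(ℝ, E →L[ℝ] E →L[ℝ] ℝ)) n
      (fun x => Bundle.TotalSpace.mk' (E →L[ℝ] E →L[ℝ] ℝ)
        (E := fun x : M => TangentSpace I x →L[ℝ] TangentSpace I x →L[ℝ] ℝ) x (g x)) p ↔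
      ContMDiffAt I 𝓘(ℝ, E →L[ℝ] E →L[ℝ] ℝ) n (tensorRep g p) p := by
  rw [contMDiffAt_hom_bundle]
  have h : (fun x => ContinuousLinearMap.inCoordinates E (TangentSpace I : M → Type _)
      (E →L[ℝ] ℝ) (fun x : M => TangentSpace I x →L[ℝ] ℝ) p x p x (g x)) =ᶠ[𝓝 p]
        tensorRep g p := by
    filter_upwards [chart_source_mem_nhds H p] with q hq
    ext u v
    rw [inCoordinates_apply_eq₂ (by simpa using hq) (by simpa using hq) (by simp)]
    have hq' : q ∈ (trivializationAt E (TangentSpace I : M → Type _) p).baseSet := by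
      simpa using hq
    simp [tensorRep_apply, dchartSymm, Bundle.Trivialization.symmL_apply _ hq']
  exact ⟨fun hh => hh.2.congr_of_eventuallyEq h.symm,
    fun hh => ⟨contMDiffAt_id, ContMDiffAt.congr_of_eventuallyEq hh h⟩⟩

end Sections

section Extension

variable {E : Type*} [NormedAddCommGroup E] [NormedSpace ℝ E] [FiniteDimensional ℝ E]
  {H : Type*} [TopologicalSpace H] {I : ModelWithCorners ℝ E H} [I.Boundaryless]
  {M : Type*} [TopologicalSpace M] [ChartedSpace H M] [IsManifold I ∞ M] [T2Space M]
  {p : M}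

/-- Constant vector fields in a chart extend to global smooth vector fields. -/
lemma exists_smooth_constant_in_chart {x : M} (hx : x ∈ (chartAt H p).source) (c : E) :
    ∃ X : VField I M, IsSmoothVField X ∧ ∀ᶠ q in 𝓝 x, dchart I p q (X q) = c := by
  obtain ⟨f, hf, -⟩ := (SmoothBumpFunction.nhds_basis_support (I := I)
    ((chartAt H p).open_source.mem_nhds hx)).mem_iff.1 Filter.univ_mem
  refine ⟨(f : M → ℝ) • fun q => dchartSymm I p q c, ?_, ?_⟩
  · refine ContMDiffOn.smul_section_of_tsupport (SmoothBumpFunction.contMDiff (I := I) f).contMDiffOn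
      (chartAt H p).open_source hf ?_
    have := ((trivializationAt E (TangentSpace I : M → Type _) p).contMDiffOn_section_baseSet_iff
      (IB := I) (n := ∞) (s := fun q => dchartSymm I p q c)).2 ?_
    · simpa using this
    · refine (contMDiffOn_const (c := c)).congr fun q hq => ?_
      have hq' : q ∈ (chartAt H p).source := by simpa using hq
      have := dchart_dchartSymm (I := I) hq' c
      rw [dchart_eq hq', Bundle.Trivialization.continuousLinearMapAt_apply,
        Bundle.Trivialization.linearMapAt_apply, if_pos hq] at this
      exact this
  · filter_upwards [f.eventuallyEq_one, (chartAt H p).open_source.mem_nhds hx] with q h1 h2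
    simp [h1, h2]

lemma exists_smooth_eq {x : M} (v : TangentSpace I x) :
    ∃ X : VField I M, IsSmoothVField X ∧ X x = v := by
  obtain ⟨X, h1, h2⟩ := exists_smooth_constant_in_chart (I := I) (mem_chart_source H x) (dchart I x x v)
  refine ⟨X, h1, ?_⟩
  have := h2.self_of_nhds
  rw [dchart_self, dchart_self] at this
  exact this

lemma IsSmoothVField.mdiff {X : VField I M} (h : IsSmoothVField X) (x : M) :
    MDifferentiableAt I I.tangent (fun x => (⟨x, X x⟩ : TangentBundle I M)) x :=
  ContMDiffAt.mdifferentiableAt (h x) (by simp)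

/-- A 1-form with `dα = β` in the sense of vector fields has exterior derivative `β` in charts. -/
lemma HasExtDeriv₁.dForm_eq {α : OneForm I M} {β : Tensor2 I M} (hα : FormAt 1 α p)
    (h : HasExtDeriv₁ α β) (u v : TangentSpace I p) : dForm α p u v = β p u v := by
  obtain ⟨X, hX, rfl⟩ := exists_smooth_eq u
  obtain ⟨Y, hY, rfl⟩ := exists_smooth_eq v
  rw [← h X Y hX hY p, ← extDeriv_eq_dForm hα (hX.mdiff p) (hY.mdiff p)]
  rfl

end Extension

section Coframe

variable {E : Type*} [NormedAddCommGroup E] [NormedSpace ℝ E] [FiniteDimensional ℝ E]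
  {H : Type*} [TopologicalSpace H] {I : ModelWithCorners ℝ E H} [I.Boundaryless]
  {M : Type*} [TopologicalSpace M] [ChartedSpace H M] [IsManifold I ∞ M]
  {F : Type*} [NormedAddCommGroup F] [NormedSpace ℝ F] [FiniteDimensional ℝ F]
  {p : M}

/-- Sections of the tangent bundle that are differentiable at `p`. -/
abbrev MDiffField (Y : VField I M) (p : M) : Prop :=
  MDifferentiableAt I I.tangent (fun x => (⟨x, Y x⟩ : TangentBundle I M)) p

/-- At the point `q`, `Φ` is a smooth coframe with values in `F`, with inverse `Ψ`, for which `g`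
has the coefficients `B`; and `A` is the smooth connection form, in this coframe, of the
Levi-Civita connection of `g`. -/
structure IsConnCoframe (g : Tensor2 I M) (B : M → F →L[ℝ] F →L[ℝ] ℝ)
    (Φ : Π q : M, TangentSpace I q →L[ℝ] F) (Ψ : Π q : M, F →L[ℝ] TangentSpace I q)
    (A : M → F →L[ℝ] F →L[ℝ] F) (q : M) : Prop where
  smooth : FormAt ⊤ Φ q
  smooth_conn : ContMDiffAt I 𝓘(ℝ, F →L[ℝ] F →L[ℝ] F) ∞ A q
  left_inv : ∀ v, Ψ q (Φ q v) = v
  right_inv : ∀ w, Φ q (Ψ q w) = w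
  smooth_metric : ContMDiffAt I 𝓘(ℝ, F →L[ℝ] F →L[ℝ] ℝ) ∞ B q
  metric : ∀ u v, g q u v = B q (Φ q u) (Φ q v)
  compat : ∀ u v w, mvfderiv I B q u v w = B q (A q (Φ q u) v) w + B q v (A q (Φ q u) w)
  torsion : ∀ u v, dForm Φ q u v = A q (Φ q v) (Φ q u) - A q (Φ q u) (Φ q v)

/-- The covariant derivative with connection form `A` in the coframe `Φ`. -/
noncomputable def coframeCov (Φ : Π q : M, TangentSpace I q →L[ℝ] F)
    (Ψ : Π q : M, F →L[ℝ] TangentSpace I q) (A : M → F →L[ℝ] F →L[ℝ] F)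
    (Y : VField I M) (p : M) : TangentSpace I p →L[ℝ] TangentSpace I p :=
  (Ψ p).comp (mvfderiv I (fun q => Φ q (Y q)) p + ((A p).flip (Φ p (Y p))).comp (Φ p))

lemma coframeCov_apply (Φ : Π q : M, TangentSpace I q →L[ℝ] F)
    (Ψ : Π q : M, F →L[ℝ] TangentSpace I q) (A : M → F →L[ℝ] F →L[ℝ] F)
    (Y : VField I M) (p : M) (v : TangentSpace I p) :
    coframeCov Φ Ψ A Y p v =
      Ψ p (mvfderiv I (fun q => Φ q (Y q)) p v + A p (Φ p v) (Φ p (Y p))) := rfl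

/-- At the point `p`, the operator `D` is a torsion-free and metric derivation on differentiable
fields. -/
structure IsLeviCivitaAt (g : Tensor2 I M) (D : VField I M → TangentSpace I p →L[ℝ] TangentSpace I p) :
    Prop where
  metric : ∀ Y Z : VField I M, MDiffField Y p → MDiffField Z p → ∀ v,
    mvfderiv I (fun y => g y (Y y) (Z y)) p v = g p (D Y v) (Z p) + g p (Y p) (D Z v)
  torsion_free : ∀ X Y : VField I M, MDiffField X p → MDiffField Y p →
    D Y (X p) - D X (Y p) = VectorField.mlieBracket I X Y p

lemma IsLeviCivitaAt.unique {g : Tensor2 I M}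
    (hsymm : ∀ u v, g p u v = g p v u) (hnd : ∀ u, g p u u = 0 → u = 0)
    {D D' : VField I M → TangentSpace I p →L[ℝ] TangentSpace I p}
    (h : IsLeviCivitaAt g D) (h' : IsLeviCivitaAt g D') {Y : VField I M} (hY : MDiffField Y p)
    (v : TangentSpace I p) : D Y v = D' Y v := by
  have ext : ∀ u : TangentSpace I p, ∃ X : VField I M, MDiffField X p ∧ X p = u := fun u =>
    ⟨FiberBundle.extend E u, FiberBundle.mdifferentiableAt_extend I E u,
      FiberBundle.extend_apply_self E u⟩
  have sym : ∀ X Y : VField I M, MDiffField X p → MDiffField Y p →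
      D Y (X p) - D' Y (X p) = D X (Y p) - D' X (Y p) := by
    intro X Y hX hY
    have e := (h.torsion_free X Y hX hY).trans (h'.torsion_free X Y hX hY).symm
    rw [sub_eq_sub_iff_add_eq_add] at e ⊢
    rw [e, add_comm]
  have skew : ∀ X Y Z : VField I M, MDiffField X p → MDiffField Y p → MDiffField Z p →
      g p (D Y (X p) - D' Y (X p)) (Z p) = - g p (D Z (X p) - D' Z (X p)) (Y p) := by
    intro X Y Z hX hY hZ
    have e := (h.metric Y Z hY hZ (X p)).symm.trans (h'.metric Y Z hY hZ (X p))
    rw [hsymm (Y p), hsymm (Y p)] at e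
    simp only [map_sub, sub_apply]
    linarith
  obtain ⟨X, hX, rfl⟩ := ext v
  refine sub_eq_zero.1 (hnd _ ?_)
  obtain ⟨Z, hZ, hZe⟩ := ext (D Y (X p) - D' Y (X p))
  nth_rewrite 2 [← hZe]
  have e1 := skew X Y Z hX hY hZ
  rw [sym X Z hX hZ] at e1
  have e2 := skew Z X Y hZ hX hY
  rw [sym Z Y hZ hY] at e2
  have e3 := skew Y Z X hY hZ hX
  rw [sym Y X hY hX] at e3
  linarith

section Local

variable {g : Tensor2 I M} {B : M → F →L[ℝ] F →L[ℝ] ℝ}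
  {Φ : Π q : M, TangentSpace I q →L[ℝ] F} {Ψ : Π q : M, F →L[ℝ] TangentSpace I q}
  {A : M → F →L[ℝ] F →L[ℝ] F}

lemma IsConnCoframe.mdiff_apply (h : IsConnCoframe g B Φ Ψ A p) {Y : VField I M}
    (hY : MDiffField Y p) : MDifferentiableAt I 𝓘(ℝ, F) (fun q => Φ q (Y q)) p :=
  (h.smooth.of_le (by simp)).mdifferentiableAt_apply hY

lemma coframeCov_isLeviCivitaAt (h : ∀ᶠ q in 𝓝 p, IsConnCoframe g B Φ Ψ A q) :
    IsLeviCivitaAt g (fun Y => coframeCov Φ Ψ A Y p) := by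
  have hp := h.self_of_nhds
  constructor
  · intro Y Z hY hZ v
    have e : (fun y => g y (Y y) (Z y)) =ᶠ[𝓝 p] fun y => B y (Φ y (Y y)) (Φ y (Z y)) := by
      filter_upwards [h] with q hq using hq.metric _ _
    rw [e.mvfderiv_eq, (mvfderiv_clm_apply₂ (hp.smooth_metric.mdifferentiableAt (by simp))
      (hp.mdiff_apply hY) (hp.mdiff_apply hZ)).2]
    simp only [hp.metric, coframeCov_apply, hp.right_inv, hp.compat, map_add, add_apply]
    ring
  · intro X Y hX hY
    have e := extDeriv_eq_dForm (hp.smooth.of_le (by simp)) hX hY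
    rw [hp.torsion] at e
    simp only [coframeCov_apply]
    rw [← map_sub, ← hp.left_inv (VectorField.mlieBracket I X Y p)]
    congr 1
    rw [sub_eq_iff_eq_add] at e
    rw [add_sub_add_comm, e]
    abel

/-- The inverse of a smooth coframe is smooth. -/
lemma contMDiffAt_coframe_inverse {n : ℕ∞} (hΦ : FormAt n Φ p)
    (hl : ∀ᶠ q in 𝓝 p, ∀ v, Ψ q (Φ q v) = v) (hr : ∀ᶠ q in 𝓝 p, ∀ w, Φ q (Ψ q w) = w) :
    ContMDiffAt I 𝓘(ℝ, F →L[ℝ] E) n (fun q => (dchart I p q).comp (Ψ q)) p := by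
  have hlp := hl.self_of_nhds
  have hrp := hr.self_of_nhds
  have e : (fun q => (dchart I p q).comp (Ψ q)) =ᶠ[𝓝 p]
      fun q => ContinuousLinearMap.inverse (formRep Φ p q) := by
    filter_upwards [hl, hr, chart_source_mem_nhds H p] with q hq1 hq2 hq'
    refine (ContinuousLinearMap.inverse_eq ?_ ?_).symm
    · ext v; simp [formRep, hq', hq2]
    · ext v; simp [formRep, hq', hq1]
  refine ContMDiffAt.congr_of_eventuallyEq ?_ e
  have hinv : ContDiffAt ℝ n (ContinuousLinearMap.inverse : (E →L[ℝ] F) → _) (formRep Φ p p) := by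
    have hq' := mem_chart_source H p
    let e : E ≃L[ℝ] F := ContinuousLinearEquiv.equivOfInverse (formRep Φ p p)
      ((dchart I p p).comp (Ψ p))
      (fun v => by simp only [formRep, ContinuousLinearMap.comp_apply, hlp,
        dchart_dchartSymm hq'])
      (fun v => by simp only [formRep, ContinuousLinearMap.comp_apply, dchartSymm_dchart hq',
        hrp])
    exact contDiffAt_map_inverse e
  exact hinv.contMDiffAt.comp p hΦ

lemma IsConnCoframe.contMDiffAt_frameRep {n : ℕ∞} (h : ∀ᶠ q in 𝓝 p, IsConnCoframe g B Φ Ψ A q) :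
    ContMDiffAt I 𝓘(ℝ, F →L[ℝ] E) n (fun q => (dchart I p q).comp (Ψ q)) p :=
  contMDiffAt_coframe_inverse (h.self_of_nhds.smooth.of_le le_top) (h.mono fun _ hq => hq.left_inv)
    (h.mono fun _ hq => hq.right_inv)

/-- Fields are differentiable as soon as their components in a coframe are. -/
lemma mdiffField_iff_coframe (h : ∀ᶠ q in 𝓝 p, IsConnCoframe g B Φ Ψ A q) {Y : VField I M} :
    MDiffField Y p ↔ MDifferentiableAt I 𝓘(ℝ, F) (fun q => Φ q (Y q)) p := by
  refine ⟨h.self_of_nhds.mdiff_apply, fun hY => mdifferentiableAt_section_iff.2 ?_⟩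
  have h1 := (mvfderiv_clm_apply ((IsConnCoframe.contMDiffAt_frameRep (n := 1)
    h).mdifferentiableAt (by simp)) hY).1
  refine h1.congr_of_eventuallyEq ?_
  filter_upwards [h] with q hq
  simp [hq.left_inv]

/-- The curvature endomorphism `x ↦ R(x, y) z` of a connection form with value `A` and derivative
`dA`, where the torsion vanishes. -/
noncomputable def curvEnd (dA : F →L[ℝ] F →L[ℝ] F →L[ℝ] F) (A : F →L[ℝ] F →L[ℝ] F) (y z : F) :
    F →L[ℝ] F :=
  (dA.flip y).flip z - (dA y).flip z + (A.flip z).comp (A y - A.flip y) + A.flip (A y z)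
    - (A y).comp (A.flip z)

lemma curvEnd_apply (dA : F →L[ℝ] F →L[ℝ] F →L[ℝ] F) (A : F →L[ℝ] F →L[ℝ] F) (y z x : F) :
    curvEnd dA A y z x =
      dA x y z - dA y x z + A (A y x - A x y) z + A x (A y z) - A y (A x z) := rfl

end Local

section Global

variable {g : Tensor2 I M} {B : M → M → F →L[ℝ] F →L[ℝ] ℝ}
  {Φ : M → Π q : M, TangentSpace I q →L[ℝ] F} {Ψ : M → Π q : M, F →L[ℝ] TangentSpace I q}
  {A : M → M → F →L[ℝ] F →L[ℝ] F}

/-- The Levi-Civita connection of a metric which near each point has a coframe with a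
connection form. -/
noncomputable def coframeConnection (h : ∀ p, ∀ᶠ q in 𝓝 p, IsConnCoframe g (B p) (Φ p) (Ψ p) (A p) q) :
    AffineConnection I M where
  toFun Y p := coframeCov (Φ p) (Ψ p) (A p) Y p
  isCovariantDerivativeOnUniv := by
    constructor
    · intro Y Z x hY hZ _
      have hx := (h x).self_of_nhds
      have h1 := hx.mdiff_apply hY
      have h2 := hx.mdiff_apply hZ
      ext v
      simp only [coframeCov_apply, add_apply, Pi.add_apply, map_add]
      have : mvfderiv I (fun q => Φ x q (Y q) + Φ x q (Z q)) x = _ := mvfderiv_add h1 h2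
      rw [this]
      simp only [map_add, add_apply]
      abel
    · intro Y f x hY hf _
      have hx := (h x).self_of_nhds
      have h1 := hx.mdiff_apply hY
      ext v
      have h2 : mvfderiv I (fun q => f q • Φ x q (Y q)) x = _ := mvfderiv_smul hf h1
      simp only [coframeCov_apply, add_apply, Pi.smul_apply', map_smul,
        smul_apply, ContinuousLinearMap.smulRight_apply]
      rw [h2]
      simp only [map_add, map_smul, hx.left_inv, smul_add, add_apply, smul_apply,
        ContinuousLinearMap.smulRight_apply]
      abel

variable (h : ∀ p, ∀ᶠ q in 𝓝 p, IsConnCoframe g (B p) (Φ p) (Ψ p) (A p) q)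

lemma coframeConnection_isLeviCivitaAt (p : M) :
    IsLeviCivitaAt g (fun Y => coframeConnection h Y p) :=
  coframeCov_isLeviCivitaAt (h p)

lemma coframeConnection_eq (hsymm : ∀ p u v, g p u v = g p v u)
    (hnd : ∀ p u, g p u u = 0 → u = 0) {p : M} {Φ' : Π q : M, TangentSpace I q →L[ℝ] F}
    {Ψ' : Π q : M, F →L[ℝ] TangentSpace I q} {A' : M → F →L[ℝ] F →L[ℝ] F}
    {B' : M → F →L[ℝ] F →L[ℝ] ℝ}
    (h' : ∀ᶠ q in 𝓝 p, IsConnCoframe g B' Φ' Ψ' A' q) {Y : VField I M} (hY : MDiffField Y p)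
    (v : TangentSpace I p) :
    coframeConnection h Y p v = coframeCov Φ' Ψ' A' Y p v :=
  (coframeConnection_isLeviCivitaAt h p).unique (hsymm p) (hnd p)
    (coframeCov_isLeviCivitaAt h') hY v

lemma contMDiffField_eventually {Y : VField I M}
    (hY : ContMDiffAt I I.tangent 2 (fun x => (⟨x, Y x⟩ : TangentBundle I M)) p) :
    ∀ᶠ q in 𝓝 p, MDiffField Y q := by
  filter_upwards [(contMDiffAt_iff_contMDiffAt_nhds (by simp)).1 hY] with q hq
  exact hq.mdifferentiableAt (by simp)

/-- The covariant derivative of a twice differentiable field along a differentiable field, and its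
derivative, computed in a coframe. -/
lemma mdiffField_coframeConnection (hsymm : ∀ p u v, g p u v = g p v u)
    (hnd : ∀ p u, g p u u = 0 → u = 0) {p : M} {Φ' : Π q : M, TangentSpace I q →L[ℝ] F}
    {Ψ' : Π q : M, F →L[ℝ] TangentSpace I q} {A' : M → F →L[ℝ] F →L[ℝ] F}
    {B' : M → F →L[ℝ] F →L[ℝ] ℝ}
    (h' : ∀ᶠ q in 𝓝 p, IsConnCoframe g B' Φ' Ψ' A' q) {W Z : VField I M} (hW : MDiffField W p)
    (hZ : ContMDiffAt I I.tangent 2 (fun x => (⟨x, Z x⟩ : TangentBundle I M)) p) :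
    MDiffField (fun y => coframeConnection h Z y (W y)) p ∧
      ∀ v, mvfderiv I (fun y => Φ' y (coframeConnection h Z y (W y))) p v =
        mvfderiv I (fun q => mvfderiv I (fun q => Φ' q (Z q)) q (W q)) p v
          + (mvfderiv I A' p v (Φ' p (W p)) (Φ' p (Z p))
            + A' p (mvfderiv I (fun q => Φ' q (W q)) p v) (Φ' p (Z p))
            + A' p (Φ' p (W p)) (mvfderiv I (fun q => Φ' q (Z q)) p v)) := by
  have hp := h'.self_of_nhds
  have hz2 : ContMDiffAt I 𝓘(ℝ, F) 2 (fun q => Φ' q (Z q)) p :=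
    (hp.smooth.of_le (n := ⊤) (m := 2) le_top).contMDiffAt_apply hZ
  have hdz : FormAt 1 (mvfderiv I (fun q => Φ' q (Z q))) p :=
    formAt_mvfderiv (n := 1) (hz2.of_le (by norm_num))
  have hA : MDifferentiableAt I 𝓘(ℝ, F →L[ℝ] F →L[ℝ] F) A' p :=
    hp.smooth_conn.mdifferentiableAt (by simp)
  have hz1 : MDifferentiableAt I 𝓘(ℝ, F) (fun q => Φ' q (Z q)) p := hz2.mdifferentiableAt (by simp)
  have e : (fun y => Φ' y (coframeConnection h Z y (W y))) =ᶠ[𝓝 p] fun q =>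
      mvfderiv I (fun q => Φ' q (Z q)) q (W q) + A' q (Φ' q (W q)) (Φ' q (Z q)) := by
    filter_upwards [h'.eventually_nhds, contMDiffField_eventually hZ] with q hq hqZ
    rw [coframeConnection_eq h hsymm hnd hq hqZ, coframeCov_apply, hq.self_of_nhds.right_inv]
  have h1 := hdz.mdifferentiableAt_apply hW
  obtain ⟨h2, h3⟩ := mvfderiv_clm_apply₂ hA (hp.mdiff_apply hW) hz1
  have h4 : mvfderiv I (fun q => mvfderiv I (fun q => Φ' q (Z q)) q (W q)
    + A' q (Φ' q (W q)) (Φ' q (Z q))) p = _ := mvfderiv_add h1 h2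
  refine ⟨(mdiffField_iff_coframe h').2 ((h1.add h2).congr_of_eventuallyEq e), fun v => ?_⟩
  rw [e.mvfderiv_eq, h4, add_apply, h3]

/-- The curvature, computed in a coframe. -/
lemma curvature_coframeConnection (hsymm : ∀ p u v, g p u v = g p v u)
    (hnd : ∀ p u, g p u u = 0 → u = 0) {p : M} {Φ' : Π q : M, TangentSpace I q →L[ℝ] F}
    {Ψ' : Π q : M, F →L[ℝ] TangentSpace I q} {A' : M → F →L[ℝ] F →L[ℝ] F}
    {B' : M → F →L[ℝ] F →L[ℝ] ℝ}
    (h' : ∀ᶠ q in 𝓝 p, IsConnCoframe g B' Φ' Ψ' A' q) {X Y Z : VField I M}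
    (hX : MDiffField X p) (hY : MDiffField Y p)
    (hZ : ContMDiffAt I I.tangent 2 (fun x => (⟨x, Z x⟩ : TangentBundle I M)) p) :
    curvature (coframeConnection h) X Y Z p =
      Ψ' p (curvEnd ((mvfderiv I A' p).comp (Ψ' p)) (A' p) (Φ' p (Y p)) (Φ' p (Z p))
        (Φ' p (X p))) := by
  have hp := h'.self_of_nhds
  have hz2 : ContMDiffAt I 𝓘(ℝ, F) 2 (fun q => Φ' q (Z q)) p :=
    (hp.smooth.of_le (n := ⊤) (m := 2) le_top).contMDiffAt_apply hZ
  have val : ∀ W : VField I M, MDiffField W p → ∀ v,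
      coframeConnection h W p v = Ψ' p (mvfderiv I (fun q => Φ' q (W q)) p v
        + A' p (Φ' p v) (Φ' p (W p))) := fun W hW v => by
    rw [coframeConnection_eq h hsymm hnd h' hW, coframeCov_apply]
  have hZ1 := hZ.mdifferentiableAt (by simp)
  obtain ⟨hX1, hX2⟩ := mdiffField_coframeConnection h hsymm hnd h' hX hZ
  obtain ⟨hY1, hY2⟩ := mdiffField_coframeConnection h hsymm hnd h' hY hZ
  rw [curvature, val _ hY1, val _ hX1, val _ hZ1, hX2, hY2, val _ hZ1, val _ hZ1,
    ← mvfderiv_mlieBracket hz2 hX hY, ← map_sub, ← map_sub, curvEnd_apply]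
  have e := extDeriv_eq_dForm (hp.smooth.of_le (by simp)) hX hY
  rw [hp.torsion, sub_eq_iff_eq_add, ← sub_eq_iff_eq_add'] at e
  congr 1
  rw [← e]
  simp only [hp.right_inv, map_add, map_sub, sub_apply, ContinuousLinearMap.comp_apply,
    hp.left_inv]
  abel

end Global
end Coframe

section Coframe

variable {E : Type*} [NormedAddCommGroup E] [NormedSpace ℝ E] [FiniteDimensional ℝ E]
  {H : Type*} [TopologicalSpace H] {I : ModelWithCorners ℝ E H} [I.Boundaryless]
  {M : Type*} [TopologicalSpace M] [ChartedSpace H M] [IsManifold I ∞ M]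
  {F : Type*} [NormedAddCommGroup F] [NormedSpace ℝ F] [FiniteDimensional ℝ F]

section Curvature

variable {g : Tensor2 I M} {B : M → M → F →L[ℝ] F →L[ℝ] ℝ}
  {Φ : M → Π q : M, TangentSpace I q →L[ℝ] F} {Ψ : M → Π q : M, F →L[ℝ] TangentSpace I q}
  {A : M → M → F →L[ℝ] F →L[ℝ] F}
  (h : ∀ p, ∀ᶠ q in 𝓝 p, IsConnCoframe g (B p) (Φ p) (Ψ p) (A p) q)

/-- The Ricci tensor, computed in a coframe. -/
lemma ricci_coframeConnection (hsymm : ∀ p u v, g p u v = g p v u)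
    (hnd : ∀ p u, g p u u = 0 → u = 0) {p : M} {Φ' : Π q : M, TangentSpace I q →L[ℝ] F}
    {Ψ' : Π q : M, F →L[ℝ] TangentSpace I q} {A' : M → F →L[ℝ] F →L[ℝ] F}
    {B' : M → F →L[ℝ] F →L[ℝ] ℝ}
    (h' : ∀ᶠ q in 𝓝 p, IsConnCoframe g B' Φ' Ψ' A' q) (v w : TangentSpace I p) :
    ricci (coframeConnection h) p v w = LinearMap.trace ℝ F
      (curvEnd ((mvfderiv I A' p).comp (Ψ' p)) (A' p) (Φ' p v) (Φ' p w) : F →ₗ[ℝ] F) := by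
  have hp := h'.self_of_nhds
  let e : TangentSpace I p ≃ₗ[ℝ] F := LinearEquiv.ofLinearMap (Φ' p : TangentSpace I p →ₗ[ℝ] F)
    (Ψ' p : F →ₗ[ℝ] TangentSpace I p) (LinearMap.ext hp.right_inv) (LinearMap.ext hp.left_inv)
  rw [← LinearMap.trace_conj' _ e.symm, LinearMap.trace_eq_matrix_trace ℝ (tangentBasis p),
    Matrix.trace, ricci]
  refine Finset.sum_congr rfl fun i _ => ?_
  rw [curvature_coframeConnection h hsymm hnd h' (FiberBundle.mdifferentiableAt_extend I E _)
    (FiberBundle.mdifferentiableAt_extend I E _) (FiberBundle.contMDiffAt_extend I E _),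
    FiberBundle.extend_apply_self, FiberBundle.extend_apply_self, FiberBundle.extend_apply_self,
    Matrix.diag_apply, LinearMap.toMatrix_apply]
  rfl

end Curvature

lemma scalarCurvature_eq [IsManifold I 1 M] (g : RiemMetric I M) (D : AffineConnection I M) {c : ℝ}
    {x : M} (hc : ∀ v w, ricci D x v w = c * g.inner x v w) :
    scalarCurvature g D x = c * Module.finrank ℝ E := by
  set G : Matrix (Fin (Module.finrank ℝ E)) (Fin (Module.finrank ℝ E)) ℝ :=
    Matrix.of fun i j => g.inner x (tangentBasis x i) (tangentBasis x j) with hG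
  have h1 : (Matrix.of fun i j => ricci D x (tangentBasis x i) (tangentBasis x j)) = c • G := by
    ext i j
    simp [hc, hG]
  have h2 : G.det ≠ 0 := by
    intro h0
    obtain ⟨v, hv, hv'⟩ := Matrix.exists_mulVec_eq_zero_iff.2 h0
    refine hv ?_
    by_contra hne
    let u : TangentSpace I x := ∑ j, v j • tangentBasis x j
    have hu0 : ∀ i, g.inner x (tangentBasis x i) u = 0 := by
      intro i
      have := congrFun hv' i
      simp only [Matrix.mulVec, dotProduct, hG, Matrix.of_apply, Pi.zero_apply] at this
      simp only [u, map_sum, map_smul, smul_eq_mul]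
      rw [← this]
      exact Finset.sum_congr rfl fun j _ => mul_comm _ _
    have hu : u ≠ 0 := by
      intro hu
      have := (Fintype.linearIndependent_iff.1 (tangentBasis (I := I) x).linearIndependent) v hu
      exact hne (funext this)
    have := g.pos x u hu
    have h3 : g.inner x u u = 0 := by
      have : g.inner x u u = ∑ j, v j * g.inner x (tangentBasis x j) u := by
        conv_lhs => rw [show g.inner x u = g.inner x (∑ j, v j • tangentBasis x j) from rfl]
        simp only [map_sum, map_smul, sum_apply, smul_apply, smul_eq_mul]
      rw [this]
      simp [hu0]
    linarith
  rw [scalarCurvature, h1, Matrix.mul_smul, Matrix.nonsing_inv_mul _ (isUnit_iff_ne_zero.2 h2)]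
  simp

/-! ### Covariant derivatives of endomorphisms -/

/-- `K` is the value at `p` of the covariant derivative of `J`. -/
def HasEndCov (D : AffineConnection I M) (J : EndField I M) (p : M)
    (K : TangentSpace I p → TangentSpace I p → TangentSpace I p) : Prop :=
  ∀ Y : VField I M, MDiffField Y p → MDiffField (fun q => J q (Y q)) p ∧
    ∀ v, D (fun q => J q (Y q)) p v = J p (D Y p v) + K v (Y p)

section

variable {g : Tensor2 I M} {B : M → M → F →L[ℝ] F →L[ℝ] ℝ}
  {Φ : M → Π q : M, TangentSpace I q →L[ℝ] F} {Ψ : M → Π q : M, F →L[ℝ] TangentSpace I q}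
  {A : M → M → F →L[ℝ] F →L[ℝ] F}
  (h : ∀ p, ∀ᶠ q in 𝓝 p, IsConnCoframe g (B p) (Φ p) (Ψ p) (A p) q)

/-- The covariant derivative of an endomorphism field, computed in a coframe. -/
lemma hasEndCov_coframeConnection (hsymm : ∀ p u v, g p u v = g p v u)
    (hnd : ∀ p u, g p u u = 0 → u = 0) {p : M} {Φ' : Π q : M, TangentSpace I q →L[ℝ] F}
    {Ψ' : Π q : M, F →L[ℝ] TangentSpace I q} {A' : M → F →L[ℝ] F →L[ℝ] F}
    {B' : M → F →L[ℝ] F →L[ℝ] ℝ}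
    (h' : ∀ᶠ q in 𝓝 p, IsConnCoframe g B' Φ' Ψ' A' q) {J : EndField I M} {j : M → F →L[ℝ] F}
    (hj : MDifferentiableAt I 𝓘(ℝ, F →L[ℝ] F) j p)
    (hJ : ∀ᶠ q in 𝓝 p, ∀ v, Φ' q (J q v) = j q (Φ' q v)) :
    HasEndCov (coframeConnection h) J p fun v y => Ψ' p (mvfderiv I j p v (Φ' p y)
      + A' p (Φ' p v) (j p (Φ' p y)) - j p (A' p (Φ' p v) (Φ' p y))) := by
  intro Y hY
  have hp := h'.self_of_nhds
  have e : (fun q => Φ' q (J q (Y q))) =ᶠ[𝓝 p] fun q => j q (Φ' q (Y q)) := by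
    filter_upwards [hJ] with q hq using hq _
  obtain ⟨h1, h2⟩ := mvfderiv_clm_apply hj (hp.mdiff_apply hY)
  have h3 : MDiffField (fun q => J q (Y q)) p :=
    (mdiffField_iff_coframe h').2 (h1.congr_of_eventuallyEq e)
  refine ⟨h3, fun v => ?_⟩
  rw [coframeConnection_eq h hsymm hnd h' h3, coframeConnection_eq h hsymm hnd h' hY,
    ← hp.left_inv (J p _), hJ.self_of_nhds, coframeCov_apply, coframeCov_apply, e.mvfderiv_eq, h2,
    hp.right_inv, hJ.self_of_nhds, ← map_add]
  congr 1
  rw [map_add]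
  abel

lemma smoothEnd_of_coframe {p : M} {n : ℕ∞} {Φ' : Π q : M, TangentSpace I q →L[ℝ] F}
    {Ψ' : Π q : M, F →L[ℝ] TangentSpace I q} {A' : M → F →L[ℝ] F →L[ℝ] F}
    {B' : M → F →L[ℝ] F →L[ℝ] ℝ}
    (h' : ∀ᶠ q in 𝓝 p, IsConnCoframe g B' Φ' Ψ' A' q) {J : EndField I M} {j : M → F →L[ℝ] F}
    (hj : ContMDiffAt I 𝓘(ℝ, F →L[ℝ] F) n j p)
    (hJ : ∀ᶠ q in 𝓝 p, ∀ v, Φ' q (J q v) = j q (Φ' q v)) :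
    ContMDiffAt I (I.prod 𝓘(ℝ, E →L[ℝ] E)) n
      (fun x => Bundle.TotalSpace.mk' (E →L[ℝ] E)
        (E := fun x : M => TangentSpace I x →L[ℝ] TangentSpace I x) x (J x)) p := by
  rw [end_smooth_iff]
  have h1 := IsConnCoframe.contMDiffAt_frameRep (n := n) h'
  have h2 : ContMDiffAt I 𝓘(ℝ, E →L[ℝ] F) n (formRep Φ' p) p :=
    h'.self_of_nhds.smooth.of_le le_top
  refine ((h1.clm_comp hj).clm_comp h2).congr_of_eventuallyEq ?_
  filter_upwards [h', hJ] with q hq hq'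
  ext v
  simp only [endRep, ContinuousLinearMap.comp_apply, formRep, ← hq', hq.left_inv]

end

section LeviCivita

variable {g : RiemMetric I M} {D : AffineConnection I M} {p : M}

lemma isLeviCivita_of_forall (h : ∀ p, IsLeviCivitaAt g.inner (fun Y => D Y p)) :
    IsLeviCivita g D where
  metric X Y Z hX hY hZ x := (h x).metric Y Z (ContMDiffAt.mdifferentiableAt (hY x) (by simp))
    (ContMDiffAt.mdifferentiableAt (hZ x) (by simp)) _
  torsion_free X Y hX hY x := (h x).torsion_free X Y
    (ContMDiffAt.mdifferentiableAt (hX x) (by simp))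
    (ContMDiffAt.mdifferentiableAt (hY x) (by simp))

lemma nijenhuis_eq (h : IsLeviCivitaAt g.inner (fun Y => D Y p)) {J : EndField I M}
    (hJ : ∀ v, J p (J p v) = -v) {K : TangentSpace I p → TangentSpace I p → TangentSpace I p}
    (hK : HasEndCov D J p K) {X Y : VField I M} (hX : MDiffField X p) (hY : MDiffField Y p) :
    nijenhuis J X Y p = K (J p (X p)) (Y p) - K (J p (Y p)) (X p)
      - J p (K (X p) (Y p) - K (Y p) (X p)) := by
  obtain ⟨hX1, hX2⟩ := hK X hX
  obtain ⟨hY1, hY2⟩ := hK Y hY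
  rw [nijenhuis, ← h.torsion_free _ _ hX1 hY1, ← h.torsion_free _ _ hX1 hY,
    ← h.torsion_free _ _ hX hY1, ← h.torsion_free _ _ hX hY, hX2, hX2, hY2, hY2]
  simp only [map_sub, map_add, hJ]
  abel

lemma mdifferentiableAt_inner {Y Z : VField I M}
    (hY : MDiffField Y p) (hZ : MDiffField Z p) :
    MDifferentiableAt I 𝓘(ℝ, ℝ) (fun q => g.inner q (Y q) (Z q)) p := by
  have h1 : ContMDiffAt I 𝓘(ℝ, E →L[ℝ] E →L[ℝ] ℝ) 1 (tensorRep g.inner p) p :=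
    tensor_smooth_iff.1 ((g.contMDiff p).of_le (by simp))
  have h2 := (mvfderiv_clm_apply₂ (h1.mdifferentiableAt (by simp))
    (mdifferentiableAt_section_iff.1 hY) (mdifferentiableAt_section_iff.1 hZ)).1
  refine h2.congr_of_eventuallyEq ?_
  filter_upwards [chart_source_mem_nhds H p] with q hq
  rw [tensorRep_apply, dchartSymm_dchart hq, dchartSymm_dchart hq]

lemma mvfderiv_fundForm (h : IsLeviCivitaAt g.inner (fun Y => D Y p)) {J : EndField I M}
    {K : TangentSpace I p → TangentSpace I p → TangentSpace I p}
    (hK : HasEndCov D J p K) {Y Z : VField I M} (hY : MDiffField Y p) (hZ : MDiffField Z p) :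
    MDifferentiableAt I 𝓘(ℝ, ℝ) (fun q => fundForm g.inner J q (Y q) (Z q)) p ∧
    ∀ v, mvfderiv I (fun q => fundForm g.inner J q (Y q) (Z q)) p v =
      fundForm g.inner J p (D Y p v) (Z p) + fundForm g.inner J p (Y p) (D Z p v)
        + g.inner p (K v (Y p)) (Z p) := by
  obtain ⟨h1, h2⟩ := hK Y hY
  refine ⟨mdifferentiableAt_inner h1 hZ, fun v => ?_⟩
  have := h.metric _ _ h1 hZ v
  refine this.trans ?_
  simp only [h2, map_add, add_apply, fundForm, ContinuousLinearMap.comp_apply]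
  ring

/-- The fundamental form of a parallel almost complex structure is closed. -/
lemma isClosedForm₂_of_parallel (h : ∀ p, IsLeviCivitaAt g.inner (fun Y => D Y p))
    {J : EndField I M} (hK : ∀ p, HasEndCov D J p fun _ _ => 0)
    (hskew : ∀ p u v, fundForm g.inner J p u v = -fundForm g.inner J p v u) :
    IsClosedForm₂ (fundForm g.inner J) := by
  intro X Y Z hX hY hZ p
  have hX' := ContMDiffAt.mdifferentiableAt (hX p) (by simp)
  have hY' := ContMDiffAt.mdifferentiableAt (hY p) (by simp)
  have hZ' := ContMDiffAt.mdifferentiableAt (hZ p) (by simp)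
  rw [extDeriv₂, (mvfderiv_fundForm (h p) (hK p) hY' hZ').2,
    (mvfderiv_fundForm (h p) (hK p) hX' hZ').2, (mvfderiv_fundForm (h p) (hK p) hX' hY').2,
    ← (h p).torsion_free X Y hX' hY', ← (h p).torsion_free X Z hX' hZ',
    ← (h p).torsion_free Y Z hY' hZ']
  simp only [map_sub, sub_apply, map_zero, zero_apply]
  rw [hskew p (X p) (D Z p (Y p)), hskew p (X p) (D Y p (Z p)), hskew p (Y p) (D Z p (X p))]
  ring

/-- The 4-form of a triple of almost complex structures which the covariant derivative rotates
into each other is parallel. -/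
lemma mvfderiv_quatForm (h : IsLeviCivitaAt g.inner (fun Y => D Y p))
    {J : Fin 3 → EndField I M} {c : TangentSpace I p → Fin 3 → Fin 3 → ℝ}
    (hc : ∀ v i j, c v i j = -c v j i)
    (hK : ∀ i, HasEndCov D (J i) p fun v y => ∑ j, c v i j • J j p y) {a b d e : VField I M}
    (ha : MDiffField a p) (hb : MDiffField b p) (hd : MDiffField d p) (he : MDiffField e p)
    (v : TangentSpace I p) :
    mvfderiv I (fun q => quatForm (fun i => fundForm g.inner (J i)) q (a q) (b q) (d q) (e q)) p v =
      quatForm (fun i => fundForm g.inner (J i)) p (D a p v) (b p) (d p) (e p)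
      + quatForm (fun i => fundForm g.inner (J i)) p (a p) (D b p v) (d p) (e p)
      + quatForm (fun i => fundForm g.inner (J i)) p (a p) (b p) (D d p v) (e p)
      + quatForm (fun i => fundForm g.inner (J i)) p (a p) (b p) (d p) (D e p v) := by
  have key : ∀ i, ∀ Y Z : VField I M, MDiffField Y p → MDiffField Z p →
    MDifferentiableAt I 𝓘(ℝ, ℝ) (fun q => fundForm g.inner (J i) q (Y q) (Z q)) p ∧
    mvfderiv I (fun q => fundForm g.inner (J i) q (Y q) (Z q)) p v =
      fundForm g.inner (J i) p (D Y p v) (Z p) + fundForm g.inner (J i) p (Y p) (D Z p v)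
        + ∑ j, c v i j * fundForm g.inner (J j) p (Y p) (Z p) := by
    intro i Y Z hY hZ
    obtain ⟨h1, h2⟩ := mvfderiv_fundForm h (hK i) hY hZ
    refine ⟨h1, (h2 v).trans ?_⟩
    simp [fundForm, map_sum]
  have prod : ∀ i, ∀ Y Z U W : VField I M, MDiffField Y p → MDiffField Z p → MDiffField U p →
      MDiffField W p → HasMFDerivAt I 𝓘(ℝ, ℝ) (fun q => fundForm g.inner (J i) q (Y q) (Z q) *
        fundForm g.inner (J i) q (U q) (W q)) p
        (mvfderiv I (fun q => fundForm g.inner (J i) q (Y q) (Z q) *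
        fundForm g.inner (J i) q (U q) (W q)) p) ∧
      mvfderiv I (fun q => fundForm g.inner (J i) q (Y q) (Z q) *
        fundForm g.inner (J i) q (U q) (W q)) p v =
      fundForm g.inner (J i) p (Y p) (Z p) * (fundForm g.inner (J i) p (D U p v) (W p)
        + fundForm g.inner (J i) p (U p) (D W p v)
        + ∑ j, c v i j * fundForm g.inner (J j) p (U p) (W p))
      + fundForm g.inner (J i) p (U p) (W p) * (fundForm g.inner (J i) p (D Y p v) (Z p)
        + fundForm g.inner (J i) p (Y p) (D Z p v)
        + ∑ j, c v i j * fundForm g.inner (J j) p (Y p) (Z p)) := by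
    intro i Y Z U W hY hZ hU hW
    obtain ⟨h1, h2⟩ := key i Y Z hY hZ
    obtain ⟨h3, h4⟩ := key i U W hU hW
    refine ⟨hasMFDerivAt_mvfderiv (h1.mul h3), ?_⟩
    have : mvfderiv I (fun q => fundForm g.inner (J i) q (Y q) (Z q) *
        fundForm g.inner (J i) q (U q) (W q)) p = _ := mvfderiv_mul h1 h3
    rw [this, add_apply, smul_apply, smul_apply, h2, h4]
    rfl
  have six := fun i => ((((((prod i a b d e ha hb hd he).1.sub (prod i a d b e ha hd hb he).1).add
    (prod i a e b d ha he hb hd).1).add (prod i b d a e hb hd ha he).1).sub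
    (prod i b e a d hb he ha hd).1).add (prod i d e a b hd he ha hb).1)
  have tot := ((six 0).add (six 1)).add (six 2)
  have tot2 := tot.const_smul (1 / 2 : ℝ)
  have tot3 : HasMFDerivAt I 𝓘(ℝ, ℝ)
      (fun q => quatForm (fun i => fundForm g.inner (J i)) q (a q) (b q) (d q) (e q)) p _ :=
    tot2.congr_of_eventuallyEq (Filter.Eventually.of_forall fun q => by
      simp [quatForm, wedge22, Fin.sum_univ_three])
  rw [HasMFDerivAt.mvfderiv_eq tot3]
  simp only [add_apply, sub_apply, smul_apply, (prod _ a b d e ha hb hd he).2,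
    (prod _ a d b e ha hd hb he).2, (prod _ a e b d ha he hb hd).2, (prod _ b d a e hb hd ha he).2,
    (prod _ b e a d hb he ha hd).2, (prod _ d e a b hd he ha hb).2]
  have c0 : ∀ i, c v i i = 0 := fun i => by linarith [hc v i i]
  simp only [quatForm, wedge22, Fin.sum_univ_three, c0, hc v 1 0, hc v 2 0, hc v 2 1, smul_eq_mul]
  ring

end LeviCivita
end Coframe

section Chart

variable {E : Type*} [NormedAddCommGroup E] [NormedSpace ℝ E] [FiniteDimensional ℝ E]
  {H : Type*} [TopologicalSpace H] {I : ModelWithCorners ℝ E H} [I.Boundaryless]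
  {M : Type*} [TopologicalSpace M] [ChartedSpace H M] [IsManifold I ∞ M]
  {F : Type*} [NormedAddCommGroup F] [NormedSpace ℝ F]
  {p q : M} {n : ℕ∞}

lemma formAt_dchart (hq : q ∈ (chartAt H p).source) : FormAt n (dchart I p) q :=
  formAt_mvfderiv ((contMDiffAt_extChartAt' (n := ∞) hq).of_le (by
    exact_mod_cast (le_top : n + 1 ≤ ⊤)))

lemma contMDiffAt_transition (hq : q ∈ (chartAt H p).source) :
    ContMDiffAt I 𝓘(ℝ, E →L[ℝ] E) n (fun z => (dchart I q z).comp (dchartSymm I p z)) q :=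
  contMDiffAt_coframe_inverse (formAt_dchart hq)
    (by filter_upwards [(chartAt H p).open_source.mem_nhds hq] with z hz v
        using dchartSymm_dchart hz v)
    (by filter_upwards [(chartAt H p).open_source.mem_nhds hq] with z hz v
        using dchart_dchartSymm hz v)

lemma contMDiffAt_formRep {α : Π q : M, TangentSpace I q →L[ℝ] F} (hα : FormAt n α q)
    (hq : q ∈ (chartAt H p).source) : ContMDiffAt I 𝓘(ℝ, E →L[ℝ] F) n (formRep α p) q := by
  have h1 : ContMDiffAt I 𝓘(ℝ, E →L[ℝ] F) n (formRep α q) q := hα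
  refine (h1.clm_comp (contMDiffAt_transition hq)).congr_of_eventuallyEq ?_
  filter_upwards [chart_source_mem_nhds H q] with z hz
  ext v
  simp only [ContinuousLinearMap.comp_apply, formRep_dchart α hz]
  rfl

lemma contMDiffAt_tensorRep {g : Tensor2 I M} (hq : q ∈ (chartAt H p).source)
    (hg : ContMDiffAt I (I.prod 𝓘(ℝ, E →L[ℝ] E →L[ℝ] ℝ)) n
      (fun x => Bundle.TotalSpace.mk' (E →L[ℝ] E →L[ℝ] ℝ)
        (E := fun x : M => TangentSpace I x →L[ℝ] TangentSpace I x →L[ℝ] ℝ) x (g x)) q) :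
    ContMDiffAt I 𝓘(ℝ, E →L[ℝ] E →L[ℝ] ℝ) n (tensorRep g p) q := by
  have h1 := tensor_smooth_iff.1 hg
  have h2 := contMDiffAt_transition (I := I) (n := n) hq
  refine ((h2.clm_precomp (F₃ := ℝ)).clm_comp (h1.clm_comp h2)).congr_of_eventuallyEq ?_
  filter_upwards [chart_source_mem_nhds H q] with z hz
  ext u v
  simp [tensorRep, dchartSymm_dchart hz]

lemma contMDiffAt_endRep {J : EndField I M} (hq : q ∈ (chartAt H p).source)
    (hJ : ContMDiffAt I (I.prod 𝓘(ℝ, E →L[ℝ] E)) n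
      (fun x => Bundle.TotalSpace.mk' (E →L[ℝ] E)
        (E := fun x : M => TangentSpace I x →L[ℝ] TangentSpace I x) x (J x)) q) :
    ContMDiffAt I 𝓘(ℝ, E →L[ℝ] E) n (endRep J p) q := by
  have h1 := end_smooth_iff.1 hJ
  have h2 := contMDiffAt_transition (I := I) (n := n) hq
  have h3 := contMDiffAt_formRep (I := I) (formAt_dchart (n := n) hq) (mem_chart_source H q)
  refine ((h3.clm_comp h1).clm_comp h2).congr_of_eventuallyEq ?_
  filter_upwards [chart_source_mem_nhds H q] with z hz
  ext v
  simp only [endRep, formRep, ContinuousLinearMap.comp_apply, dchartSymm_dchart hz]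

lemma dForm_dchart (hq : q ∈ (chartAt H p).source) (u v : TangentSpace I q) :
    dForm (dchart I p) q u v = 0 := by
  have h1 := extDeriv_eq_dForm (formAt_dchart (n := 1) hq)
    (FiberBundle.mdifferentiableAt_extend I E u) (FiberBundle.mdifferentiableAt_extend I E v)
  rw [FiberBundle.extend_apply_self, FiberBundle.extend_apply_self] at h1
  have h2 := mvfderiv_mlieBracket (F := E) (f := extChartAt I p)
    (contMDiffAt_extChartAt' (n := 2) hq) (FiberBundle.mdifferentiableAt_extend I E u)
    (FiberBundle.mdifferentiableAt_extend I E v)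
  rw [FiberBundle.extend_apply_self, FiberBundle.extend_apply_self] at h2
  rw [← h1]
  exact sub_eq_zero.2 h2

/-- `(u, v) ↦ (w ↦ (∂_u h(v, w) + ∂_v h(u, w) - ∂_w h(u, v)) / 2)` as a function of `∂h`. -/
noncomputable def koszul :
    (E →L[ℝ] E →L[ℝ] E →L[ℝ] ℝ) →L[ℝ] (E →L[ℝ] E →L[ℝ] E →L[ℝ] ℝ) :=
  (1 / 2 : ℝ) • (ContinuousLinearMap.id ℝ _ +
    (ContinuousLinearMap.flipₗᵢ ℝ E E (E →L[ℝ] ℝ)).toContinuousLinearEquiv.toContinuousLinearMap -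
    (ContinuousLinearMap.compL ℝ E (E →L[ℝ] E →L[ℝ] ℝ) (E →L[ℝ] E →L[ℝ] ℝ)
      (ContinuousLinearMap.flipₗᵢ ℝ E E ℝ).toContinuousLinearEquiv.toContinuousLinearMap).comp
    (ContinuousLinearMap.flipₗᵢ ℝ E E (E →L[ℝ] ℝ)).toContinuousLinearEquiv.toContinuousLinearMap)

lemma koszul_apply (d : E →L[ℝ] E →L[ℝ] E →L[ℝ] ℝ) (u v w : E) :
    koszul d u v w = (1 / 2) * (d u v w + d v u w - d w u v) := rfl

variable (I) in
/-- The Christoffel symbols of `g` in the chart at `p`. -/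
noncomputable def christoffel (g : Tensor2 I M) (p q : M) : E →L[ℝ] E →L[ℝ] E :=
  (ContinuousLinearMap.compL ℝ E (E →L[ℝ] ℝ) E (tensorRep g p q).inverse).comp
    (koszul (formRep (mvfderiv I (tensorRep g p)) p q))

section

variable (g : RiemMetric I M)

lemma tensorRep_symm (u v : E) : tensorRep g.inner p q u v = tensorRep g.inner p q v u :=
  g.symm q _ _

lemma tensorRep_pos (hq : q ∈ (chartAt H p).source) {u : E} (hu : u ≠ 0) :
    0 < tensorRep g.inner p q u u := by
  refine g.pos q _ fun h => hu ?_
  rw [← dchart_dchartSymm (I := I) hq u]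
  exact (congrArg _ h).trans (map_zero _)

lemma eq_of_tensorRep_eq (hq : q ∈ (chartAt H p).source) {u v : E}
    (h : ∀ w, tensorRep g.inner p q u w = tensorRep g.inner p q v w) : u = v := by
  by_contra hne
  have := tensorRep_pos g hq (sub_ne_zero.2 hne)
  rw [show tensorRep g.inner p q (u - v) (u - v) = tensorRep g.inner p q u (u - v) -
    tensorRep g.inner p q v (u - v) by
      rw [map_sub (tensorRep g.inner p q)]; rfl, h, sub_self] at this
  exact lt_irrefl _ this

lemma exists_tensorRep_equiv (hq : q ∈ (chartAt H p).source) :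
    ∃ e : E ≃L[ℝ] (E →L[ℝ] ℝ), (e : E →L[ℝ] E →L[ℝ] ℝ) = tensorRep g.inner p q := by
  have hinj : Function.Injective (tensorRep g.inner p q : E →ₗ[ℝ] (E →L[ℝ] ℝ)) := fun u v h =>
    eq_of_tensorRep_eq g hq fun w => congrArg (fun f => f w) h
  have hd : Module.finrank ℝ E = Module.finrank ℝ (E →L[ℝ] ℝ) := by
    rw [← (LinearMap.toContinuousLinearMap (𝕜 := ℝ) (E := E) (F' := ℝ)).finrank_eq]
    exact (Subspace.dual_finrank_eq (K := ℝ) (V := E)).symm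
  refine ⟨(LinearEquiv.ofInjectiveOfFinrankEq _ hinj hd).toContinuousLinearEquiv, ?_⟩
  ext; rfl

lemma christoffel_spec (hq : q ∈ (chartAt H p).source) (u v w : E) :
    tensorRep g.inner p q (christoffel I g.inner p q u v) w =
      koszul (formRep (mvfderiv I (tensorRep g.inner p)) p q) u v w := by
  obtain ⟨e, he⟩ := exists_tensorRep_equiv g hq
  simp only [christoffel, ContinuousLinearMap.comp_apply, ContinuousLinearMap.compL_apply]
  rw [← he, ContinuousLinearMap.inverse_equiv]
  simp

lemma contMDiffAt_metricRep (hq : q ∈ (chartAt H p).source) :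
    ContMDiffAt I 𝓘(ℝ, E →L[ℝ] E →L[ℝ] ℝ) ∞ (tensorRep g.inner p) q :=
  contMDiffAt_tensorRep (n := ⊤) hq (g.contMDiff q)

lemma contMDiffAt_christoffel (hq : q ∈ (chartAt H p).source) :
    ContMDiffAt I 𝓘(ℝ, E →L[ℝ] E →L[ℝ] E) ∞ (christoffel I g.inner p) q := by
  have h1 := contMDiffAt_metricRep g hq
  have h2 := contMDiffAt_formRep (n := ⊤) (formAt_mvfderiv (n := ⊤) h1) hq
  obtain ⟨e, he⟩ := exists_tensorRep_equiv g hq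
  have h3 : ContDiffAt ℝ ∞ (ContinuousLinearMap.inverse : (E →L[ℝ] E →L[ℝ] ℝ) → _)
      (tensorRep g.inner p q) := by
    rw [← he]; exact contDiffAt_map_inverse e
  have h4 := h3.contMDiffAt.comp q h1
  have h5 : ContMDiffAt I 𝓘(ℝ, E →L[ℝ] E →L[ℝ] E →L[ℝ] ℝ) ∞
      (fun q => koszul (formRep (mvfderiv I (tensorRep g.inner p)) p q)) q :=
    (koszul (E := E)).contDiff.contDiffAt.contMDiffAt.comp q h2
  exact (((ContinuousLinearMap.compL ℝ E (E →L[ℝ] ℝ) E).contDiff.contDiffAt.contMDiffAt).comp q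
    h4).clm_comp h5

lemma mvfderiv_tensorRep_symm (hq : q ∈ (chartAt H p).source) (t : TangentSpace I q) (u v : E) :
    mvfderiv I (tensorRep g.inner p) q t u v = mvfderiv I (tensorRep g.inner p) q t v u := by
  have h1 := (contMDiffAt_metricRep g hq).mdifferentiableAt (by simp)
  have h2 := fun u v => (mvfderiv_clm_apply₂ h1 (mdifferentiableAt_const (c := u))
    (mdifferentiableAt_const (c := v))).2 t
  have h3 : (fun z => tensorRep g.inner p z u v) = fun z => tensorRep g.inner p z v u :=
    funext fun z => tensorRep_symm g u v
  have h4 := h2 u v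
  rw [h3, h2 v u] at h4
  simpa [mvfderiv_const] using h4.symm

/-- The coordinate coframe with the Christoffel symbols. -/
lemma isConnCoframe_chart (hq : q ∈ (chartAt H p).source) :
    IsConnCoframe g.inner (tensorRep g.inner p) (dchart I p) (dchartSymm I p)
      (christoffel I g.inner p) q where
  smooth := formAt_dchart hq
  smooth_conn := contMDiffAt_christoffel g hq
  left_inv := dchartSymm_dchart hq
  right_inv := dchart_dchartSymm hq
  smooth_metric := contMDiffAt_metricRep g hq
  metric u v := by rw [tensorRep_apply, dchartSymm_dchart hq, dchartSymm_dchart hq]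
  compat u v w := by
    rw [tensorRep_symm g v, christoffel_spec g hq, christoffel_spec g hq, koszul_apply,
      koszul_apply]
    simp only [formRep, ContinuousLinearMap.comp_apply, dchartSymm_dchart hq]
    rw [mvfderiv_tensorRep_symm g hq u w v, mvfderiv_tensorRep_symm g hq _ v w,
      mvfderiv_tensorRep_symm g hq _ (dchart I p q u) w,
      mvfderiv_tensorRep_symm g hq _ (dchart I p q u) v]
    ring
  torsion u v := by
    rw [dForm_dchart hq, eq_comm, sub_eq_zero]
    refine eq_of_tensorRep_eq g hq fun w => ?_
    rw [christoffel_spec g hq, christoffel_spec g hq, koszul_apply, koszul_apply]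
    simp only [formRep, ContinuousLinearMap.comp_apply, dchartSymm_dchart hq]
    rw [mvfderiv_tensorRep_symm g hq _ (dchart I p q v) (dchart I p q u)]
    ring

end

end Chart

section Algebra

variable {E : Type*} [AddCommGroup E] [Module ℝ E] [FiniteDimensional ℝ E]

/-- Endomorphisms which are skew for a nondegenerate form have trace zero. -/
lemma trace_eq_zero_of_skew (e : E ≃ₗ[ℝ] Module.Dual ℝ E) (Q : E →ₗ[ℝ] E)
    (h : ∀ z w, e (Q z) w = -e z (Q w)) : LinearMap.trace ℝ E Q = 0 := by
  have h1 : e.conj Q = -Module.Dual.transpose (R := ℝ) Q := by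
    ext f w
    obtain ⟨z, rfl⟩ := e.surjective f
    simp [LinearEquiv.conj_apply, h, Module.Dual.transpose]
  have h2 := LinearMap.trace_conj' Q e
  rw [h1, map_neg, LinearMap.trace_transpose'] at h2
  linarith

/-- Curvature tensors `R(x, y) z = P y z x = Q x y z` with the symmetries of a hyperkähler
curvature are Ricci-flat. -/
lemma ricci_flat_of_quaternionic (e : E ≃ₗ[ℝ] Module.Dual ℝ E) (P Q : E → E → E →ₗ[ℝ] E)
    (hPQ : ∀ x y z, P y z x = Q x y z) (hskew : ∀ x y z w, e (Q x y z) w = -e z (Q x y w))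
    (hxy : ∀ x y z, Q x y z = -Q y x z)
    (hB : ∀ x y z, Q x y z + Q y z x + Q z x y = 0) (J : Fin 3 → E →ₗ[ℝ] E)
    (hJ : ∀ i x y z, Q x y (J i z) = J i (Q x y z))
    (hJ2 : ∀ i z, J i (J i z) = -z) (hJ3 : ∀ i z, J i (J (i + 1) z) = J (i + 2) z)
    (hJ4 : ∀ i z, J (i + 1) (J i z) = -J (i + 2) z) (y z : E) :
    LinearMap.trace ℝ E (P y z) = 0 := by
  have hsub : ∀ y z, P y z - P z y = -Q y z := by
    intro y z
    ext x
    have := hB x y z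
    simp only [LinearMap.sub_apply, hPQ, LinearMap.neg_apply]
    rw [hxy x z y]
    rw [sub_neg_eq_add, eq_neg_iff_add_eq_zero, ← this]
    abel
  have hsymm : ∀ y z, LinearMap.trace ℝ E (P y z) = LinearMap.trace ℝ E (P z y) := by
    intro y z
    have := congrArg (LinearMap.trace ℝ E) (hsub y z)
    rw [map_sub, map_neg, trace_eq_zero_of_skew e (Q y z) (hskew y z)] at this
    linarith
  have hQ : ∀ i y z, LinearMap.trace ℝ E (J i ∘ₗ Q y z) = 0 := by
    intro i y z
    have e1 : J i ∘ₗ Q y z = J (i + 1) ∘ₗ (J (i + 2) ∘ₗ Q y z) := by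
      ext w
      have := hJ3 (i + 1) (Q y z w)
      rw [add_assoc, add_assoc] at this
      simpa using this.symm
    have e2 : (J (i + 2) ∘ₗ Q y z) ∘ₗ J (i + 1) = -(J i ∘ₗ Q y z) := by
      ext w
      have := hJ4 (i + 1) (Q y z w)
      rw [add_assoc, add_assoc] at this
      simpa [hJ] using this
    have h3 := LinearMap.trace_comp_comm' (R := ℝ) (J (i + 1)) (J (i + 2) ∘ₗ Q y z)
    rw [e2, ← e1, map_neg] at h3
    linarith
  have hPJ : ∀ i y z, P y (J i z) = J i ∘ₗ P y z := by
    intro i y z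
    ext x
    simp [hPQ, hJ]
  have hmove : ∀ i y z, LinearMap.trace ℝ E (P (J i y) z) = LinearMap.trace ℝ E (P y (J i z)) := by
    intro i y z
    have := congrArg (LinearMap.trace ℝ E) (congrArg (J i ∘ₗ ·) (hsub y z))
    simp only [LinearMap.comp_sub, LinearMap.comp_neg, map_sub, map_neg, hQ, ← hPJ] at this
    rw [hsymm (J i y)]
    linarith
  have hlast : ∀ y z, LinearMap.trace ℝ E (P (J 2 y) z) = 0 := by
    intro y z
    have h1 := hJ3 0 y
    have h2 := hJ4 0 z
    simp only [zero_add] at h1 h2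
    have h3 : LinearMap.trace ℝ E (P (J 2 y) z) = -LinearMap.trace ℝ E (P (J 2 y) z) := by
      nth_rewrite 1 [← h1]
      rw [hmove, hmove, h2, hmove, show (-(J 2 z)) = J 2 (-z) by simp, hPJ, hPJ]
      rw [show P y (-z) = -P y z by ext x; simp [hPQ]]
      simp
    linarith
  have := hlast (-(J 2 y)) z
  rwa [map_neg, hJ2, neg_neg] at this

end Algebra

section LeviCivita

variable {E : Type*} [NormedAddCommGroup E] [NormedSpace ℝ E] [FiniteDimensional ℝ E]
  {H : Type*} [TopologicalSpace H] {I : ModelWithCorners ℝ E H} [I.Boundaryless]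
  {M : Type*} [TopologicalSpace M] [ChartedSpace H M] [IsManifold I ∞ M]
  {p : M}

lemma eventually_isConnCoframe_chart (g : RiemMetric I M) (p : M) :
    ∀ᶠ q in 𝓝 p, IsConnCoframe g.inner (tensorRep g.inner p) (dchart I p) (dchartSymm I p)
      (christoffel I g.inner p) q := by
  filter_upwards [chart_source_mem_nhds H p] with q hq using isConnCoframe_chart g hq

/-- The Levi-Civita connection of a Riemannian metric. -/
noncomputable def leviCivita (g : RiemMetric I M) : AffineConnection I M :=
  coframeConnection (eventually_isConnCoframe_chart g)

lemma RiemMetric_nondeg (g : RiemMetric I M) (p : M) (u : TangentSpace I p)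
    (h : g.inner p u u = 0) : u = 0 := by
  by_contra hu
  exact (g.pos p u hu).ne' h

lemma leviCivita_at (g : RiemMetric I M) (p : M) :
    IsLeviCivitaAt g.inner (fun Y => leviCivita g Y p) :=
  coframeConnection_isLeviCivitaAt _ p

variable {g : RiemMetric I M} {J : EndField I M}

/-- The covariant derivative of a smooth endomorphism field. -/
noncomputable def endCov (g : RiemMetric I M) (J : EndField I M) (p : M)
    (v y : TangentSpace I p) : TangentSpace I p :=
  dchartSymm I p p (mvfderiv I (endRep J p) p v (dchart I p p y)
      + christoffel I g.inner p p (dchart I p p v) (endRep J p p (dchart I p p y))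
      - endRep J p p (christoffel I g.inner p p (dchart I p p v) (dchart I p p y)))

lemma dchart_end (J : EndField I M) : ∀ᶠ q in 𝓝 p, ∀ v, dchart I p q (J q v) =
    endRep J p q (dchart I p q v) := by
  filter_upwards [chart_source_mem_nhds H p] with q hq v
  simp only [endRep, ContinuousLinearMap.comp_apply, dchartSymm_dchart hq]

lemma hasEndCov_endCov (hJ : IsSmoothEndOn J Set.univ) (p : M) :
    HasEndCov (leviCivita g) J p (endCov g J p) :=
  hasEndCov_coframeConnection _ (fun p u v => g.symm p u v) (RiemMetric_nondeg g)
    (eventually_isConnCoframe_chart g p)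
    ((contMDiffAt_endRep (n := ⊤) (mem_chart_source H p)
      ((hJ p (Set.mem_univ p)).contMDiffAt Filter.univ_mem)).mdifferentiableAt (by simp))
    (dchart_end J)

/-- The complex structure of a Kähler metric is parallel. -/
lemma endCov_eq_zero [T2Space M] (hJ : IsComplexStructure J)
    (hherm : ∀ x u v, g.inner x (J x u) (J x v) = g.inner x u v)
    (hclosed : IsClosedForm₂ (fundForm g.inner J)) (p : M) (x y : TangentSpace I p) :
    endCov g J p x y = 0 := by
  have hK := hasEndCov_endCov (g := g) hJ.smooth p
  have hlc := leviCivita_at g p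
  set K := endCov g J p with hKdef
  have hω : ∀ q u v, fundForm g.inner J q u v = -fundForm g.inner J q v u := by
    intro q u v
    simp only [fundForm, ContinuousLinearMap.comp_apply]
    rw [← hherm q (J q u) v, hJ.sq, g.symm q (J q v) u, map_neg]
    rfl
  have hKJ : ∀ x y, K x (J p y) = -J p (K x y) := by
    intro x y
    obtain ⟨Y, hY, rfl⟩ := exists_smooth_eq y
    obtain ⟨h1, h2⟩ := hK Y (hY.mdiff p)
    have h3 := (hK _ h1).2 x
    have h4 : (fun q => J q (J q (Y q))) = (-1 : ℝ) • Y := by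
      funext q
      rw [hJ.sq]; simp
    rw [h4, (leviCivita g).isCovariantDerivativeOnUniv.smul_const _ (hY.mdiff p), h2, map_add,
      hJ.sq] at h3
    simp only [neg_smul, one_smul, add_assoc] at h3
    have h5 := left_eq_add.1 h3
    exact eq_neg_of_add_eq_zero_right h5
  have hskew : ∀ x y z, g.inner p (K x y) z = -g.inner p (K x z) y := by
    intro x y z
    obtain ⟨Y, hY, rfl⟩ := exists_smooth_eq y
    obtain ⟨Z, hZ, rfl⟩ := exists_smooth_eq z
    have h1 := (mvfderiv_fundForm hlc hK (hY.mdiff p) (hZ.mdiff p)).2 x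
    have h2 := (mvfderiv_fundForm hlc hK (hZ.mdiff p) (hY.mdiff p)).2 x
    have h3 : (fun q => fundForm g.inner J q (Y q) (Z q)) =
      -fun q => fundForm g.inner J q (Z q) (Y q) := funext fun q => hω q _ _
    rw [h3, mvfderiv_neg, neg_apply, h2, hω p (leviCivita g Y p x), hω p (Y p)] at h1
    linarith
  have hcyc : ∀ x y z, g.inner p (K x y) z + g.inner p (K y z) x + g.inner p (K z x) y = 0 := by
    intro x y z
    obtain ⟨X, hX, rfl⟩ := exists_smooth_eq x
    obtain ⟨Y, hY, rfl⟩ := exists_smooth_eq y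
    obtain ⟨Z, hZ, rfl⟩ := exists_smooth_eq z
    have h := hclosed X Y Z hX hY hZ p
    have hX' := hX.mdiff p
    have hY' := hY.mdiff p
    have hZ' := hZ.mdiff p
    rw [extDeriv₂, (mvfderiv_fundForm hlc hK hY' hZ').2,
      (mvfderiv_fundForm hlc hK hX' hZ').2, (mvfderiv_fundForm hlc hK hX' hY').2,
      ← hlc.torsion_free X Y hX' hY', ← hlc.torsion_free X Z hX' hZ',
      ← hlc.torsion_free Y Z hY' hZ'] at h
    simp only [map_sub, sub_apply] at h
    rw [hω p (X p) (leviCivita g Z p (Y p)), hω p (X p) (leviCivita g Y p (Z p)),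
      hω p (Y p) (leviCivita g Z p (X p)), hskew (Y p) (X p)] at h
    linarith
  have hN : ∀ x y, K (J p x) y - K (J p y) x = J p (K x y - K y x) := by
    intro x y
    obtain ⟨X, hX, rfl⟩ := exists_smooth_eq x
    obtain ⟨Y, hY, rfl⟩ := exists_smooth_eq y
    have h := hJ.integrable X Y hX hY p
    rw [nijenhuis_eq hlc (hJ.sq p) hK (hX.mdiff p) (hY.mdiff p)] at h
    exact sub_eq_zero.1 h
  have hgJ : ∀ u v, g.inner p (J p u) v = -g.inner p u (J p v) := by
    intro u v
    have := hω p u v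
    simp only [fundForm, ContinuousLinearMap.comp_apply] at this
    rw [this, g.symm p (J p v) u]
  have hstar : ∀ x y z, g.inner p (K (J p x) y) z =
      g.inner p (K (J p y) x) z + g.inner p (K (J p z) x) y := by
    intro x y z
    have h1 := congrArg (fun w => g.inner p w z) (hN x y)
    simp only [map_sub, sub_apply, hgJ] at h1
    have h2 := hcyc x y (J p z)
    rw [hskew y (J p z)] at h2
    linarith
  have hzero : ∀ x y z, g.inner p (K (J p x) y) z = 0 := by
    intro x y z
    have h1 := hstar x y z
    have h2 := hstar y z x
    have h3 := hstar z x y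
    rw [hskew (J p y) x z] at h1
    rw [hskew (J p z) y x] at h2
    rw [hskew (J p x) z y] at h3
    linarith
  have h0 : K (J p (-(J p x))) y = 0 := RiemMetric_nondeg g p _ (hzero _ _ _)
  rwa [map_neg, hJ.sq, neg_neg] at h0

end LeviCivita

section

variable {E : Type*} [NormedAddCommGroup E] [NormedSpace ℝ E] [FiniteDimensional ℝ E]
  {H : Type*} [TopologicalSpace H] {I : ModelWithCorners ℝ E H} [I.Boundaryless]
  {M : Type*} [TopologicalSpace M] [ChartedSpace H M] [IsManifold I ∞ M] [T2Space M]
  {p q : M} {g : RiemMetric I M} {J : EndField I M}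

/-- The complex structure of a Kähler metric is parallel, in coordinates. -/
lemma endRep_parallel (hJ : IsComplexStructure J)
    (hherm : ∀ x u v, g.inner x (J x u) (J x v) = g.inner x u v)
    (hclosed : IsClosedForm₂ (fundForm g.inner J)) (hq : q ∈ (chartAt H p).source) (x y : E) :
    mvfderiv I (endRep J p) q (dchartSymm I p q x) y =
      endRep J p q (christoffel I g.inner p q x y) - christoffel I g.inner p q x (endRep J p q y) := by
  have h1 : ∀ᶠ z in 𝓝 q, IsConnCoframe g.inner (tensorRep g.inner p) (dchart I p) (dchartSymm I p)
      (christoffel I g.inner p) z := by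
    filter_upwards [(chartAt H p).open_source.mem_nhds hq] with z hz using isConnCoframe_chart g hz
  have h2 : ∀ᶠ z in 𝓝 q, ∀ v, dchart I p z (J z v) = endRep J p z (dchart I p z v) := by
    filter_upwards [(chartAt H p).open_source.mem_nhds hq] with z hz v
    simp only [endRep, ContinuousLinearMap.comp_apply, dchartSymm_dchart hz]
  have h3 := hasEndCov_coframeConnection (eventually_isConnCoframe_chart g)
    (fun p u v => g.symm p u v) (RiemMetric_nondeg g) h1
    ((contMDiffAt_endRep (n := ⊤) hq
      ((hJ.smooth q (Set.mem_univ q)).contMDiffAt Filter.univ_mem)).mdifferentiableAt (by simp)) h2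
  have h4 := hasEndCov_endCov (g := g) hJ.smooth q
  obtain ⟨Y, hY, hYy⟩ := exists_smooth_eq (dchartSymm I p q y)
  have h5 := (h3 Y (hY.mdiff q)).2 (dchartSymm I p q x)
  have h6 := (h4 Y (hY.mdiff q)).2 (dchartSymm I p q x)
  have h7 := add_left_cancel (h5.symm.trans h6)
  rw [endCov_eq_zero hJ hherm hclosed] at h7
  have h8 := congrArg (dchart I p q) h7
  rw [dchart_dchartSymm hq, map_zero, hYy, dchart_dchartSymm hq, dchart_dchartSymm hq] at h8
  rw [sub_eq_zero] at h8
  exact eq_sub_of_add_eq h8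

lemma mdiffField_leviCivita {W Z : VField I M} (hW : IsSmoothVField W) (hZ : IsSmoothVField Z) :
    MDiffField (fun y => leviCivita g Z y (W y)) p :=
  (mdiffField_coframeConnection (eventually_isConnCoframe_chart g) (fun p u v => g.symm p u v)
    (RiemMetric_nondeg g) (eventually_isConnCoframe_chart g p) (hW.mdiff p)
    ((hZ p).of_le (WithTop.coe_le_coe.2 (le_top : (2 : ℕ∞) ≤ ⊤)))).1

lemma contMDiffAt_inner {n : ℕ∞} {Y Z : VField I M} (hY : IsSmoothVField Y)
    (hZ : IsSmoothVField Z) :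
    ContMDiffAt I 𝓘(ℝ, ℝ) n (fun q => g.inner q (Y q) (Z q)) p := by
  have h1 := (contMDiffAt_metricRep g (mem_chart_source H p)).of_le
    (m := n) (by exact_mod_cast (le_top : n ≤ ⊤))
  have hY' := contMDiffAt_section_iff.1 ((hY p).of_le
    (m := n) (by exact_mod_cast (le_top : n ≤ ⊤)))
  have hZ' := contMDiffAt_section_iff.1 ((hZ p).of_le
    (m := n) (by exact_mod_cast (le_top : n ≤ ⊤)))
  refine ((h1.clm_apply hY').clm_apply hZ').congr_of_eventuallyEq ?_
  filter_upwards [chart_source_mem_nhds H p] with q hq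
  rw [tensorRep_apply, dchartSymm_dchart hq, dchartSymm_dchart hq]

lemma curvature_skew {X Y Z W : VField I M} (hX : IsSmoothVField X) (hY : IsSmoothVField Y)
    (hZ : IsSmoothVField Z) (hW : IsSmoothVField W) :
    g.inner p (curvature (leviCivita g) X Y Z p) (W p) =
      -g.inner p (Z p) (curvature (leviCivita g) X Y W p) := by
  have h0 := mvfderiv_mlieBracket (contMDiffAt_inner (g := g) (n := 2) hZ hW) (hX.mdiff p)
    (hY.mdiff p)
  have h1 : ∀ V : VField I M, (fun q => mvfderiv I (fun q => g.inner q (Z q) (W q)) q (V q)) =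
      (fun q => g.inner q (leviCivita g Z q (V q)) (W q)) +
        fun q => g.inner q (Z q) (leviCivita g W q (V q)) := fun V => funext fun q =>
    (leviCivita_at g q).metric Z W (hZ.mdiff q) (hW.mdiff q) (V q)
  have h2 : ∀ V : VField I M, IsSmoothVField V → ∀ v, mvfderiv I
      ((fun q => g.inner q (leviCivita g Z q (V q)) (W q)) +
        fun q => g.inner q (Z q) (leviCivita g W q (V q))) p v = _ := fun V hV v => by
    rw [mvfderiv_add (mdifferentiableAt_inner (mdiffField_leviCivita hV hZ) (hW.mdiff p))
      (mdifferentiableAt_inner (hZ.mdiff p) (mdiffField_leviCivita hV hW)), add_apply,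
      (leviCivita_at g p).metric _ _ (mdiffField_leviCivita hV hZ) (hW.mdiff p),
      (leviCivita_at g p).metric _ _ (hZ.mdiff p) (mdiffField_leviCivita hV hW)]
  rw [h1, h1, h2 _ hY, h2 _ hX, (leviCivita_at g p).metric Z W (hZ.mdiff p) (hW.mdiff p)] at h0
  simp only [curvature, map_sub, sub_apply]
  linarith

lemma curvature_end (hpar : ∀ p, HasEndCov (leviCivita g) J p fun _ _ => 0) {X Y Z JZ : VField I M}
    (hX : IsSmoothVField X) (hY : IsSmoothVField Y) (hZ : IsSmoothVField Z)
    (hJZ : JZ = fun q => J q (Z q)) :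
    curvature (leviCivita g) X Y JZ p = J p (curvature (leviCivita g) X Y Z p) := by
  have h1 : ∀ q v, leviCivita g JZ q v = J q (leviCivita g Z q v) := fun q v => by
    rw [hJZ, (hpar q Z (hZ.mdiff q)).2, add_zero]
  have h2 : ∀ V : VField I M, IsSmoothVField V → ∀ v,
      leviCivita g (fun y => leviCivita g JZ y (V y)) p v =
        J p (leviCivita g (fun y => leviCivita g Z y (V y)) p v) := fun V hV v => by
    simp only [h1]
    rw [(hpar p _ (mdiffField_leviCivita hV hZ)).2, add_zero]
  rw [curvature, h2 Y hY, h2 X hX, h1, curvature, map_sub, map_sub]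

lemma christoffel_symm (hq : q ∈ (chartAt H p).source) (u v : E) :
    christoffel I g.inner p q u v = christoffel I g.inner p q v u := by
  have := (isConnCoframe_chart g hq).torsion (dchartSymm I p q u) (dchartSymm I p q v)
  rw [dForm_dchart hq, dchart_dchartSymm hq, dchart_dchartSymm hq] at this
  exact (sub_eq_zero.1 this.symm).symm

lemma mvfderiv_christoffel_symm (hq : q ∈ (chartAt H p).source) (t : TangentSpace I q) (u v : E) :
    mvfderiv I (christoffel I g.inner p) q t u v = mvfderiv I (christoffel I g.inner p) q t v u := by
  have h1 := (contMDiffAt_christoffel g hq).mdifferentiableAt (by simp)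
  have h2 := fun u v => (mvfderiv_clm_apply₂ h1 (mdifferentiableAt_const (c := u))
    (mdifferentiableAt_const (c := v))).2 t
  have h3 : (fun z => christoffel I g.inner p z u v) =ᶠ[𝓝 q]
      fun z => christoffel I g.inner p z v u := by
    filter_upwards [(chartAt H p).open_source.mem_nhds hq] with z hz using christoffel_symm hz u v
  have h4 := h2 u v
  rw [h3.mvfderiv_eq, h2 v u] at h4
  simpa [mvfderiv_const] using h4.symm

lemma IsSmoothEndOn.smooth_apply (hJ : IsSmoothEndOn J Set.univ) {Z : VField I M}
    (hZ : IsSmoothVField Z) : IsSmoothVField fun q => J q (Z q) := by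
  intro p
  refine contMDiffAt_section_iff (n := ⊤).2 ?_
  have h1 := contMDiffAt_endRep (n := ⊤) (mem_chart_source H p)
    ((hJ p (Set.mem_univ p)).contMDiffAt Filter.univ_mem)
  have h2 := contMDiffAt_section_iff (n := ⊤).1 (hZ p)
  refine (h1.clm_apply h2).congr_of_eventuallyEq ?_
  filter_upwards [chart_source_mem_nhds H p] with q hq
  simp only [endRep, ContinuousLinearMap.comp_apply, dchartSymm_dchart hq]

/-- Hyperkähler metrics are Ricci-flat, in coordinates. -/
lemma HyperKahlerStructure.trace_curvEnd (S : HyperKahlerStructure I M) (p : M) (y z : E) :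
    LinearMap.trace ℝ E (curvEnd ((mvfderiv I (christoffel I S.g.inner p) p).comp (dchartSymm I p p))
      (christoffel I S.g.inner p p) y z : E →ₗ[ℝ] E) = 0 := by
  have hp := mem_chart_source H p
  set dA := (mvfderiv I (christoffel I S.g.inner p) p).comp (dchartSymm I p p) with hdA
  set A := christoffel I S.g.inner p p with hA
  have hcurv : ∀ x y z : E, ∃ X Y Z : VField I M, IsSmoothVField X ∧ IsSmoothVField Y ∧
      IsSmoothVField Z ∧ dchart I p p (X p) = x ∧ dchart I p p (Y p) = y ∧
        dchart I p p (Z p) = z := by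
    intro x y z
    obtain ⟨X, hX, hx⟩ := exists_smooth_eq (dchartSymm I p p x)
    obtain ⟨Y, hY, hy⟩ := exists_smooth_eq (dchartSymm I p p y)
    obtain ⟨Z, hZ, hz⟩ := exists_smooth_eq (dchartSymm I p p z)
    refine ⟨X, Y, Z, hX, hY, hZ, ?_, ?_, ?_⟩
    · rw [hx, dchart_dchartSymm hp]
    · rw [hy, dchart_dchartSymm hp]
    · rw [hz, dchart_dchartSymm hp]
  have hR : ∀ X Y Z : VField I M, IsSmoothVField X → IsSmoothVField Y → IsSmoothVField Z →
      dchart I p p (curvature (leviCivita S.g) X Y Z p) =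
        curvEnd dA A (dchart I p p (Y p)) (dchart I p p (Z p)) (dchart I p p (X p)) := by
    intro X Y Z hX hY hZ
    rw [leviCivita, curvature_coframeConnection (eventually_isConnCoframe_chart S.g)
      (fun p u v => S.g.symm p u v) (RiemMetric_nondeg S.g) (eventually_isConnCoframe_chart S.g p)
      (hX.mdiff p) (hY.mdiff p) ((hZ p).of_le (WithTop.coe_le_coe.2 (le_top : (2 : ℕ∞) ≤ ⊤))), dchart_dchartSymm hp]
  obtain ⟨e, he⟩ := exists_tensorRep_equiv S.g hp
  let Q : E → E → E →ₗ[ℝ] E := fun x y => IsLinearMap.mk' (fun z => curvEnd dA A y z x)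
    ⟨fun z w => by simp only [curvEnd_apply, map_add]; abel,
      fun c z => by simp only [curvEnd_apply, map_smul, smul_sub, smul_add]⟩
  have hQ : ∀ x y z, Q x y z = curvEnd dA A y z x := fun _ _ _ => rfl
  have hhg : ∀ u v, tensorRep S.g.inner p p (dchart I p p u) (dchart I p p v) = S.g.inner p u v :=
    fun u v => ((isConnCoframe_chart S.g hp).metric u v).symm
  refine ricci_flat_of_quaternionic
    (e.toLinearEquiv.trans (LinearMap.toContinuousLinearMap (𝕜 := ℝ) (E := E) (F' := ℝ)).symm)
    (fun y z => (curvEnd dA A y z : E →ₗ[ℝ] E)) Q (fun _ _ _ => rfl) ?_ ?_ ?_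
    (fun i => (endRep (S.J i) p p : E →ₗ[ℝ] E)) ?_ ?_ ?_ ?_ y z
  · intro x y z w
    obtain ⟨X, Y, Z, hX, hY, hZ, rfl, rfl, rfl⟩ := hcurv x y z
    obtain ⟨W, -, -, hW, -, -, rfl, -, -⟩ := hcurv w w w
    have h1 : ∀ u v : E, (e.toLinearEquiv.trans (LinearMap.toContinuousLinearMap
        (𝕜 := ℝ) (E := E) (F' := ℝ)).symm) u v = tensorRep S.g.inner p p u v := fun u v => by
      rw [← he]; rfl
    rw [h1, h1, hQ, hQ, ← hR X Y Z hX hY hZ, ← hR X Y W hX hY hW, hhg, hhg]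
    exact curvature_skew hX hY hZ hW
  · intro x y z
    simp only [hQ, curvEnd_apply, map_sub, sub_apply]
    abel
  · intro x y z
    have h1 : ∀ u v, A u v = A v u := christoffel_symm hp
    have h2 : ∀ t u v, dA t u v = dA t v u := fun t u v => mvfderiv_christoffel_symm hp _ u v
    simp only [hQ, curvEnd_apply, h1 y x, h1 z y, h1 x z, sub_self, map_zero, zero_apply]
    rw [h2 y x z, h2 z y x, h2 x z y]
    abel
  · intro i x y z
    obtain ⟨X, Y, Z, hX, hY, hZ, rfl, rfl, rfl⟩ := hcurv x y z
    have hpar : ∀ p, HasEndCov (leviCivita S.g) (S.J i) p fun _ _ => 0 := fun p => by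
      have := hasEndCov_endCov (g := S.g) (S.hypercomplex.complex i).smooth p
      have h0 : endCov S.g (S.J i) p = fun _ _ => 0 := by
        funext u v
        exact endCov_eq_zero (S.hypercomplex.complex i) (S.hermitian i) (S.closed i) p u v
      rwa [h0] at this
    have h1 := curvature_end hpar (p := p) hX hY hZ rfl
    have h2 := congrArg (dchart I p p) h1
    have h3 := (dchart_end (p := p) (S.J i)).self_of_nhds
    rw [hR X Y _ hX hY ((S.hypercomplex.complex i).smooth.smooth_apply hZ), h3, h3,
      hR X Y Z hX hY hZ] at h2
    exact h2
  all_goals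
    intro i z
    obtain ⟨Z, -, -, -, -, -, rfl, -, -⟩ := hcurv z z z
    have h3 := fun i => (dchart_end (p := p) (S.J i)).self_of_nhds
    have h4 := S.hypercomplex.quaternion p i (Z p)
    simp only [ContinuousLinearMap.coe_coe, ← h3, ← map_neg]
  · rw [h4.1]
  · rw [h4.2.1]
  · exact congrArg _ (h4.2.2.trans (map_neg _ _).symm)

end

section Algebra

variable {E : Type*} [NormedAddCommGroup E] [NormedSpace ℝ E] [FiniteDimensional ℝ E] {k : ℕ}

/-- The space in which the coframe on the total space takes its values. -/
abbrev TotalModel (k : ℕ) (E : Type*) := ℝ × (Fin k → ℝ) × E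

/-- The projection to the fibre coordinate `j`. -/
noncomputable def fibCoord (j : Fin k) : TotalModel k E →L[ℝ] ℝ :=
  (ContinuousLinearMap.proj j).comp
    ((ContinuousLinearMap.fst ℝ _ _).comp (ContinuousLinearMap.snd ℝ _ _))

/-- The projection to the base. -/
noncomputable def baseCoord : TotalModel k E →L[ℝ] E :=
  (ContinuousLinearMap.snd ℝ _ _).comp (ContinuousLinearMap.snd ℝ _ _)

/-- The inclusion of the base. -/
noncomputable def baseIncl : E →L[ℝ] TotalModel k E :=
  (ContinuousLinearMap.inr ℝ _ _).comp (ContinuousLinearMap.inr ℝ _ _)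

@[simp] lemma fibCoord_apply (j : Fin k) (u : TotalModel k E) : fibCoord j u = u.2.1 j := rfl

@[simp] lemma baseCoord_apply (u : TotalModel k E) : baseCoord u = u.2.2 := rfl

@[simp] lemma baseIncl_apply (X : E) : (baseIncl X : TotalModel k E) = (0, 0, X) := rfl

/-- The bilinear map `(u, w) ↦ ι (β (u, w))` for a bilinear map `β` on the base. -/
noncomputable def baseLift {G : Type*} [NormedAddCommGroup G] [NormedSpace ℝ G]
    (ι : G →L[ℝ] TotalModel k E) (β : E →L[ℝ] E →L[ℝ] G) :
    TotalModel k E →L[ℝ] TotalModel k E →L[ℝ] TotalModel k E :=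
  (((ContinuousLinearMap.compL ℝ (TotalModel k E) E (TotalModel k E)).flip baseCoord).comp
    (ContinuousLinearMap.compL ℝ E G (TotalModel k E) ι)).comp (β.comp baseCoord)

@[simp] lemma baseLift_apply {G : Type*} [NormedAddCommGroup G] [NormedSpace ℝ G]
    (ι : G →L[ℝ] TotalModel k E) (β : E →L[ℝ] E →L[ℝ] G) (u w : TotalModel k E) :
    baseLift ι β u w = ι (β u.2.2 w.2.2) := rfl

/-- The bilinear map `(u, w) ↦ b(u) b'(w) v`. -/
noncomputable def rankOneForm (b b' : TotalModel k E →L[ℝ] ℝ) (v : TotalModel k E) :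
    TotalModel k E →L[ℝ] TotalModel k E →L[ℝ] TotalModel k E :=
  b.smulRight (b'.smulRight v)

@[simp] lemma rankOneForm_apply (b b' : TotalModel k E →L[ℝ] ℝ) (v u w : TotalModel k E) :
    rankOneForm b b' v u w = b u • b' w • v := rfl

/-- The bilinear map `(u, w) ↦ b(u) T(w)`. -/
noncomputable def smulForm (b : TotalModel k E →L[ℝ] ℝ) :
    (TotalModel k E →L[ℝ] TotalModel k E) →L[ℝ]
      TotalModel k E →L[ℝ] TotalModel k E →L[ℝ] TotalModel k E :=
  ContinuousLinearMap.smulRightL ℝ (TotalModel k E) (TotalModel k E →L[ℝ] TotalModel k E) b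

@[simp] lemma smulForm_apply (b : TotalModel k E →L[ℝ] ℝ)
    (T : TotalModel k E →L[ℝ] TotalModel k E) (u w : TotalModel k E) :
    smulForm b T u w = b u • T w := rfl

/-- The endomorphism of the model induced by an endomorphism of the base. -/
noncomputable def baseEnd (J : E →L[ℝ] E) : TotalModel k E →L[ℝ] TotalModel k E :=
  baseIncl.comp (J.comp baseCoord)

@[simp] lemma baseEnd_apply (J : E →L[ℝ] E) (u : TotalModel k E) :
    baseEnd J u = (0, 0, J u.2.2) := rfl

/-- The part of `connForm` which does not depend on the base. -/
noncomputable def connFormConst (k : ℕ) (E : Type*) [NormedAddCommGroup E] [NormedSpace ℝ E] :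
    TotalModel k E →L[ℝ] TotalModel k E →L[ℝ] TotalModel k E :=
  (∑ j : Fin k, rankOneForm (fibCoord j) (fibCoord j) ((-2 : ℝ), (0 : Fin k → ℝ), (0 : E)))
  + (∑ j : Fin k, rankOneForm (fibCoord j) (ContinuousLinearMap.fst ℝ ℝ ((Fin k → ℝ) × E))
      ((0 : ℝ), (Pi.single j 2 : Fin k → ℝ), (0 : E)))
  + (smulForm (ContinuousLinearMap.fst ℝ ℝ ((Fin k → ℝ) × E))
      (baseEnd (ContinuousLinearMap.id ℝ E))).flip

/-- The Levi-Civita connection form of the total metric, in terms of the metric `h` of the base,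
of the curvature forms `σ j = h (J j ·, ·)`, and of the Christoffel symbols `G` of the base. -/
noncomputable def connForm (h : E →L[ℝ] E →L[ℝ] ℝ) (σ : Fin k → E →L[ℝ] E →L[ℝ] ℝ)
    (J : Fin k → E →L[ℝ] E) (G : E →L[ℝ] E →L[ℝ] E) :
    TotalModel k E →L[ℝ] TotalModel k E →L[ℝ] TotalModel k E :=
  connFormConst k E - baseLift (ContinuousLinearMap.inl ℝ ℝ ((Fin k → ℝ) × E)) h
  - (∑ j, baseLift ((ContinuousLinearMap.inr ℝ ℝ ((Fin k → ℝ) × E)).comp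
      ((ContinuousLinearMap.inl ℝ (Fin k → ℝ) E).comp
        (ContinuousLinearMap.single ℝ (fun _ : Fin k => ℝ) j))) (σ j))
  + (∑ j, (smulForm (fibCoord j) (baseEnd (J j)) + (smulForm (fibCoord j) (baseEnd (J j))).flip))
  + baseLift baseIncl G

lemma connForm_apply (h : E →L[ℝ] E →L[ℝ] ℝ) (σ : Fin k → E →L[ℝ] E →L[ℝ] ℝ)
    (J : Fin k → E →L[ℝ] E) (G : E →L[ℝ] E →L[ℝ] E) (u w : TotalModel k E) :
    connForm h σ J G u w = (-2 * ∑ j, u.2.1 j * w.2.1 j - h u.2.2 w.2.2,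
      fun j => 2 * u.2.1 j * w.1 - σ j u.2.2 w.2.2,
      w.1 • u.2.2 + ∑ j, u.2.1 j • J j w.2.2 + ∑ j, w.2.1 j • J j u.2.2 + G u.2.2 w.2.2) := by
  have hf : ∀ u : TotalModel k E, ContinuousLinearMap.fst ℝ ℝ ((Fin k → ℝ) × E) u = u.1 :=
    fun _ => rfl
  simp only [connForm, connFormConst, add_apply, sub_apply, sum_apply, baseLift_apply,
    ContinuousLinearMap.comp_apply, rankOneForm_apply, smulForm_apply, baseEnd_apply, hf,
    ContinuousLinearMap.flip_apply, fibCoord_apply, baseIncl_apply, ContinuousLinearMap.inl_apply,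
    ContinuousLinearMap.inr_apply, ContinuousLinearMap.single_apply, ContinuousLinearMap.id_apply]
  refine Prod.ext ?_ (Prod.ext ?_ ?_)
  · simp [Finset.mul_sum, Prod.fst_sum]
    exact Finset.sum_congr rfl fun j _ => by ring
  · ext i
    simp [Prod.snd_sum, Prod.fst_sum, Finset.sum_apply, Pi.single_apply]
    ring
  · simp [Prod.snd_sum, Finset.sum_add_distrib]
    abel

/-- The total metric on the model. -/
noncomputable def totalForm (h : E →L[ℝ] E →L[ℝ] ℝ) : TotalModel k E →L[ℝ] TotalModel k E →L[ℝ] ℝ :=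
  (ContinuousLinearMap.fst ℝ ℝ ((Fin k → ℝ) × E)).smulRight
      (ContinuousLinearMap.fst ℝ ℝ ((Fin k → ℝ) × E))
  + (∑ j : Fin k, (fibCoord (E := E) j).smulRight (fibCoord (E := E) j))
  + ((ContinuousLinearMap.compL ℝ (TotalModel k E) E ℝ).flip baseCoord).comp (h.comp baseCoord)

lemma totalForm_apply (h : E →L[ℝ] E →L[ℝ] ℝ) (u w : TotalModel k E) :
    totalForm h u w = u.1 * w.1 + ∑ j, u.2.1 j * w.2.1 j + h u.2.2 w.2.2 := by
  simp [totalForm]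

/-- The trace on the model, in blocks. -/
lemma trace_totalModel (f : TotalModel k E →ₗ[ℝ] TotalModel k E) :
    LinearMap.trace ℝ _ f = (f (1, 0, 0)).1 + ∑ j, (f (0, Pi.single j 1, 0)).2.1 j +
      LinearMap.trace ℝ E (LinearMap.snd ℝ _ _ ∘ₗ LinearMap.snd ℝ _ _ ∘ₗ f ∘ₗ
        LinearMap.inr ℝ _ _ ∘ₗ LinearMap.inr ℝ _ _) := by
  let b := ((Module.Basis.singleton Unit ℝ).prod
    ((Pi.basisFun ℝ (Fin k)).prod (Module.finBasis ℝ E)))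
  rw [LinearMap.trace_eq_matrix_trace ℝ b, LinearMap.trace_eq_matrix_trace ℝ (Module.finBasis ℝ E),
    Matrix.trace, Matrix.trace]
  simp only [Fintype.sum_sum_type, Matrix.diag_apply, LinearMap.toMatrix_apply]
  simp [b, add_assoc, Module.Basis.prod_apply]
  rfl

end Algebra

section Algebra

variable {E : Type*} [NormedAddCommGroup E] [NormedSpace ℝ E] [FiniteDimensional ℝ E] {k : ℕ}

/-- `h` is a Euclidean metric, and the `J j` are anticommuting complex structures compatible with
it. -/
structure IsCliffordTriple (h : E →L[ℝ] E →L[ℝ] ℝ) (J : Fin k → E →L[ℝ] E) : Prop where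
  symm : ∀ x y, h x y = h y x
  pos : ∀ x, x ≠ 0 → 0 < h x x
  skew : ∀ j x y, h (J j x) y = -h x (J j y)
  sq : ∀ j x, J j (J j x) = -x
  anti : ∀ i j, i ≠ j → ∀ x, J i (J j x) = -J j (J i x)

variable {h : E →L[ℝ] E →L[ℝ] ℝ} {J : Fin k → E →L[ℝ] E}

lemma IsCliffordTriple.trace_of_skew (H : IsCliffordTriple h J) (Q : E →ₗ[ℝ] E)
    (hQ : ∀ x y, h (Q x) y = -h x (Q y)) : LinearMap.trace ℝ E Q = 0 := by
  let φ : E →ₗ[ℝ] Module.Dual ℝ E :=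
    (LinearMap.toContinuousLinearMap (𝕜 := ℝ) (E := E) (F' := ℝ)).symm.toLinearMap ∘ₗ
      (h : E →ₗ[ℝ] E →L[ℝ] ℝ)
  have hφ : ∀ x y, φ x y = h x y := fun _ _ => rfl
  have hinj : Function.Injective φ := by
    rw [← LinearMap.ker_eq_bot, LinearMap.ker_eq_bot']
    intro x hx
    by_contra hne
    have := H.pos x hne
    rw [← hφ, hx] at this
    exact lt_irrefl _ this
  refine trace_eq_zero_of_skew (LinearEquiv.ofInjectiveOfFinrankEq φ hinj
    (Subspace.dual_finrank_eq (K := ℝ) (V := E)).symm) Q fun z w => ?_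
  exact hQ z w

lemma IsCliffordTriple.trace_eq_zero (H : IsCliffordTriple h J) (j : Fin k) :
    LinearMap.trace ℝ E (J j : E →ₗ[ℝ] E) = 0 :=
  H.trace_of_skew _ fun x y => H.skew j x y

lemma IsCliffordTriple.trace_comp (H : IsCliffordTriple h J) (i j : Fin k) :
    LinearMap.trace ℝ E ((J i : E →ₗ[ℝ] E) ∘ₗ (J j : E →ₗ[ℝ] E)) =
      if i = j then -(Module.finrank ℝ E : ℝ) else 0 := by
  split_ifs with hij
  · subst hij
    rw [show (J i : E →ₗ[ℝ] E) ∘ₗ (J i : E →ₗ[ℝ] E) = -LinearMap.id by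
      ext x; simpa using H.sq i x, map_neg, LinearMap.trace_id]
  · refine H.trace_of_skew _ fun x y => ?_
    simp only [LinearMap.comp_apply, ContinuousLinearMap.coe_coe]
    rw [H.skew, H.skew, neg_neg, H.anti j i (Ne.symm hij), map_neg]

lemma IsCliffordTriple.comp_comp (H : IsCliffordTriple h J) (j : Fin k) (x y : E) :
    h (J j x) (J j y) = h x y := by
  rw [H.skew, H.sq, map_neg, neg_neg]

/-- The derivative of the connection form, when the derivatives of `h` and `J` are given by the
Christoffel symbols. -/
def IsConnDeriv (h : E →L[ℝ] E →L[ℝ] ℝ) (J : Fin k → E →L[ℝ] E) (G : E →L[ℝ] E →L[ℝ] E)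
    (s : ℝ) (dΓ : E →L[ℝ] E →L[ℝ] E →L[ℝ] E)
    (dA : TotalModel k E →L[ℝ] TotalModel k E →L[ℝ] TotalModel k E →L[ℝ] TotalModel k E) : Prop :=
  ∀ x y z, dA x y z = (-(h (G x.2.2 y.2.2) z.2.2 + h y.2.2 (G x.2.2 z.2.2)),
    fun j => -(h (J j (G x.2.2 y.2.2)) z.2.2 + h (J j y.2.2) (G x.2.2 z.2.2)),
    ∑ j, y.2.1 j • (J j (G x.2.2 z.2.2) - G x.2.2 (J j z.2.2))
      + ∑ j, z.2.1 j • (J j (G x.2.2 y.2.2) - G x.2.2 (J j y.2.2))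
      - x.1 • G y.2.2 z.2.2 + s • dΓ x.2.2 y.2.2 z.2.2)

variable {G Γ : E →L[ℝ] E →L[ℝ] E} {dΓ : E →L[ℝ] E →L[ℝ] E →L[ℝ] E} {s : ℝ}
  {dA : TotalModel k E →L[ℝ] TotalModel k E →L[ℝ] TotalModel k E →L[ℝ] TotalModel k E}

/-- The base component of the curvature of the total metric. -/
lemma curvEnd_connForm_base (H : IsCliffordTriple h J) (hG : ∀ x y, G x y = G y x)
    (hs : ∀ x y, G x y = s • Γ x y) (hd : IsConnDeriv h J G (s ^ 2) dΓ dA) (y z : TotalModel k E)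
    (X : E) :
    (curvEnd dA (connForm h (fun j => h.comp (J j)) J G) y z (0, 0, X)).2.2 =
      (-2 * ∑ j, y.2.1 j * z.2.1 j - h y.2.2 z.2.2 - y.1 * z.1) • X
      + ∑ j, (y.2.1 j * z.1 - h (J j y.2.2) z.2.2 - y.1 * z.2.1 j) • J j X
      - ∑ i, ∑ j, (y.2.1 i * z.2.1 j) • J i (J j X)
      + h z.2.2 X • y.2.2 - ∑ j, h (J j z.2.2) X • J j y.2.2
      - (2 : ℝ) • ∑ j, h (J j y.2.2) X • J j z.2.2
      + s ^ 2 • curvEnd dΓ Γ y.2.2 z.2.2 X := by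
  have hΓ : s ^ 2 • curvEnd dΓ Γ y.2.2 z.2.2 X = s ^ 2 • dΓ X y.2.2 z.2.2 - s ^ 2 • dΓ y.2.2 X z.2.2
      + G X (G y.2.2 z.2.2) - G y.2.2 (G X z.2.2) + G (G y.2.2 X - G X y.2.2) z.2.2 := by
    simp only [curvEnd_apply, hs, map_smul, smul_apply, smul_add, smul_sub, map_sub, sub_apply,
      pow_two, smul_smul]
    abel
  rw [hΓ, hG y.2.2 X, sub_self, map_zero, zero_apply, add_zero]
  rw [curvEnd_apply, hd, hd]
  simp only [connForm_apply, Prod.snd_add, Prod.snd_sub, Prod.fst_add, Prod.fst_sub, Pi.zero_apply, ContinuousLinearMap.comp_apply,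
    zero_mul, mul_zero, zero_smul, Finset.sum_const_zero, map_zero, zero_apply, sub_zero, zero_sub, add_zero, zero_add,
    Pi.add_apply, Pi.sub_apply, map_add, map_sub, map_sum, map_smul, add_apply, sub_apply, sum_apply, smul_apply]
  have h1 : ∀ j w, h (J j X) w = -h (J j w) X := fun j w => by rw [H.skew, H.symm]
  simp only [hG y.2.2 X, h1, H.symm X z.2.2, smul_sub, smul_add, sub_smul, add_smul, neg_neg,
    neg_smul, Finset.sum_add_distrib, Finset.sum_sub_distrib, Finset.smul_sum, smul_smul,
    Finset.sum_neg_distrib, two_mul, add_mul, two_smul, mul_comm z.1,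
    fun j => mul_comm y.1 (z.2.1 j)]
  abel

lemma curvEnd_connForm_fst (hd : IsConnDeriv h J G s dΓ dA) (y z : TotalModel k E) :
    (curvEnd dA (connForm h (fun j => h.comp (J j)) J G) y z (1, 0, 0)).1 =
      -4 * (∑ j, y.2.1 j * z.2.1 j) - h y.2.2 z.2.2 := by
  rw [curvEnd_apply, hd, hd]
  simp only [connForm_apply, Prod.snd_add, Prod.snd_sub, Prod.fst_add, Prod.fst_sub,
    Pi.zero_apply, ContinuousLinearMap.comp_apply, zero_mul, mul_zero, zero_smul, smul_zero,
    Finset.sum_const_zero, map_zero, zero_apply, sub_zero, zero_sub, add_zero, zero_add,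
    Pi.add_apply, Pi.sub_apply, neg_zero, one_smul, mul_one, Finset.mul_sum]
  rw [sub_eq_add_neg, sub_eq_add_neg]
  congr 1
  exact Finset.sum_congr rfl fun j _ => by ring

lemma curvEnd_connForm_fibre (H : IsCliffordTriple h J) (hd : IsConnDeriv h J G s dΓ dA)
    (y z : TotalModel k E) (j : Fin k) :
    (curvEnd dA (connForm h (fun j => h.comp (J j)) J G) y z (0, Pi.single j 1, 0)).2.1 j =
      -4 * (∑ j, y.2.1 j * z.2.1 j) + 4 * (y.2.1 j * z.2.1 j) - h y.2.2 z.2.2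
        - 4 * (y.1 * z.1) := by
  rw [curvEnd_apply, hd, hd]
  simp only [connForm_apply, Prod.snd_add, Prod.snd_sub, Prod.fst_add, Prod.fst_sub,
    Pi.zero_apply, ContinuousLinearMap.comp_apply, zero_mul, mul_zero, zero_smul, smul_zero,
    Finset.sum_const_zero, map_zero, zero_apply, sub_zero, zero_sub, add_zero, zero_add,
    Pi.add_apply, Pi.sub_apply, neg_zero, one_smul, mul_one, Pi.single_apply, ite_mul, mul_ite,
    ite_smul, Finset.sum_ite_eq', Finset.sum_ite_eq, Finset.mem_univ, if_true, one_mul, H.comp_comp]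
  simp
  ring

/-- The Ricci tensor of the total metric. -/
lemma trace_curvEnd_connForm (H : IsCliffordTriple h J) (hG : ∀ x y, G x y = G y x)
    (hs : ∀ x y, G x y = s • Γ x y) (hd : IsConnDeriv h J G (s ^ 2) dΓ dA) (y z : TotalModel k E)
    (hflat : LinearMap.trace ℝ E (curvEnd dΓ Γ y.2.2 z.2.2 : E →ₗ[ℝ] E) = 0) :
    LinearMap.trace ℝ _ (curvEnd dA (connForm h (fun j => h.comp (J j)) J G) y z :
      TotalModel k E →ₗ[ℝ] TotalModel k E) =
      -(Module.finrank ℝ E + 4 * k) * totalForm h y z := by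
  have hrank : ∀ (φ : E →L[ℝ] ℝ) (v : E), LinearMap.trace ℝ E ((φ : E →ₗ[ℝ] ℝ).smulRight v) = φ v :=
    fun φ v => LinearMap.trace_smulRight _ _
  have e : LinearMap.snd ℝ (Fin k → ℝ) E ∘ₗ LinearMap.snd ℝ ℝ ((Fin k → ℝ) × E) ∘ₗ
      (curvEnd dA (connForm h (fun j => h.comp (J j)) J G) y z :
        TotalModel k E →ₗ[ℝ] TotalModel k E) ∘ₗ LinearMap.inr ℝ ℝ ((Fin k → ℝ) × E) ∘ₗ
          LinearMap.inr ℝ (Fin k → ℝ) E =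
      (-2 * ∑ j, y.2.1 j * z.2.1 j - h y.2.2 z.2.2 - y.1 * z.1) • LinearMap.id
      + ∑ j, (y.2.1 j * z.1 - h (J j y.2.2) z.2.2 - y.1 * z.2.1 j) • (J j : E →ₗ[ℝ] E)
      - ∑ i, ∑ j, (y.2.1 i * z.2.1 j) • ((J i : E →ₗ[ℝ] E) ∘ₗ (J j : E →ₗ[ℝ] E))
      + (h z.2.2 : E →ₗ[ℝ] ℝ).smulRight y.2.2
      - ∑ j, (h (J j z.2.2) : E →ₗ[ℝ] ℝ).smulRight (J j y.2.2)
      - (2 : ℝ) • ∑ j, (h (J j y.2.2) : E →ₗ[ℝ] ℝ).smulRight (J j z.2.2)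
      + s ^ 2 • (curvEnd dΓ Γ y.2.2 z.2.2 : E →ₗ[ℝ] E) := by
    ext X
    refine (curvEnd_connForm_base H hG hs hd y z X).trans ?_
    simp [LinearMap.sum_apply]
  rw [trace_totalModel, e]
  simp only [ContinuousLinearMap.coe_coe, curvEnd_connForm_fst hd, curvEnd_connForm_fibre H hd,
    map_add, map_sub, map_sum, map_smul, LinearMap.trace_id, H.trace_eq_zero, H.trace_comp, hrank,
    hflat, H.comp_comp, smul_eq_mul, totalForm_apply, mul_ite, mul_zero, Finset.sum_ite_eq,
    Finset.mem_univ, if_true, Finset.sum_const_zero, Finset.sum_const, Finset.card_univ,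
    Fintype.card_fin, nsmul_eq_mul, Finset.sum_add_distrib, Finset.sum_sub_distrib, ← Finset.mul_sum]
  rw [H.symm z.2.2 y.2.2]
  simp only [mul_neg, Finset.sum_neg_distrib, ← Finset.sum_mul]
  ring

end Algebra

section FormCalculus

variable {E : Type*} [NormedAddCommGroup E] [NormedSpace ℝ E] [CompleteSpace E]
  {H : Type*} [TopologicalSpace H] {I : ModelWithCorners ℝ E H} [I.Boundaryless]
  {M : Type*} [TopologicalSpace M] [ChartedSpace H M] [IsManifold I ∞ M]
  {E' : Type*} [NormedAddCommGroup E'] [NormedSpace ℝ E'] [CompleteSpace E']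
  {H' : Type*} [TopologicalSpace H'] {I' : ModelWithCorners ℝ E' H'} [I'.Boundaryless]
  {M' : Type*} [TopologicalSpace M'] [ChartedSpace H' M'] [IsManifold I' ∞ M']
  {F : Type*} [NormedAddCommGroup F] [NormedSpace ℝ F]
  {G : Type*} [NormedAddCommGroup G] [NormedSpace ℝ G]
  {p : M}

lemma mvfderiv_clm_comp (L : F →L[ℝ] G) {f : M → F} (hf : MDifferentiableAt I 𝓘(ℝ, F) f p) :
    mvfderiv I (fun q => L (f q)) p = L.comp (mvfderiv I f p) := by
  rw [mvfderiv_comp_fderiv L.differentiableAt hf, ContinuousLinearMap.fderiv]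

lemma dForm_const_comp {α : Π q : M, TangentSpace I q →L[ℝ] F} (h : FormAt 1 α p) (L : F →L[ℝ] G)
    (u v : TangentSpace I p) : dForm (fun q => L.comp (α q)) p u v = L (dForm α p u v) := by
  have e : formRep (fun q => L.comp (α q)) p =
      fun q => ContinuousLinearMap.compL ℝ E F G L (formRep α p q) := rfl
  rw [dForm, e, mvfderiv_clm_comp _ (ContMDiffAt.mdifferentiableAt h (by simp)), dForm, map_sub]
  rfl

lemma dForm_smul {α : Π q : M, TangentSpace I q →L[ℝ] F} (h : FormAt 1 α p) {c : M → ℝ}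
    (hc : MDifferentiableAt I 𝓘(ℝ, ℝ) c p) (u v : TangentSpace I p) :
    dForm (fun q => c q • α q) p u v =
      mvfderiv I c p u • α p v - mvfderiv I c p v • α p u + c p • dForm α p u v := by
  have e : formRep (fun q => c q • α q) p = fun q => c q • formRep α p q := rfl
  rw [dForm, e]
  have h1 := mvfderiv_smul hc (ContMDiffAt.mdifferentiableAt h (by simp))
  have e2 : (fun q => c q • formRep α p q) = c • formRep α p := rfl
  rw [e2, h1, dForm]
  have e3 : ∀ w, formRep α p p (dchart I p p w) = α p w :=
    formRep_dchart α (mem_chart_source H p)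
  simp only [add_apply, smul_apply, ContinuousLinearMap.smulRight_apply, e3, smul_sub,
    ContinuousLinearMap.toSpanSingleton_apply, ContinuousLinearMap.comp_apply]
  abel

lemma dForm_mvfderiv {f : M → F} (hf : ContMDiffAt I 𝓘(ℝ, F) 2 f p) (u v : TangentSpace I p) :
    dForm (mvfderiv I f) p u v = 0 := by
  have h1 := extDeriv_eq_dForm (formAt_mvfderiv (n := 1) (hf.of_le (by norm_num)))
    (FiberBundle.mdifferentiableAt_extend I E u) (FiberBundle.mdifferentiableAt_extend I E v)
  rw [FiberBundle.extend_apply_self, FiberBundle.extend_apply_self] at h1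
  have h2 := mvfderiv_mlieBracket hf (FiberBundle.mdifferentiableAt_extend I E u)
    (FiberBundle.mdifferentiableAt_extend I E v)
  rw [FiberBundle.extend_apply_self, FiberBundle.extend_apply_self] at h2
  rw [← h1]
  exact sub_eq_zero.2 h2

lemma dForm_pullback {f : M → M'} (hf : ContMDiffAt I I' 2 f p)
    {α : Π q : M', TangentSpace I' q →L[ℝ] F} (h : FormAt 1 α (f p)) (u v : TangentSpace I p) :
    dForm (fun q => (α (f q)).comp (mfderiv I I' f q)) p u v =
      dForm α (f p) (mfderiv I I' f p u) (mfderiv I I' f p v) := by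
  have h1 := extDeriv_eq_dForm (FormAt.pullback (n := 1) (hf.of_le (by norm_num)) h)
    (FiberBundle.mdifferentiableAt_extend I E u) (FiberBundle.mdifferentiableAt_extend I E v)
  have h2 := extDeriv_pullback hf h
    (FiberBundle.mdifferentiableAt_extend I E u) (FiberBundle.mdifferentiableAt_extend I E v)
  rw [FiberBundle.extend_apply_self, FiberBundle.extend_apply_self] at h1 h2
  exact h1.symm.trans h2

end FormCalculus

section TotalAlgebra

variable {E : Type*} [NormedAddCommGroup E] [NormedSpace ℝ E] [FiniteDimensional ℝ E] {k : ℕ}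
  {h : E →L[ℝ] E →L[ℝ] ℝ} {J : Fin k → E →L[ℝ] E} {G : E →L[ℝ] E →L[ℝ] E}

lemma connForm_torsion (H : IsCliffordTriple h J) (hG : ∀ x y, G x y = G y x)
    (u w : TotalModel k E) :
    connForm h (fun j => h.comp (J j)) J G w u - connForm h (fun j => h.comp (J j)) J G u w =
      (0, fun j => 2 * (u.1 * w.2.1 j - w.1 * u.2.1 j) + 2 * h (J j u.2.2) w.2.2,
        u.1 • w.2.2 - w.1 • u.2.2) := by
  have h1 : ∀ j, h (J j w.2.2) u.2.2 = -h (J j u.2.2) w.2.2 := fun j => by rw [H.skew, H.symm]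
  rw [connForm_apply, connForm_apply, hG w.2.2, H.symm w.2.2]
  refine Prod.ext ?_ (Prod.ext (funext fun j => ?_) ?_)
  · simp [mul_comm]
  · simp [h1]; ring
  · simp only [Prod.snd_sub]; abel

lemma connForm_compat (H : IsCliffordTriple h J) (u v w : TotalModel k E) :
    totalForm h (connForm h (fun j => h.comp (J j)) J G u v) w
      + totalForm h v (connForm h (fun j => h.comp (J j)) J G u w) =
      h (G u.2.2 v.2.2) w.2.2 + h v.2.2 (G u.2.2 w.2.2) := by
  have h1 : ∀ j, h v.2.2 (J j u.2.2) = h (J j u.2.2) v.2.2 := fun j => H.symm _ _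
  have h2 : ∀ j, h v.2.2 (J j w.2.2) = -h (J j v.2.2) w.2.2 := fun j => by
    rw [H.skew, neg_neg]
  rw [connForm_apply, connForm_apply, totalForm_apply, totalForm_apply]
  simp only [map_add, map_sum, map_smul, add_apply, sum_apply, smul_apply, smul_eq_mul, h1, h2,
    ContinuousLinearMap.comp_apply, H.symm v.2.2 u.2.2, mul_sub, sub_mul, add_mul, mul_add,
    Finset.sum_sub_distrib, Finset.sum_mul, Finset.mul_sum, Finset.sum_neg_distrib, mul_neg]
  have e1 : ∑ j, -2 * (u.2.1 j * v.2.1 j) * w.1 = -∑ j, v.2.1 j * (2 * u.2.1 j * w.1) := by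
    rw [← Finset.sum_neg_distrib]; exact Finset.sum_congr rfl fun j _ => by ring
  have e2 : ∑ j, v.1 * (-2 * (u.2.1 j * w.2.1 j)) = -∑ j, 2 * u.2.1 j * v.1 * w.2.1 j := by
    rw [← Finset.sum_neg_distrib]; exact Finset.sum_congr rfl fun j _ => by ring
  have e3 : ∑ j, h (J j u.2.2) v.2.2 * w.2.1 j = ∑ j, w.2.1 j * h (J j u.2.2) v.2.2 :=
    Finset.sum_congr rfl fun j _ => mul_comm _ _
  rw [e1, e2, e3]
  ring

end TotalAlgebra

section TotalSpace

variable {k : ℕ} {E : Type*} [NormedAddCommGroup E] [NormedSpace ℝ E] [FiniteDimensional ℝ E]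
  {H : Type*} [TopologicalSpace H] {I : ModelWithCorners ℝ E H} [I.Boundaryless]
  {M : Type*} [TopologicalSpace M] [ChartedSpace H M] [IsManifold I ∞ M]
  {E' : Type*} [NormedAddCommGroup E'] [NormedSpace ℝ E'] [FiniteDimensional ℝ E']
  {H' : Type*} [TopologicalSpace H'] {I' : ModelWithCorners ℝ E' H'} [I'.Boundaryless]
  {B : Type*} [TopologicalSpace B] [ChartedSpace H' B] [IsManifold I' ∞ B]
  [MulAction (Torus k) B]

/-- A torus bundle with connection whose curvature forms are the Kähler forms of anticommuting
complex structures which are parallel for the metric of the base. -/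
structure IsTotalData (g : RiemMetric I M) (J : Fin k → EndField I M) (pr : B → M)
    (θ : Fin k → OneForm I' B) : Prop where
  bundle : IsPrincipalTorusBundle I I' k pr
  conn : IsTorusConnection I' θ
  complex : ∀ j, IsComplexStructure (J j)
  hermitian : ∀ j x u v, g.inner x (J j x u) (J j x v) = g.inner x u v
  closed : ∀ j, IsClosedForm₂ (fundForm g.inner (J j))
  anti : ∀ i j, i ≠ j → ∀ x v, J i x (J j x v) = -J j x (J i x v)
  extDeriv : ∀ j, HasExtDeriv₁ (θ j) (pullback₂ pr (fundForm g.inner (J j)))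
  rank : Module.finrank ℝ E' = Module.finrank ℝ E + k

lemma IsPrincipalTorusBundle.mdifferentiableAt {pr : B → M} (h : IsPrincipalTorusBundle I I' k pr)
    (b : B) : MDifferentiableAt I' I pr b :=
  (h.smooth_proj b).mdifferentiableAt (by simp)

/-- The generators of the torus action. -/
lemma IsTorusConnection.exists_vertical {pr : B → M} {θ : Fin k → OneForm I' B}
    (hb : IsPrincipalTorusBundle I I' k pr) (hθ : IsTorusConnection I' θ) (b : B) (i : Fin k) :
    ∃ V : TangentSpace I' b, (∀ j, θ j b V = if i = j then 1 else 0) ∧ mfderiv I' I pr b V = 0 := by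
  set c : ℝ → B := fun s => (Pi.mulSingle i (Circle.exp s) : Torus k) • b with hc
  have hc0 : c 0 = b := by simp [hc]
  have key : ∃ V : TangentSpace I' (c 0), (∀ j, θ j (c 0) V = if i = j then 1 else 0) ∧
      mfderiv I' I pr (c 0) V = 0 := by
    refine ⟨mfderiv 𝓘(ℝ, ℝ) I' c 0 (1 : ℝ), fun j => hθ.vertical i j b 0, ?_⟩
    have hd : MDifferentiableAt 𝓘(ℝ, ℝ) I' c 0 := by
      by_contra hd
      have h1 := hθ.vertical i i b 0
      rw [if_pos rfl] at h1
      simp only [pullback₁] at h1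
      rw [mfderiv_zero_of_not_mdifferentiableAt hd] at h1
      exact zero_ne_one (α := ℝ) ((map_zero (θ i _)).symm.trans h1)
    have h2 := mfderiv_comp (0 : ℝ) (hb.mdifferentiableAt (c 0)) hd
    have h3 : pr ∘ c = fun _ => pr b := funext fun s => hb.proj_smul _ _
    have h4 : mfderiv 𝓘(ℝ, ℝ) I (pr ∘ c) 0 = 0 := by rw [h3]; exact mfderiv_const
    rw [h4] at h2
    exact (congrArg (fun L => L (1 : ℝ)) h2).symm
  rwa [hc0] at key

/-- Local sections. -/
lemma IsPrincipalTorusBundle.exists_section {pr : B → M} (h : IsPrincipalTorusBundle I I' k pr)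
    (b : B) : ∃ (U : Set M) (s : M → B), IsOpen U ∧ pr b ∈ U ∧ ContMDiffOn I I' ∞ s U ∧
      s (pr b) = b ∧ ∀ x ∈ U, pr (s x) = x := by
  obtain ⟨U, hU, hx, e, hsrc, htgt, hfst, -, -, hsymm⟩ := h.locally_trivial (pr b)
  have hb : b ∈ e.source := by rw [hsrc]; exact hx
  have hmem : ∀ x ∈ U, ((x, (e b).2) : M × Torus k) ∈ e.target := fun x hx => by
    rw [htgt]; exact ⟨hx, Set.mem_univ _⟩
  refine ⟨U, fun x => e.symm (x, (e b).2), hU, hx, ?_, ?_, fun x hx => ?_⟩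
  · have h1 : ContMDiffOn I (I.prod (torusModel k)) ∞ (fun x : M => (x, (e b).2)) U :=
      contMDiffOn_id.prodMk contMDiffOn_const
    exact hsymm.comp h1 hmem
  · have : (pr b, (e b).2) = e b := Prod.ext (hfst b hb).symm rfl
    simp only [this, e.left_inv hb]
  · rw [← hfst _ (e.map_target (hmem x hx)), e.right_inv (hmem x hx)]

lemma IsPrincipalTorusBundle.surjective_mfderiv {pr : B → M}
    (h : IsPrincipalTorusBundle I I' k pr) (b : B) (X : TangentSpace I (pr b)) :
    ∃ W : TangentSpace I' b, mfderiv I' I pr b W = X := by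
  obtain ⟨U, s, hU, hx, hs, hsb, hprs⟩ := h.exists_section b
  have hs' : MDifferentiableAt I I' s (pr b) :=
    ((hs (pr b) hx).contMDiffAt (hU.mem_nhds hx)).mdifferentiableAt (by simp)
  have h2 := mfderiv_comp (pr b) (h.mdifferentiableAt (s (pr b))) hs'
  have h3 : pr ∘ s =ᶠ[𝓝 (pr b)] id := by
    filter_upwards [hU.mem_nhds hx] with x hx using hprs x hx
  rw [h3.mfderiv_eq, mfderiv_id] at h2
  have key : ∃ W : TangentSpace I' (s (pr b)), (mfderiv I' I pr (s (pr b)) W : E) = X :=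
    ⟨mfderiv I I' s (pr b) X, (congrArg (fun L => L X) h2).symm⟩
  rwa [hsb] at key

/-- The projection of the total space `ℝ × B` to the base. -/
def totalProj (pr : B → M) : ℝ × B → M := fun q => pr q.2

variable (I) in
/-- The chart of the base at `x`, on the total space. -/
noncomputable def totalChart (pr : B → M) (x : M) : ℝ × B → E := fun q =>
  extChartAt I x (totalProj pr q)

variable (I) in
/-- The coframe `(dt, 2 e^{2t} θ, e^t dx)` on the total space. -/
noncomputable def totalCoframe (pr : B → M) (θ : Fin k → OneForm I' B) (x : M) (q : ℝ × B) :
    TangentSpace (𝓘(ℝ, ℝ).prod I') q →L[ℝ] TotalModel k E :=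
  (dt q).prod ((ContinuousLinearMap.pi fun j => scaledForm (θ j) q).prod
    (Real.exp q.1 • mvfderiv (𝓘(ℝ, ℝ).prod I') (totalChart I pr x) q))

section

variable {g : RiemMetric I M} {J : Fin k → EndField I M} {pr : B → M} {θ : Fin k → OneForm I' B}
  {x : M} {q : ℝ × B}

lemma dt_apply (q : ℝ × B) (v : TangentSpace (𝓘(ℝ, ℝ).prod I') q) : dt q v = (v : ℝ × E').1 := by
  have : (dt q : TangentSpace (𝓘(ℝ, ℝ).prod I') q →L[ℝ] ℝ) = ContinuousLinearMap.fst ℝ ℝ E' :=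
    HasMFDerivAt.mvfderiv_eq (hasMFDerivAt_fst (x := q))
  rw [this]; rfl

lemma liftForm_apply (α : OneForm I' B) (q : ℝ × B) (v : TangentSpace (𝓘(ℝ, ℝ).prod I') q) :
    liftForm α q v = α q.2 (v : ℝ × E').2 := by
  have : mfderiv (𝓘(ℝ, ℝ).prod I') I' (Prod.snd : ℝ × B → B) q =
    ContinuousLinearMap.snd ℝ ℝ E' := (hasMFDerivAt_snd (x := q)).mfderiv
  simp only [liftForm, pullback₁, this]
  rfl

lemma scaledForm_apply (α : OneForm I' B) (q : ℝ × B) (v : TangentSpace (𝓘(ℝ, ℝ).prod I') q) :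
    scaledForm α q v = 2 * Real.exp (2 * q.1) * α q.2 (v : ℝ × E').2 := by
  simp only [scaledForm, smul_apply, liftForm_apply, smul_eq_mul]

lemma mfderiv_totalProj (hpr : MDifferentiableAt I' I pr q.2)
    (v : TangentSpace (𝓘(ℝ, ℝ).prod I') q) :
    mfderiv (𝓘(ℝ, ℝ).prod I') I (totalProj pr) q v = mfderiv I' I pr q.2 (v : ℝ × E').2 := by
  have h1 := (HasMFDerivAt.comp q hpr.hasMFDerivAt (hasMFDerivAt_snd (x := q) (I := 𝓘(ℝ, ℝ)))).mfderiv
  have h2 : totalProj pr = pr ∘ Prod.snd := rfl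
  rw [h2, h1]
  rfl

lemma IsPrincipalTorusBundle.contMDiff_totalProj (h : IsPrincipalTorusBundle I I' k pr) :
    ContMDiff (𝓘(ℝ, ℝ).prod I') I ∞ (totalProj pr) :=
  h.smooth_proj.comp contMDiff_snd

lemma IsPrincipalTorusBundle.mvfderiv_totalChart (h : IsPrincipalTorusBundle I I' k pr)
    (hq : totalProj pr q ∈ (chartAt H x).source) :
    mvfderiv (𝓘(ℝ, ℝ).prod I') (totalChart I pr x) q =
      (dchart I x (totalProj pr q)).comp (mfderiv (𝓘(ℝ, ℝ).prod I') I (totalProj pr) q) :=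
  mvfderiv_comp_mfderiv (mdifferentiableAt_chart hq)
    ((h.contMDiff_totalProj q).mdifferentiableAt (by simp))

lemma IsPrincipalTorusBundle.mvfderiv_totalChart_apply (h : IsPrincipalTorusBundle I I' k pr)
    (hq : totalProj pr q ∈ (chartAt H x).source) (v : TangentSpace (𝓘(ℝ, ℝ).prod I') q) :
    mvfderiv (𝓘(ℝ, ℝ).prod I') (totalChart I pr x) q v =
      dchart I x (totalProj pr q) (mfderiv I' I pr q.2 (v : ℝ × E').2) := by
  rw [h.mvfderiv_totalChart hq, ContinuousLinearMap.comp_apply,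
    mfderiv_totalProj (h.mdifferentiableAt _)]

lemma IsPrincipalTorusBundle.contMDiffAt_totalChart (h : IsPrincipalTorusBundle I I' k pr)
    (hq : totalProj pr q ∈ (chartAt H x).source) :
    ContMDiffAt (𝓘(ℝ, ℝ).prod I') 𝓘(ℝ, E) ∞ (totalChart I pr x) q :=
  ContMDiffAt.comp q (contMDiffAt_extChartAt' hq) (h.contMDiff_totalProj q)

lemma totalCoframe_apply (v : TangentSpace (𝓘(ℝ, ℝ).prod I') q) :
    totalCoframe I pr θ x q v = ((v : ℝ × E').1,
      fun j => 2 * Real.exp (2 * q.1) * θ j q.2 (v : ℝ × E').2,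
      Real.exp q.1 • mvfderiv (𝓘(ℝ, ℝ).prod I') (totalChart I pr x) q v) := by
  refine Prod.ext (dt_apply q v) (Prod.ext (funext fun j => scaledForm_apply _ q v) rfl)

lemma totalCoframe_bijective (hb : IsPrincipalTorusBundle I I' k pr) (hθ : IsTorusConnection I' θ)
    (hrank : Module.finrank ℝ E' = Module.finrank ℝ E + k)
    (hq : totalProj pr q ∈ (chartAt H x).source) :
    Function.Bijective (totalCoframe (I' := I') I pr θ x q) := by
  let L : ℝ × E' →L[ℝ] TotalModel k E := totalCoframe (I' := I') I pr θ x q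
  have hsurj : Function.Surjective L := by
    rintro ⟨a, w, X⟩
    obtain ⟨W, hW⟩ := hb.surjective_mfderiv q.2
      (dchartSymm I x (totalProj pr q) ((Real.exp q.1)⁻¹ • X))
    choose V hV hV' using hθ.exists_vertical hb q.2
    set c : Fin k → ℝ := fun j => (2 * Real.exp (2 * q.1))⁻¹ * w j - θ j q.2 W
    refine ⟨(a, W + ∑ i, c i • V i), ?_⟩
    refine (totalCoframe_apply _).trans (Prod.ext rfl (Prod.ext (funext fun j => ?_) ?_))
    · have h1 : 2 * Real.exp (2 * q.1) ≠ 0 := by positivity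
      change 2 * Real.exp (2 * q.1) * θ j q.2 (W + ∑ i, c i • V i) = w j
      rw [map_add, map_sum]
      simp only [map_smul, hV, smul_eq_mul, mul_ite, mul_one, mul_zero, Finset.sum_ite_eq',
        Finset.mem_univ, if_true, c]
      field_simp
      ring
    · change Real.exp q.1 • mvfderiv (𝓘(ℝ, ℝ).prod I') (totalChart I pr x) q
        (a, W + ∑ i, c i • V i) = X
      refine (congrArg (Real.exp q.1 • ·) (hb.mvfderiv_totalChart_apply hq _)).trans ?_
      have e : mfderiv I' I pr q.2 (W + ∑ i, c i • V i) =
          dchartSymm I x (totalProj pr q) ((Real.exp q.1)⁻¹ • X) := by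
        rw [map_add, map_sum]
        simp only [map_smul, hV', smul_zero, Finset.sum_const_zero]
        exact (add_zero _).trans (hW.trans (map_smul _ _ _))
      refine (congrArg (fun z => Real.exp q.1 • dchart I x (totalProj pr q) z) e).trans ?_
      rw [dchart_dchartSymm hq, smul_smul, mul_inv_cancel₀ (Real.exp_pos _).ne', one_smul]
  refine ⟨?_, hsurj⟩
  refine (LinearMap.injective_iff_surjective_of_finrank_eq_finrank (f := (L : ℝ × E' →ₗ[ℝ] TotalModel k E)) ?_).2 hsurj
  simp [hrank]
  omega

end

end TotalSpace

section TotalConnection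

variable {k : ℕ} {E : Type*} [NormedAddCommGroup E] [NormedSpace ℝ E] [FiniteDimensional ℝ E]
  {H : Type*} [TopologicalSpace H] {I : ModelWithCorners ℝ E H} [I.Boundaryless]
  {M : Type*} [TopologicalSpace M] [ChartedSpace H M] [IsManifold I ∞ M]
  {E' : Type*} [NormedAddCommGroup E'] [NormedSpace ℝ E'] [FiniteDimensional ℝ E']
  {H' : Type*} [TopologicalSpace H'] {I' : ModelWithCorners ℝ E' H'} [I'.Boundaryless]
  {B : Type*} [TopologicalSpace B] [ChartedSpace H' B] [IsManifold I' ∞ B]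
  [MulAction (Torus k) B]
  {g : RiemMetric I M} {J : Fin k → EndField I M} {pr : B → M} {θ : Fin k → OneForm I' B}
  {x : M} {q : ℝ × B}

lemma IsTotalData.isCliffordTriple (T : IsTotalData g J pr θ) {y : M}
    (hy : y ∈ (chartAt H x).source) :
    IsCliffordTriple (tensorRep g.inner x y) (fun j => endRep (J j) x y) where
  symm := tensorRep_symm g
  pos u hu := tensorRep_pos g hy hu
  skew j u v := by
    rw [tensorRep_apply, tensorRep_apply]
    simp only [endRep, ContinuousLinearMap.comp_apply, dchartSymm_dchart hy]
    rw [← T.hermitian j y (dchartSymm I x y u), (T.complex j).sq, map_neg, neg_neg]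
  sq j u := by
    simp only [endRep, ContinuousLinearMap.comp_apply, dchartSymm_dchart hy, (T.complex j).sq,
      map_neg, dchart_dchartSymm hy]
  anti i j hij u := by
    simp only [endRep, ContinuousLinearMap.comp_apply, dchartSymm_dchart hy, T.anti i j hij,
      map_neg]

/-- The frame dual to `totalCoframe`. -/
noncomputable def totalFrame (I : ModelWithCorners ℝ E H) (pr : B → M) (θ : Fin k → OneForm I' B)
    (x : M) (q : ℝ × B) : TotalModel k E →L[ℝ] TangentSpace (𝓘(ℝ, ℝ).prod I') q :=
  (totalCoframe I pr θ x q).inverse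

lemma exists_totalCoframe_equiv (hb : IsPrincipalTorusBundle I I' k pr)
    (hθ : IsTorusConnection I' θ) (hrank : Module.finrank ℝ E' = Module.finrank ℝ E + k)
    (hq : totalProj pr q ∈ (chartAt H x).source) :
    ∃ e : TangentSpace (𝓘(ℝ, ℝ).prod I') q ≃L[ℝ] TotalModel k E,
      (e : TangentSpace (𝓘(ℝ, ℝ).prod I') q →L[ℝ] TotalModel k E) = totalCoframe I pr θ x q := by
  let L : ℝ × E' →L[ℝ] TotalModel k E := totalCoframe (I' := I') I pr θ x q
  have h := totalCoframe_bijective hb hθ hrank hq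
  exact ⟨(LinearEquiv.ofBijective (L : ℝ × E' →ₗ[ℝ] TotalModel k E) h).toContinuousLinearEquiv, rfl⟩

lemma IsTotalData.totalFrame_totalCoframe (T : IsTotalData g J pr θ)
    (hq : totalProj pr q ∈ (chartAt H x).source) (v : TangentSpace (𝓘(ℝ, ℝ).prod I') q) :
    totalFrame I pr θ x q (totalCoframe I pr θ x q v) = v := by
  obtain ⟨e, he⟩ := exists_totalCoframe_equiv T.bundle T.conn T.rank hq
  rw [totalFrame, ← he, ContinuousLinearMap.inverse_equiv]
  exact e.symm_apply_apply v

lemma IsTotalData.totalCoframe_totalFrame (T : IsTotalData g J pr θ)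
    (hq : totalProj pr q ∈ (chartAt H x).source) (v : TotalModel k E) :
    totalCoframe I pr θ x q (totalFrame I pr θ x q v) = v := by
  obtain ⟨e, he⟩ := exists_totalCoframe_equiv T.bundle T.conn T.rank hq
  rw [totalFrame, ← he, ContinuousLinearMap.inverse_equiv]
  exact e.apply_symm_apply v

/-- The connection form of the total metric in the coframe `totalCoframe`. -/
noncomputable def totalConn (g : RiemMetric I M) (J : Fin k → EndField I M) (pr : B → M) (x : M)
    (q : ℝ × B) : TotalModel k E →L[ℝ] TotalModel k E →L[ℝ] TotalModel k E :=
  connForm (tensorRep g.inner x (totalProj pr q))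
    (fun j => (tensorRep g.inner x (totalProj pr q)).comp (endRep (J j) x (totalProj pr q)))
    (fun j => endRep (J j) x (totalProj pr q))
    (Real.exp (-q.1) • christoffel I g.inner x (totalProj pr q))

/-- The total metric in the coframe `totalCoframe`. -/
noncomputable def totalMetricRep (k : ℕ) (g : RiemMetric I M) (pr : B → M) (x : M)
    (q : ℝ × B) : TotalModel k E →L[ℝ] TotalModel k E →L[ℝ] ℝ :=
  totalForm (tensorRep g.inner x (totalProj pr q))

section Smooth

variable {P : Type*} [TopologicalSpace P] {HP EP : Type*} [NormedAddCommGroup EP]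
  [NormedSpace ℝ EP] [TopologicalSpace HP] [ChartedSpace HP P] {IP : ModelWithCorners ℝ EP HP}
  {n : ℕ∞} {p : P} {G : Type*} [NormedAddCommGroup G] [NormedSpace ℝ G]

lemma contMDiffAt_sum_clm {ι : Type*} {s : Finset ι} {c : ι → P → G}
    (h : ∀ i, ContMDiffAt IP 𝓘(ℝ, G) n (c i) p) :
    ContMDiffAt IP 𝓘(ℝ, G) n (fun q => ∑ i ∈ s, c i q) p := by
  classical
  induction s using Finset.induction_on with
  | empty => simpa using contMDiffAt_const
  | insert a s ha ih =>
    simp only [Finset.sum_insert ha]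
    exact (h a).add ih

lemma contMDiffAt_baseLift {ι : G →L[ℝ] TotalModel k E} {β : P → E →L[ℝ] E →L[ℝ] G}
    (h : ContMDiffAt IP 𝓘(ℝ, E →L[ℝ] E →L[ℝ] G) n β p) :
    ContMDiffAt IP 𝓘(ℝ, TotalModel k E →L[ℝ] TotalModel k E →L[ℝ] TotalModel k E) n
      (fun q => baseLift ι (β q)) p :=
  contMDiffAt_const.clm_comp (h.clm_comp contMDiffAt_const)

lemma contMDiffAt_smulForm {b : TotalModel k E →L[ℝ] ℝ} {j : P → E →L[ℝ] E}
    (h : ContMDiffAt IP 𝓘(ℝ, E →L[ℝ] E) n j p) :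
    ContMDiffAt IP 𝓘(ℝ, TotalModel k E →L[ℝ] TotalModel k E →L[ℝ] TotalModel k E) n
      (fun q => smulForm b (baseEnd (j q))) p := by
  have h1 : ContMDiffAt IP 𝓘(ℝ, TotalModel k E →L[ℝ] TotalModel k E) n
      (fun q => baseEnd (j q)) p := contMDiffAt_const.clm_comp (h.clm_comp contMDiffAt_const)
  exact (smulForm b).contDiff.contDiffAt.contMDiffAt.comp p h1

lemma contMDiffAt_clm_flip {F : Type*} [NormedAddCommGroup F] [NormedSpace ℝ F]
    {c : P → F →L[ℝ] F →L[ℝ] G} (h : ContMDiffAt IP 𝓘(ℝ, F →L[ℝ] F →L[ℝ] G) n c p) :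
    ContMDiffAt IP 𝓘(ℝ, F →L[ℝ] F →L[ℝ] G) n (fun q => (c q).flip) p :=
  (ContinuousLinearMap.flipₗᵢ ℝ F F
    G).toContinuousLinearEquiv.contDiff.contDiffAt.contMDiffAt.comp p h

lemma contMDiffAt_connForm {h : P → E →L[ℝ] E →L[ℝ] ℝ} {σ : Fin k → P → E →L[ℝ] E →L[ℝ] ℝ}
    {J : Fin k → P → E →L[ℝ] E} {G : P → E →L[ℝ] E →L[ℝ] E}
    (hh : ContMDiffAt IP 𝓘(ℝ, E →L[ℝ] E →L[ℝ] ℝ) n h p)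
    (hσ : ∀ j, ContMDiffAt IP 𝓘(ℝ, E →L[ℝ] E →L[ℝ] ℝ) n (σ j) p)
    (hJ : ∀ j, ContMDiffAt IP 𝓘(ℝ, E →L[ℝ] E) n (J j) p)
    (hG : ContMDiffAt IP 𝓘(ℝ, E →L[ℝ] E →L[ℝ] E) n G p) :
    ContMDiffAt IP 𝓘(ℝ, TotalModel k E →L[ℝ] TotalModel k E →L[ℝ] TotalModel k E) n
      (fun q => connForm (h q) (fun j => σ j q) (fun j => J j q) (G q)) p := by
  have h0 : ContMDiffAt IP 𝓘(ℝ, TotalModel k E →L[ℝ] TotalModel k E →L[ℝ] TotalModel k E) n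
    (fun _ : P => connFormConst k E) p := contMDiffAt_const
  have h1 := contMDiffAt_baseLift (ι := ContinuousLinearMap.inl ℝ ℝ ((Fin k → ℝ) × E)) hh
  have h2 := contMDiffAt_sum_clm (s := Finset.univ) fun j => contMDiffAt_baseLift
    (ι := (ContinuousLinearMap.inr ℝ ℝ ((Fin k → ℝ) × E)).comp
      ((ContinuousLinearMap.inl ℝ (Fin k → ℝ) E).comp
        (ContinuousLinearMap.single ℝ (fun _ : Fin k => ℝ) j))) (hσ j)
  have h3 := contMDiffAt_sum_clm (s := Finset.univ) fun j =>
    (contMDiffAt_smulForm (b := fibCoord j) (hJ j)).add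
      (contMDiffAt_clm_flip (contMDiffAt_smulForm (b := fibCoord j) (hJ j)))
  have h4 := contMDiffAt_baseLift (ι := (baseIncl : E →L[ℝ] TotalModel k E)) hG
  exact (((h0.sub h1).sub h2).add h3).add h4

lemma contMDiffAt_totalForm {h : P → E →L[ℝ] E →L[ℝ] ℝ}
    (hh : ContMDiffAt IP 𝓘(ℝ, E →L[ℝ] E →L[ℝ] ℝ) n h p) :
    ContMDiffAt IP 𝓘(ℝ, TotalModel k E →L[ℝ] TotalModel k E →L[ℝ] ℝ) n
      (fun q => totalForm (k := k) (h q)) p :=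
  contMDiffAt_const.add (contMDiffAt_const.clm_comp (hh.clm_comp contMDiffAt_const))

end Smooth

lemma contMDiff_exp_fst (c : ℝ) :
    ContMDiff (𝓘(ℝ, ℝ).prod I') 𝓘(ℝ, ℝ) ∞ (fun q : ℝ × B => Real.exp (c * q.1)) :=
  ((Real.contDiff_exp.comp (contDiff_const.mul contDiff_id)).contMDiff (n := ∞)).comp
    contMDiff_fst

lemma IsTotalData.contMDiffAt_totalConn (T : IsTotalData g J pr θ)
    (hq : totalProj pr q ∈ (chartAt H x).source) :
    ContMDiffAt (𝓘(ℝ, ℝ).prod I')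
      𝓘(ℝ, TotalModel k E →L[ℝ] TotalModel k E →L[ℝ] TotalModel k E) ∞
      (totalConn g J pr x) q := by
  have hπ := T.bundle.contMDiff_totalProj q
  have hh := (contMDiffAt_metricRep g hq).comp q hπ
  have hJ : ∀ j, ContMDiffAt (𝓘(ℝ, ℝ).prod I') 𝓘(ℝ, E →L[ℝ] E) ∞
      (fun q => endRep (J j) x (totalProj pr q)) q := fun j =>
    (contMDiffAt_endRep (n := ⊤) hq
      (((T.complex j).smooth _ (Set.mem_univ _)).contMDiffAt Filter.univ_mem)).comp q hπ
  have hG := (contMDiffAt_christoffel g hq).comp q hπ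
  have he := contMDiff_exp_fst (I' := I') (B := B) (-1) q
  simp only [neg_one_mul] at he
  exact contMDiffAt_connForm (n := ⊤) hh (fun j => hh.clm_comp (hJ j)) hJ (he.smul hG)

lemma IsTotalData.contMDiffAt_totalMetricRep (T : IsTotalData g J pr θ)
    (hq : totalProj pr q ∈ (chartAt H x).source) :
    ContMDiffAt (𝓘(ℝ, ℝ).prod I') 𝓘(ℝ, TotalModel k E →L[ℝ] TotalModel k E →L[ℝ] ℝ) ∞
      (totalMetricRep k g pr x) q :=
  contMDiffAt_totalForm (n := ⊤)
    ((contMDiffAt_metricRep g hq).comp q (T.bundle.contMDiff_totalProj q))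

lemma formAt_dt : FormAt ⊤ (dt : OneForm (𝓘(ℝ, ℝ).prod I') (ℝ × B)) q :=
  formAt_mvfderiv contMDiffAt_fst

lemma IsTotalData.formAt_liftForm (T : IsTotalData g J pr θ) (j : Fin k) :
    FormAt ⊤ (liftForm (θ j)) q :=
  FormAt.pullback (n := ⊤) contMDiffAt_snd (oneForm_smooth_iff (n := ⊤).1 (T.conn.smooth j q.2))

lemma IsTotalData.formAt_scaledForm (T : IsTotalData g J pr θ) (j : Fin k) :
    FormAt ⊤ (scaledForm (θ j)) q :=
  (T.formAt_liftForm j).smul (contMDiffAt_const.mul (contMDiff_exp_fst 2 q))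

lemma IsTotalData.formAt_totalCoframe (T : IsTotalData g J pr θ)
    (hq : totalProj pr q ∈ (chartAt H x).source) :
    FormAt ⊤ (totalCoframe I pr θ x) q := by
  have he := contMDiff_exp_fst (I' := I') (B := B) 1 q
  simp only [one_mul] at he
  exact formAt_dt.prod ((FormAt.pi T.formAt_scaledForm).prod
    ((formAt_mvfderiv (n := ⊤) (T.bundle.contMDiffAt_totalChart hq)).smul he))

end TotalConnection

section TotalConnection

variable {k : ℕ} {E : Type*} [NormedAddCommGroup E] [NormedSpace ℝ E] [FiniteDimensional ℝ E]
  {H : Type*} [TopologicalSpace H] {I : ModelWithCorners ℝ E H} [I.Boundaryless]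
  {M : Type*} [TopologicalSpace M] [ChartedSpace H M] [IsManifold I ∞ M]
  {E' : Type*} [NormedAddCommGroup E'] [NormedSpace ℝ E'] [FiniteDimensional ℝ E']
  {H' : Type*} [TopologicalSpace H'] {I' : ModelWithCorners ℝ E' H'} [I'.Boundaryless]
  {B : Type*} [TopologicalSpace B] [ChartedSpace H' B] [IsManifold I' ∞ B]
  [MulAction (Torus k) B]
  {g : RiemMetric I M} {J : Fin k → EndField I M} {pr : B → M} {θ : Fin k → OneForm I' B}
  {x : M} {q : ℝ × B}

lemma mvfderiv_comp_totalProj {F : Type*} [NormedAddCommGroup F] [NormedSpace ℝ F] {c : M → F}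
    (hb : IsPrincipalTorusBundle I I' k pr)
    (hc : ContMDiffAt I 𝓘(ℝ, F) ∞ c (totalProj pr q)) :
    mvfderiv (𝓘(ℝ, ℝ).prod I') (fun z => c (totalProj pr z)) q =
      (mvfderiv I c (totalProj pr q)).comp (mfderiv (𝓘(ℝ, ℝ).prod I') I (totalProj pr) q) :=
  mvfderiv_comp_mfderiv (hc.mdifferentiableAt (by simp))
    ((hb.contMDiff_totalProj q).mdifferentiableAt (by simp))

lemma mdifferentiableAt_comp_totalProj {F : Type*} [NormedAddCommGroup F] [NormedSpace ℝ F]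
    {c : M → F} (hb : IsPrincipalTorusBundle I I' k pr)
    (hc : ContMDiffAt I 𝓘(ℝ, F) ∞ c (totalProj pr q)) :
    MDifferentiableAt (𝓘(ℝ, ℝ).prod I') 𝓘(ℝ, F) (fun z => c (totalProj pr z)) q :=
  (hc.mdifferentiableAt (by simp)).comp q
    ((hb.contMDiff_totalProj q).mdifferentiableAt (by simp))

/-- The third component of the coframe determines the differential of the projection. -/
lemma mfderiv_totalProj_eq (hb : IsPrincipalTorusBundle I I' k pr)
    (hq : totalProj pr q ∈ (chartAt H x).source) (v : TangentSpace (𝓘(ℝ, ℝ).prod I') q) :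
    mfderiv (𝓘(ℝ, ℝ).prod I') I (totalProj pr) q v = dchartSymm I x (totalProj pr q)
      (Real.exp (-q.1) • (totalCoframe I pr θ x q v).2.2) := by
  rw [totalCoframe_apply, smul_smul, ← Real.exp_add, neg_add_cancel, Real.exp_zero, one_smul,
    hb.mvfderiv_totalChart hq, ContinuousLinearMap.comp_apply, dchartSymm_dchart hq]

lemma mvfderiv_metricRep (hq : totalProj pr q ∈ (chartAt H x).source) (X y z : E) :
    mvfderiv I (tensorRep g.inner x) (totalProj pr q) (dchartSymm I x (totalProj pr q) X) y z =
      tensorRep g.inner x (totalProj pr q) (christoffel I g.inner x (totalProj pr q) X y) z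
        + tensorRep g.inner x (totalProj pr q) y
            (christoffel I g.inner x (totalProj pr q) X z) := by
  rw [(isConnCoframe_chart g hq).compat, dchart_dchartSymm hq]

lemma mvfderiv_exp_fst (c : ℝ) (v : TangentSpace (𝓘(ℝ, ℝ).prod I') q) :
    mvfderiv (𝓘(ℝ, ℝ).prod I') (fun z : ℝ × B => Real.exp (c * z.1)) q v =
      c * Real.exp (c * q.1) * (v : ℝ × E').1 := by
  have h1 : HasDerivAt (fun t : ℝ => Real.exp (c * t)) (c * Real.exp (c * q.1)) q.1 := by
    simpa [mul_comm] using ((hasDerivAt_id q.1).const_mul c).exp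
  have h2 : MDifferentiableAt (𝓘(ℝ, ℝ).prod I') 𝓘(ℝ, ℝ) (Prod.fst : ℝ × B → ℝ) q :=
    mdifferentiableAt_fst
  rw [mvfderiv_comp_fderiv (g := fun t => Real.exp (c * t)) (f := Prod.fst) h1.differentiableAt h2,
    h1.hasFDerivAt.fderiv, ContinuousLinearMap.comp_apply]
  change (dt q v) • (c * Real.exp (c * q.1)) = _
  rw [dt_apply, smul_eq_mul, mul_comm]

lemma IsTotalData.dForm_scaledForm [T2Space B] (T : IsTotalData g J pr θ) (j : Fin k)
    (hq : totalProj pr q ∈ (chartAt H x).source) (u v : TangentSpace (𝓘(ℝ, ℝ).prod I') q) :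
    dForm (scaledForm (θ j)) q u v =
      2 * ((totalCoframe I pr θ x q u).1 * (totalCoframe I pr θ x q v).2.1 j
        - (totalCoframe I pr θ x q v).1 * (totalCoframe I pr θ x q u).2.1 j)
      + 2 * tensorRep g.inner x (totalProj pr q)
        (endRep (J j) x (totalProj pr q) (totalCoframe I pr θ x q u).2.2)
          (totalCoframe I pr θ x q v).2.2 := by
  have hθ : FormAt ⊤ (θ j) q.2 := oneForm_smooth_iff (n := ⊤).1 (T.conn.smooth j q.2)
  have h1 : dForm (liftForm (θ j)) q u v = g.inner (totalProj pr q)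
      (J j _ (mfderiv (𝓘(ℝ, ℝ).prod I') I (totalProj pr) q u))
      (mfderiv (𝓘(ℝ, ℝ).prod I') I (totalProj pr) q v) := by
    refine (dForm_pullback (f := (Prod.snd : ℝ × B → B)) contMDiffAt_snd
      (hθ.of_le (by simp)) u v).trans ?_
    rw [HasExtDeriv₁.dForm_eq (hθ.of_le (by simp)) (T.extDeriv j)]
    have h2 := mfderiv_comp q (T.bundle.mdifferentiableAt q.2)
      (mdifferentiableAt_snd (I := 𝓘(ℝ, ℝ)) (I' := I') (x := q))
    have h3 : pr ∘ Prod.snd = totalProj pr := rfl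
    rw [h3] at h2
    rw [h2]
    rfl
  have h2 : MDifferentiableAt (𝓘(ℝ, ℝ).prod I') 𝓘(ℝ, ℝ)
      (fun z : ℝ × B => Real.exp (2 * z.1)) q :=
    (contMDiff_exp_fst 2 q).mdifferentiableAt (by simp)
  have h3 : mvfderiv (𝓘(ℝ, ℝ).prod I') (fun z : ℝ × B => 2 * Real.exp (2 * z.1)) q =
      (2 : ℝ) • mvfderiv (𝓘(ℝ, ℝ).prod I') (fun z : ℝ × B => Real.exp (2 * z.1)) q :=
    mvfderiv_clm_comp ((2 : ℝ) • ContinuousLinearMap.id ℝ ℝ) h2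
  have h4 := dForm_smul ((T.formAt_liftForm j (q := q)).of_le (by simp))
    ((mdifferentiableAt_comp_differentiableAt (g := fun s : ℝ => 2 * s) (by fun_prop) h2)) u v
  refine h4.trans ?_
  rw [h1, h3, mfderiv_totalProj_eq (θ := θ) T.bundle hq u, mfderiv_totalProj_eq (θ := θ) T.bundle hq v]
  simp only [smul_apply, mvfderiv_exp_fst, tensorRep_apply, endRep, ContinuousLinearMap.comp_apply,
    dchartSymm_dchart hq, map_smul, smul_eq_mul]
  have e1 : Real.exp (2 * q.1) * (Real.exp (-q.1) * Real.exp (-q.1)) = 1 := by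
    rw [← Real.exp_add, ← Real.exp_add]; ring_nf; exact Real.exp_zero
  have hc : ∀ v, (totalCoframe (I' := I') I pr θ x q v).1 = (v : ℝ × E').1 := dt_apply q
  have hf : ∀ v, (totalCoframe (I' := I') I pr θ x q v).2.1 j =
      2 * Real.exp (2 * q.1) * θ j q.2 (v : ℝ × E').2 := scaledForm_apply _ q
  simp only [hc, hf, liftForm_apply]
  linear_combination (2 * g.inner (totalProj pr q) (J j _ (dchartSymm I x (totalProj pr q)
    (totalCoframe I pr θ x q u).2.2)) (dchartSymm I x (totalProj pr q)
    (totalCoframe I pr θ x q v).2.2)) * e1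

lemma IsTotalData.dForm_totalCoframe [T2Space B] (T : IsTotalData g J pr θ)
    (hq : totalProj pr q ∈ (chartAt H x).source) (u v : TangentSpace (𝓘(ℝ, ℝ).prod I') q) :
    dForm (totalCoframe I pr θ x) q u v = (0, fun j =>
      2 * ((totalCoframe I pr θ x q u).1 * (totalCoframe I pr θ x q v).2.1 j
        - (totalCoframe I pr θ x q v).1 * (totalCoframe I pr θ x q u).2.1 j)
      + 2 * tensorRep g.inner x (totalProj pr q)
        (endRep (J j) x (totalProj pr q) (totalCoframe I pr θ x q u).2.2)
          (totalCoframe I pr θ x q v).2.2,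
      (totalCoframe I pr θ x q u).1 • (totalCoframe I pr θ x q v).2.2
        - (totalCoframe I pr θ x q v).1 • (totalCoframe I pr θ x q u).2.2) := by
  have h := (T.formAt_totalCoframe hq).of_le (m := 1) (by simp)
  have hf := T.bundle.contMDiffAt_totalChart hq
  refine Prod.ext ?_ (Prod.ext (funext fun j => ?_) ?_)
  · refine (dForm_const_comp h (ContinuousLinearMap.fst ℝ ℝ ((Fin k → ℝ) × E)) u v).symm.trans ?_
    exact dForm_mvfderiv contMDiffAt_fst u v
  · refine (dForm_const_comp h (fibCoord j) u v).symm.trans ?_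
    exact T.dForm_scaledForm j hq u v
  · refine (dForm_const_comp h baseCoord u v).symm.trans ?_
    have he := contMDiff_exp_fst (I' := I') (B := B) 1 q
    have h1 := dForm_smul (c := fun q : ℝ × B => Real.exp (1 * q.1)) (formAt_mvfderiv (n := 1) (hf.of_le (by
      exact_mod_cast le_top))) (he.mdifferentiableAt (by simp)) u v
    have h2 : (fun q => baseCoord.comp (totalCoframe I pr θ x q)) = fun q =>
      Real.exp (1 * q.1) • mvfderiv (𝓘(ℝ, ℝ).prod I') (totalChart I pr x) q := by
      funext q; rw [one_mul]; rfl
    rw [h2]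
    refine h1.trans ?_
    rw [dForm_mvfderiv (hf.of_le (WithTop.coe_le_coe.2 (le_top : (2 : ℕ∞) ≤ ⊤))), mvfderiv_exp_fst, mvfderiv_exp_fst,
      totalCoframe_apply, totalCoframe_apply]
    simp [smul_smul, mul_comm]

/-- The coframe of the total metric and its connection form. -/
lemma IsTotalData.isConnCoframe [T2Space M] [T2Space B] (T : IsTotalData g J pr θ)
    (hq : totalProj pr q ∈ (chartAt H x).source) :
    IsConnCoframe (totalMetric pr g θ) (totalMetricRep k g pr x) (totalCoframe I pr θ x)
      (totalFrame I pr θ x) (totalConn g J pr x) q where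
  smooth := T.formAt_totalCoframe hq
  smooth_conn := T.contMDiffAt_totalConn hq
  left_inv := T.totalFrame_totalCoframe hq
  right_inv := T.totalCoframe_totalFrame hq
  smooth_metric := T.contMDiffAt_totalMetricRep hq
  metric u v := by
    have e1 : Real.exp (4 * q.1) = Real.exp (2 * q.1) * Real.exp (2 * q.1) := by
      rw [← Real.exp_add]; ring_nf
    have e2 : Real.exp (2 * q.1) * (Real.exp (-q.1) * Real.exp (-q.1)) = 1 := by
      rw [← Real.exp_add, ← Real.exp_add]; ring_nf; exact Real.exp_zero
    have h1 : baseForm (I' := I') pr g.inner q u v = tensorRep g.inner x (totalProj pr q)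
        (totalCoframe I pr θ x q u).2.2 (totalCoframe I pr θ x q v).2.2 := by
      change Real.exp (2 * q.1) * g.inner (totalProj pr q)
        (mfderiv (𝓘(ℝ, ℝ).prod I') I (totalProj pr) q u)
        (mfderiv (𝓘(ℝ, ℝ).prod I') I (totalProj pr) q v) = _
      rw [mfderiv_totalProj_eq (θ := θ) T.bundle hq u, mfderiv_totalProj_eq (θ := θ) T.bundle hq v]
      simp only [map_smul, smul_apply, smul_eq_mul, tensorRep_apply]
      linear_combination g.inner (totalProj pr q) (dchartSymm I x (totalProj pr q)
        (totalCoframe I pr θ x q u).2.2) (dchartSymm I x (totalProj pr q)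
          (totalCoframe I pr θ x q v).2.2) * e2
    rw [totalMetricRep, totalForm_apply, ← h1]
    simp only [totalMetric, add_apply, smul_apply, sum_apply, tensor,
      ContinuousLinearMap.smulRight_apply, dt_apply, liftForm_apply, smul_eq_mul, totalCoframe_apply]
    congr 2
    rw [e1, Finset.mul_sum]
    exact Finset.sum_congr rfl fun j _ => by ring
  compat u v w := by
    have hB := (T.contMDiffAt_totalMetricRep hq).mdifferentiableAt (by simp)
    have h1 := (mvfderiv_clm_apply₂ hB (mdifferentiableAt_const (c := v))
      (mdifferentiableAt_const (c := w))).2 u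
    have hh := mdifferentiableAt_comp_totalProj T.bundle (contMDiffAt_metricRep g hq)
    have h2 := (mvfderiv_clm_apply₂ hh (mdifferentiableAt_const (c := v.2.2))
      (mdifferentiableAt_const (c := w.2.2))).2 u
    simp only [mvfderiv_const, zero_apply, map_zero, add_zero] at h1 h2
    have h3 : (fun z => totalMetricRep k g pr x z v w) =
      (fun _ => v.1 * w.1 + ∑ j, v.2.1 j * w.2.1 j) +
        fun z : ℝ × B => tensorRep g.inner x (totalProj pr z) v.2.2 w.2.2 := by
      funext z; exact totalForm_apply _ _ _
    rw [← h1, h3, mvfderiv_add mdifferentiableAt_const (mvfderiv_clm_apply₂ hh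
      (mdifferentiableAt_const (c := v.2.2)) (mdifferentiableAt_const (c := w.2.2))).1,
      mvfderiv_const, zero_add, h2, mvfderiv_comp_totalProj T.bundle (contMDiffAt_metricRep g hq),
      ContinuousLinearMap.comp_apply, mfderiv_totalProj_eq (θ := θ) T.bundle hq u,
      mvfderiv_metricRep hq, totalMetricRep, totalConn, connForm_compat (T.isCliffordTriple hq)]
    simp only [smul_apply, map_smul]
  torsion u v := by
    rw [T.dForm_totalCoframe hq, totalConn, connForm_torsion (T.isCliffordTriple hq) fun X y => by
      simp only [smul_apply, christoffel_symm hq X y]]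

end TotalConnection

section Metric

lemma isVonNBounded_of_pos {V : Type*} [NormedAddCommGroup V] [NormedSpace ℝ V]
    [FiniteDimensional ℝ V] (b : V →L[ℝ] V →L[ℝ] ℝ) (hb : ∀ v, v ≠ 0 → 0 < b v v) :
    Bornology.IsVonNBounded ℝ {v : V | b v v < 1} := by
  have hcont : Continuous fun v : V => b v v := b.continuous.clm_apply continuous_id
  obtain ⟨m, hm, hbm⟩ : ∃ m > 0, ∀ v, ‖v‖ = 1 → m ≤ b v v := by
    rcases (Metric.sphere (0 : V) 1).eq_empty_or_nonempty with h | h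
    · refine ⟨1, one_pos, fun v hv => ?_⟩
      have : v ∈ Metric.sphere (0 : V) 1 := by simpa using hv
      rw [h] at this
      exact this.elim
    · obtain ⟨v₀, hv₀, hmin⟩ := (isCompact_sphere (0 : V) 1).exists_isMinOn h hcont.continuousOn
      refine ⟨b v₀ v₀, hb v₀ ?_, fun v hv => hmin (by simpa using hv)⟩
      rintro rfl
      simp at hv₀
  rw [NormedSpace.isVonNBounded_iff]
  refine (Metric.isBounded_iff_subset_closedBall 0).2 ⟨√(1 / m), fun v hv => ?_⟩
  rw [mem_closedBall_zero_iff]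
  refine Real.le_sqrt_of_sq_le ?_
  rw [le_div_iff₀ hm]
  rcases eq_or_ne v 0 with rfl | hv0
  · simp
  · have h1 := hbm (‖v‖⁻¹ • v) (by rw [norm_smul, norm_inv, norm_norm,
      inv_mul_cancel₀ (norm_ne_zero_iff.2 hv0)])
    have h0 : 0 < ‖v‖ := norm_pos_iff.2 hv0
    simp only [map_smul, smul_apply, smul_eq_mul] at h1
    have h2 : ‖v‖ ^ 2 * m ≤ b v v := by
      calc ‖v‖ ^ 2 * m ≤ ‖v‖ ^ 2 * (‖v‖⁻¹ * (‖v‖⁻¹ * b v v)) := by gcongr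
        _ = b v v := by field_simp
    exact h2.trans (le_of_lt hv)

variable {E : Type*} [NormedAddCommGroup E] [NormedSpace ℝ E] [FiniteDimensional ℝ E]
  {H : Type*} [TopologicalSpace H] {I : ModelWithCorners ℝ E H} [I.Boundaryless]
  {M : Type*} [TopologicalSpace M] [ChartedSpace H M] [IsManifold I ∞ M]
  {F : Type*} [NormedAddCommGroup F] [NormedSpace ℝ F]

/-- A positive definite bilinear form given by a smooth coframe, as a Riemannian metric. -/
noncomputable def coframeMetric (g : Tensor2 I M) (hsymm : ∀ p u v, g p u v = g p v u)
    (hpos : ∀ p u, u ≠ 0 → 0 < g p u u) {B : M → M → F →L[ℝ] F →L[ℝ] ℝ}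
    {Φ : M → Π q : M, TangentSpace I q →L[ℝ] F} {Ψ : M → Π q : M, F →L[ℝ] TangentSpace I q}
    {A : M → M → F →L[ℝ] F →L[ℝ] F}
    (h : ∀ p, ∀ᶠ q in 𝓝 p, IsConnCoframe g (B p) (Φ p) (Ψ p) (A p) q) : RiemMetric I M where
  inner := g
  symm := hsymm
  pos := hpos
  isVonNBounded p := isVonNBounded_of_pos (V := E) (g p) (hpos p)
  contMDiff p := by
    refine tensor_smooth_iff (n := ⊤).2 ?_
    have hp := (h p).self_of_nhds
    have h1 : ContMDiffAt I 𝓘(ℝ, E →L[ℝ] F) ∞ (formRep (Φ p) p) p := hp.smooth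
    refine ((h1.clm_precomp (F₃ := ℝ)).clm_comp
      (hp.smooth_metric.clm_comp h1)).congr_of_eventuallyEq ?_
    filter_upwards [h p] with q hq
    ext u v
    rw [tensorRep_apply, hq.metric]
    rfl

end Metric

section TotalConnection

variable {k : ℕ} {E : Type*} [NormedAddCommGroup E] [NormedSpace ℝ E] [FiniteDimensional ℝ E]
  {H : Type*} [TopologicalSpace H] {I : ModelWithCorners ℝ E H} [I.Boundaryless]
  {M : Type*} [TopologicalSpace M] [ChartedSpace H M] [IsManifold I ∞ M]
  {E' : Type*} [NormedAddCommGroup E'] [NormedSpace ℝ E'] [FiniteDimensional ℝ E']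
  {H' : Type*} [TopologicalSpace H'] {I' : ModelWithCorners ℝ E' H'} [I'.Boundaryless]
  {B : Type*} [TopologicalSpace B] [ChartedSpace H' B] [IsManifold I' ∞ B]
  [MulAction (Torus k) B]
  {g : RiemMetric I M} {J : Fin k → EndField I M} {pr : B → M} {θ : Fin k → OneForm I' B}
  {x : M} {q : ℝ × B}

lemma mvfderiv_comp_totalProj_totalFrame {F : Type*} [NormedAddCommGroup F] [NormedSpace ℝ F]
    {c : M → F} (T : IsTotalData g J pr θ) (hq : totalProj pr q ∈ (chartAt H x).source)
    (hc : MDifferentiableAt I 𝓘(ℝ, F) c (totalProj pr q)) (X : TotalModel k E) :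
    MDifferentiableAt (𝓘(ℝ, ℝ).prod I') 𝓘(ℝ, F) (fun z => c (totalProj pr z)) q ∧
    mvfderiv (𝓘(ℝ, ℝ).prod I') (fun z => c (totalProj pr z)) q (totalFrame I pr θ x q X) =
      mvfderiv I c (totalProj pr q)
        (dchartSymm I x (totalProj pr q) (Real.exp (-q.1) • X.2.2)) := by
  have hπ := (T.bundle.contMDiff_totalProj q).mdifferentiableAt (by simp)
  refine ⟨hc.comp q hπ, ?_⟩
  rw [mvfderiv_comp_mfderiv hc hπ,
    ContinuousLinearMap.comp_apply, mfderiv_totalProj_eq (θ := θ) T.bundle hq,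
    T.totalCoframe_totalFrame hq]

lemma IsTotalData.isConnDeriv [T2Space M] (T : IsTotalData g J pr θ)
    (hq : totalProj pr q ∈ (chartAt H x).source) :
    IsConnDeriv (tensorRep g.inner x (totalProj pr q)) (fun j => endRep (J j) x (totalProj pr q))
      (Real.exp (-q.1) • christoffel I g.inner x (totalProj pr q)) (Real.exp (-q.1) ^ 2)
      ((mvfderiv I (christoffel I g.inner x) (totalProj pr q)).comp
        (dchartSymm I x (totalProj pr q)))
      ((mvfderiv (𝓘(ℝ, ℝ).prod I') (totalConn g J pr x) q).comp (totalFrame I pr θ x q)) := by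
  intro X y z
  set p := totalProj pr q with hp
  set V := totalFrame I pr θ x q X with hV
  have hA := (T.contMDiffAt_totalConn hq).mdifferentiableAt (by simp)
  obtain ⟨h1, h2⟩ := mvfderiv_clm_apply₂ hA (mdifferentiableAt_const (c := y))
    (mdifferentiableAt_const (c := z))
  have h3 := h2 V
  simp only [mvfderiv_const, zero_apply, map_zero, add_zero] at h3
  have hL : ∀ {G : Type} [NormedAddCommGroup G] [NormedSpace ℝ G] (L : TotalModel k E →L[ℝ] G),
      L (mvfderiv (𝓘(ℝ, ℝ).prod I') (totalConn g J pr x) q V y z) =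
        mvfderiv (𝓘(ℝ, ℝ).prod I') (fun w => L (totalConn g J pr x w y z)) q V := fun L => by
    rw [← h3, mvfderiv_clm_comp L h1]; rfl
  have hLE : baseCoord (mvfderiv (𝓘(ℝ, ℝ).prod I') (totalConn g J pr x) q V y z) =
        mvfderiv (𝓘(ℝ, ℝ).prod I') (fun w => baseCoord (totalConn g J pr x w y z)) q V := by
    rw [← h3, mvfderiv_clm_comp _ h1]; rfl
  have hh := (contMDiffAt_metricRep g hq).mdifferentiableAt (by simp)
  have hJ : ∀ j, MDifferentiableAt I 𝓘(ℝ, E →L[ℝ] E) (endRep (J j) x) p := fun j =>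
    (contMDiffAt_endRep (n := ⊤) hq (((T.complex j).smooth _
      (Set.mem_univ _)).contMDiffAt Filter.univ_mem)).mdifferentiableAt (by simp)
  have hG := (contMDiffAt_christoffel g hq).mdifferentiableAt (by simp)
  set s := Real.exp (-q.1) with hs
  set W := dchartSymm I x p (s • X.2.2) with hW
  have dJ : ∀ j u, MDifferentiableAt I 𝓘(ℝ, E) (fun m => endRep (J j) x m u) p ∧
      mvfderiv I (fun m => endRep (J j) x m u) p W =
        endRep (J j) x p (christoffel I g.inner x p (s • X.2.2) u)
          - christoffel I g.inner x p (s • X.2.2) (endRep (J j) x p u) := fun j u => by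
    obtain ⟨a1, a2⟩ := mvfderiv_clm_apply (hJ j) (mdifferentiableAt_const (c := u))
    refine ⟨a1, (a2 W).trans ?_⟩
    rw [mvfderiv_const, zero_apply, map_zero, add_zero,
      endRep_parallel (T.complex j) (T.hermitian j) (T.closed j) hq]
  refine Prod.ext ?_ (Prod.ext (funext fun j => ?_) ?_)
  · refine (hL (ContinuousLinearMap.fst ℝ ℝ ((Fin k → ℝ) × E))).trans ?_
    obtain ⟨a1, a2⟩ := mvfderiv_clm_apply₂ hh (mdifferentiableAt_const (c := y.2.2))
      (mdifferentiableAt_const (c := z.2.2))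
    obtain ⟨b1, b2⟩ := mvfderiv_comp_totalProj_totalFrame T hq a1 X
    have e : (fun w => ContinuousLinearMap.fst ℝ ℝ ((Fin k → ℝ) × E) (totalConn g J pr x w y z)) =
        (fun _ => -2 * ∑ j, y.2.1 j * z.2.1 j) -
          fun w => tensorRep g.inner x (totalProj pr w) y.2.2 z.2.2 := by
      funext w
      exact congrArg Prod.fst (connForm_apply _ _ _ _ _ _)
    rw [e, mvfderiv_sub mdifferentiableAt_const b1, mvfderiv_const, zero_sub, neg_apply, b2, a2,
      mvfderiv_metricRep hq]
    simp only [mvfderiv_const, zero_apply, map_zero, add_zero, map_smul, smul_apply, smul_zero]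
    rfl
  · refine (hL (fibCoord j)).trans ?_
    obtain ⟨a1, a2⟩ := mvfderiv_clm_apply₂ hh (dJ j y.2.2).1
      (mdifferentiableAt_const (c := z.2.2))
    obtain ⟨b1, b2⟩ := mvfderiv_comp_totalProj_totalFrame T hq a1 X
    have e : (fun w => fibCoord j (totalConn g J pr x w y z)) = (fun _ => 2 * y.2.1 j * z.1) -
        fun w => tensorRep g.inner x (totalProj pr w) (endRep (J j) x (totalProj pr w) y.2.2)
          z.2.2 := by
      funext w
      exact congrArg (fun u : TotalModel k E => u.2.1 j) (connForm_apply _ _ _ _ _ _)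
    rw [e, mvfderiv_sub mdifferentiableAt_const b1, mvfderiv_const, zero_sub, neg_apply, b2, a2,
      mvfderiv_metricRep hq, (dJ j y.2.2).2]
    simp only [mvfderiv_const, zero_apply, map_zero, add_zero, map_smul, smul_apply, map_sub,
      sub_apply, smul_zero, smul_sub, ← hp, ← hs]
    ring
  · refine hLE.trans ?_
    obtain ⟨a1, a2⟩ := mvfderiv_clm_apply₂ hG (mdifferentiableAt_const (c := y.2.2))
      (mdifferentiableAt_const (c := z.2.2))
    obtain ⟨b1, b2⟩ := mvfderiv_comp_totalProj_totalFrame T hq a1 X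
    have he : MDifferentiableAt (𝓘(ℝ, ℝ).prod I') 𝓘(ℝ, ℝ)
        (fun w : ℝ × B => Real.exp (-1 * w.1)) q :=
      (contMDiff_exp_fst (-1) q).mdifferentiableAt (by simp)
    have c1 : ∀ u u' : TotalModel k E, MDifferentiableAt (𝓘(ℝ, ℝ).prod I') 𝓘(ℝ, E)
        (fun w => ∑ j, u.2.1 j • endRep (J j) x (totalProj pr w) u'.2.2) q ∧
        mvfderiv (𝓘(ℝ, ℝ).prod I')
          (fun w => ∑ j, u.2.1 j • endRep (J j) x (totalProj pr w) u'.2.2) q V =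
        ∑ j, u.2.1 j • (endRep (J j) x p (christoffel I g.inner x p (s • X.2.2) u'.2.2)
          - christoffel I g.inner x p (s • X.2.2) (endRep (J j) x p u'.2.2)) := by
      intro u u'
      have d : ∀ j, HasMFDerivAt (𝓘(ℝ, ℝ).prod I') 𝓘(ℝ, E)
          (fun w => u.2.1 j • endRep (J j) x (totalProj pr w) u'.2.2) q
          (u.2.1 j • mvfderiv (𝓘(ℝ, ℝ).prod I')
            (fun w => endRep (J j) x (totalProj pr w) u'.2.2) q) := fun j =>
        (hasMFDerivAt_mvfderiv
          (mvfderiv_comp_totalProj_totalFrame T hq (dJ j u'.2.2).1 X).1).const_smul _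
      have d' := HasMFDerivAt.sum (t := Finset.univ) fun j _ => d j
      have d2 : (∑ j, fun w => u.2.1 j • endRep (J j) x (totalProj pr w) u'.2.2) =
        fun w => ∑ j, u.2.1 j • endRep (J j) x (totalProj pr w) u'.2.2 := by
        funext w; simp
      rw [d2] at d'
      refine ⟨d'.mdifferentiableAt, ?_⟩
      rw [HasMFDerivAt.mvfderiv_eq d', sum_apply]
      refine Finset.sum_congr rfl fun j _ => ?_
      rw [smul_apply, (mvfderiv_comp_totalProj_totalFrame T hq (dJ j u'.2.2).1 X).2, (dJ j _).2]
    have e : (fun w => baseCoord (totalConn g J pr x w y z)) =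
        (((fun _ => z.1 • y.2.2) + fun w : ℝ × B => ∑ j, y.2.1 j • endRep (J j) x (totalProj pr w) z.2.2)
        + fun w : ℝ × B => ∑ j, z.2.1 j • endRep (J j) x (totalProj pr w) y.2.2)
        + (fun w : ℝ × B => Real.exp (-1 * w.1)) •
            fun w : ℝ × B => christoffel I g.inner x (totalProj pr w) y.2.2 z.2.2 := by
      funext w
      refine (congrArg (fun u : TotalModel k E => u.2.2) (connForm_apply _ _ _ _ _ _)).trans ?_
      simp
    have m1 := (mdifferentiableAt_const (c := z.1 • y.2.2) (x := q)
      (I := 𝓘(ℝ, ℝ).prod I') (I' := 𝓘(ℝ, E))).add (c1 y z).1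
    rw [e, mvfderiv_add (m1.add (c1 z y).1) (he.smul b1), mvfderiv_add m1 (c1 z y).1,
      mvfderiv_add mdifferentiableAt_const (c1 y z).1, mvfderiv_const, zero_add,
      mvfderiv_smul he b1]
    simp only [add_apply, (c1 y z).2, (c1 z y).2, smul_apply, b2, a2, mvfderiv_const, zero_apply, map_zero,
      add_zero, ContinuousLinearMap.smulRight_apply, ContinuousLinearMap.comp_apply, ContinuousLinearMap.toSpanSingleton_apply, mvfderiv_exp_fst]
    have hX1 : (V : ℝ × E').1 = X.1 := by
      rw [← dt_apply q V]
      exact congrArg Prod.fst (T.totalCoframe_totalFrame hq X)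
    have b3 := b2
    rw [a2, map_smul, map_smul] at b3
    simp only [mvfderiv_const, zero_apply, map_zero, add_zero, smul_apply] at b3
    rw [hX1, hV, b3]
    simp only [neg_one_mul, ← hs, ← hp, map_smul, smul_apply]
    module

end TotalConnection

section TotalMetric

variable {k : ℕ} {E : Type*} [NormedAddCommGroup E] [NormedSpace ℝ E] [FiniteDimensional ℝ E]
  {H : Type*} [TopologicalSpace H] {I : ModelWithCorners ℝ E H} [I.Boundaryless]
  {M : Type*} [TopologicalSpace M] [ChartedSpace H M] [IsManifold I ∞ M]
  {E' : Type*} [NormedAddCommGroup E'] [NormedSpace ℝ E'] [FiniteDimensional ℝ E']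
  {H' : Type*} [TopologicalSpace H'] {I' : ModelWithCorners ℝ E' H'} [I'.Boundaryless]
  {B : Type*} [TopologicalSpace B] [ChartedSpace H' B] [IsManifold I' ∞ B]
  [MulAction (Torus k) B]
  {g : RiemMetric I M} {J : Fin k → EndField I M} {pr : B → M} {θ : Fin k → OneForm I' B}
  {x : M} {q : ℝ × B}

variable [T2Space M] [T2Space B]

lemma IsTotalData.eventually_isConnCoframe (T : IsTotalData g J pr θ)
    (hq : totalProj pr q ∈ (chartAt H x).source) :
    ∀ᶠ z in 𝓝 q, IsConnCoframe (totalMetric pr g θ) (totalMetricRep k g pr x)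
      (totalCoframe I pr θ x) (totalFrame I pr θ x) (totalConn g J pr x) z := by
  filter_upwards [(T.bundle.contMDiff_totalProj q).continuousAt.preimage_mem_nhds
    ((chartAt H x).open_source.mem_nhds hq)] with z hz using T.isConnCoframe hz

lemma IsTotalData.totalMetric_symm (T : IsTotalData g J pr θ) (p : ℝ × B)
    (u v : TangentSpace (𝓘(ℝ, ℝ).prod I') p) :
    totalMetric pr g θ p u v = totalMetric pr g θ p v u := by
  have h := T.isConnCoframe (mem_chart_source H (totalProj pr p))
  rw [h.metric, h.metric, totalMetricRep, totalForm_apply, totalForm_apply, tensorRep_symm]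
  simp only [mul_comm]

lemma IsTotalData.totalMetric_pos (T : IsTotalData g J pr θ) (p : ℝ × B)
    (u : TangentSpace (𝓘(ℝ, ℝ).prod I') p) (hu : u ≠ 0) : 0 < totalMetric pr g θ p u u := by
  have hp := mem_chart_source H (totalProj pr p)
  have h := T.isConnCoframe hp
  rw [h.metric, totalMetricRep, totalForm_apply]
  set w := totalCoframe I pr θ (totalProj pr p) p u with hw
  have hw0 : w ≠ 0 := fun h0 => hu (by rw [← h.left_inv u, ← hw, h0, map_zero])
  have h1 : 0 ≤ w.1 * w.1 := mul_self_nonneg _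
  have h2 : ∀ j ∈ Finset.univ, 0 ≤ w.2.1 j * w.2.1 j := fun j _ => mul_self_nonneg _
  have h3 : 0 ≤ tensorRep g.inner (totalProj pr p) (totalProj pr p) w.2.2 w.2.2 := by
    rcases eq_or_ne w.2.2 0 with h0 | h0
    · rw [h0, map_zero]
    · exact (tensorRep_pos g hp h0).le
  refine lt_of_le_of_ne (add_nonneg (add_nonneg h1 (Finset.sum_nonneg h2)) h3) fun h0 => hw0 ?_
  have h4 := (add_eq_zero_iff_of_nonneg (add_nonneg h1 (Finset.sum_nonneg h2)) h3).1 h0.symm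
  have h5 := (add_eq_zero_iff_of_nonneg h1 (Finset.sum_nonneg h2)).1 h4.1
  refine Prod.ext (mul_self_eq_zero.1 h5.1) (Prod.ext (funext fun j => mul_self_eq_zero.1
    ((Finset.sum_eq_zero_iff_of_nonneg h2).1 h5.2 j (Finset.mem_univ j))) ?_)
  by_contra h6
  exact (tensorRep_pos g hp h6).ne' h4.2

/-- The total metric as a Riemannian metric. -/
noncomputable def IsTotalData.riem (T : IsTotalData g J pr θ) :
    RiemMetric (𝓘(ℝ, ℝ).prod I') (ℝ × B) :=
  coframeMetric (totalMetric pr g θ) T.totalMetric_symm T.totalMetric_pos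
    fun p => T.eventually_isConnCoframe (mem_chart_source H (totalProj pr p))

lemma IsTotalData.riem_inner (T : IsTotalData g J pr θ) : T.riem.inner = totalMetric pr g θ := rfl

/-- The Levi-Civita connection of the total metric. -/
noncomputable def IsTotalData.connection (T : IsTotalData g J pr θ) :
    AffineConnection (𝓘(ℝ, ℝ).prod I') (ℝ × B) :=
  coframeConnection (g := totalMetric pr g θ)
    fun p => T.eventually_isConnCoframe (mem_chart_source H (totalProj pr p))

lemma IsTotalData.connection_at (T : IsTotalData g J pr θ) (p : ℝ × B) :
    IsLeviCivitaAt T.riem.inner (fun Y => T.connection Y p) :=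
  coframeConnection_isLeviCivitaAt _ p

lemma IsTotalData.isLeviCivita (T : IsTotalData g J pr θ) : IsLeviCivita T.riem T.connection :=
  isLeviCivita_of_forall T.connection_at

lemma IsTotalData.ricci_eq {S : HyperKahlerStructure I M} (T : IsTotalData S.g J pr θ) (p : ℝ × B)
    (v w : TangentSpace (𝓘(ℝ, ℝ).prod I') p) :
    ricci T.connection p v w = -(Module.finrank ℝ E + 4 * k) * T.riem.inner p v w := by
  have hp := mem_chart_source H (totalProj pr p)
  have h := T.eventually_isConnCoframe hp
  rw [IsTotalData.connection, ricci_coframeConnection _ T.totalMetric_symm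
    (RiemMetric_nondeg T.riem) h, totalConn, trace_curvEnd_connForm (T.isCliffordTriple hp)
      (Γ := christoffel I S.g.inner (totalProj pr p) (totalProj pr p)) (fun X y => by
        simp only [smul_apply, christoffel_symm hp X y]) (fun X y => by simp only [smul_apply])
      (T.isConnDeriv hp) _ _ (S.trace_curvEnd _ _ _)]
  congr 1
  exact (h.self_of_nhds.metric v w).symm

lemma IsTotalData.isEinsteinWith {S : HyperKahlerStructure I M} (T : IsTotalData S.g J pr θ) :
    IsEinsteinWith T.riem (-(Module.finrank ℝ E + 4 * k)) :=
  ⟨T.connection, T.isLeviCivita, T.ricci_eq⟩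

lemma IsTotalData.hasNegativeScalarCurvature {S : HyperKahlerStructure I M}
    (T : IsTotalData S.g J pr θ) (hk : 0 < k) : HasNegativeScalarCurvature T.riem := by
  refine ⟨T.connection, T.isLeviCivita, fun p => ?_⟩
  rw [scalarCurvature_eq _ _ (T.ricci_eq p)]
  have h1 : 0 < Module.finrank ℝ (ℝ × E') := by simp
  have h2 : (0 : ℝ) < Module.finrank ℝ (ℝ × E') := by exact_mod_cast h1
  have h3 : (0 : ℝ) < k := by exact_mod_cast hk
  have h4 : (0 : ℝ) < Module.finrank ℝ E + 4 * k := by positivity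
  nlinarith

end TotalMetric

section ModelEnd

variable {k : ℕ} {E : Type*} [NormedAddCommGroup E] [NormedSpace ℝ E] [FiniteDimensional ℝ E]

/-- The endomorphism of the model acting by `L` on the first two factors and by `J` on the
base. -/
noncomputable def modelEnd (L : (ℝ × (Fin k → ℝ)) →L[ℝ] (ℝ × (Fin k → ℝ))) (J : E →L[ℝ] E) :
    TotalModel k E →L[ℝ] TotalModel k E :=
  (((ContinuousLinearMap.fst ℝ ℝ (Fin k → ℝ)).prod
    ((ContinuousLinearMap.inl ℝ (Fin k → ℝ) E).comp (ContinuousLinearMap.snd ℝ ℝ (Fin k → ℝ)))).comp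
      (L.comp ((ContinuousLinearMap.fst ℝ ℝ ((Fin k → ℝ) × E)).prod
        ((ContinuousLinearMap.fst ℝ (Fin k → ℝ) E).comp
          (ContinuousLinearMap.snd ℝ ℝ ((Fin k → ℝ) × E)))))) + baseEnd J

lemma modelEnd_apply (L : (ℝ × (Fin k → ℝ)) →L[ℝ] (ℝ × (Fin k → ℝ))) (J : E →L[ℝ] E)
    (u : TotalModel k E) :
    modelEnd L J u = ((L (u.1, u.2.1)).1, (L (u.1, u.2.1)).2, J u.2.2) := by
  simp [modelEnd]

end ModelEnd

section TotalEnd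

variable {k : ℕ} {E : Type*} [NormedAddCommGroup E] [NormedSpace ℝ E] [FiniteDimensional ℝ E]
  {H : Type*} [TopologicalSpace H] {I : ModelWithCorners ℝ E H} [I.Boundaryless]
  {M : Type*} [TopologicalSpace M] [ChartedSpace H M] [IsManifold I ∞ M]
  {E' : Type*} [NormedAddCommGroup E'] [NormedSpace ℝ E'] [FiniteDimensional ℝ E']
  {H' : Type*} [TopologicalSpace H'] {I' : ModelWithCorners ℝ E' H'} [I'.Boundaryless]
  {B : Type*} [TopologicalSpace B] [ChartedSpace H' B] [IsManifold I' ∞ B]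
  [MulAction (Torus k) B]
  {g : RiemMetric I M} {J : Fin k → EndField I M} {pr : B → M} {θ : Fin k → OneForm I' B}
  {x : M} {q : ℝ × B}

variable {L : (ℝ × (Fin k → ℝ)) →L[ℝ] (ℝ × (Fin k → ℝ))} {K : EndField I M}

/-- The endomorphism field on the total space given by the constant endomorphism `L` of the
span of `dt` and the connection forms and by the endomorphism field `K` of the base. -/
noncomputable def totalEnd (pr : B → M) (θ : Fin k → OneForm I' B)
    (L : (ℝ × (Fin k → ℝ)) →L[ℝ] (ℝ × (Fin k → ℝ))) (K : EndField I M) :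
    EndField (𝓘(ℝ, ℝ).prod I') (ℝ × B) := fun q =>
  (totalFrame I pr θ (totalProj pr q) q).comp
    ((modelEnd L (endRep K (totalProj pr q) (totalProj pr q))).comp
      (totalCoframe I pr θ (totalProj pr q) q))

lemma IsTotalData.totalCoframe_totalEnd (T : IsTotalData g J pr θ)
    (hq : totalProj pr q ∈ (chartAt H x).source) (v : TangentSpace (𝓘(ℝ, ℝ).prod I') q) :
    totalCoframe I pr θ x q (totalEnd pr θ L K q v) =
      modelEnd L (endRep K x (totalProj pr q)) (totalCoframe I pr θ x q v) := by
  have hq' := mem_chart_source H (totalProj pr q)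
  have h1 : totalCoframe I pr θ (totalProj pr q) q (totalEnd pr θ L K q v) =
      modelEnd L (endRep K (totalProj pr q) (totalProj pr q))
        (totalCoframe I pr θ (totalProj pr q) q v) := T.totalCoframe_totalFrame hq' _
  have h2 : ∀ w, (totalCoframe I pr θ x q w).1 =
    (totalCoframe I pr θ (totalProj pr q) q w).1 := fun w => rfl
  have h3 : ∀ w, (totalCoframe I pr θ x q w).2.1 =
    (totalCoframe I pr θ (totalProj pr q) q w).2.1 := fun w => rfl
  have h4 : ∀ w, (totalCoframe I pr θ x q w).2.2 = Real.exp q.1 •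
      dchart I x (totalProj pr q) (mfderiv (𝓘(ℝ, ℝ).prod I') I (totalProj pr) q w) := fun w => by
    rw [totalCoframe_apply, T.bundle.mvfderiv_totalChart hq]; rfl
  have h5 : ∀ w, (totalCoframe I pr θ (totalProj pr q) q w).2.2 = Real.exp q.1 •
      dchart I (totalProj pr q) (totalProj pr q)
        (mfderiv (𝓘(ℝ, ℝ).prod I') I (totalProj pr) q w) := fun w => by
    rw [totalCoframe_apply, T.bundle.mvfderiv_totalChart hq']; rfl
  have h6 : mfderiv (𝓘(ℝ, ℝ).prod I') I (totalProj pr) q (totalEnd pr θ L K q v) =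
      K (totalProj pr q) (mfderiv (𝓘(ℝ, ℝ).prod I') I (totalProj pr) q v) := by
    rw [mfderiv_totalProj_eq (θ := θ) T.bundle hq', h1, modelEnd_apply]
    simp only [h5, endRep, ContinuousLinearMap.comp_apply, map_smul, dchartSymm_dchart hq', smul_smul]
    rw [← Real.exp_add, neg_add_cancel, Real.exp_zero, one_smul]
  have h7 := h1
  rw [modelEnd_apply] at h7 ⊢
  refine Prod.ext ?_ (Prod.ext ?_ ?_)
  · rw [h2, h7]; rfl
  · rw [h3, h7]; rfl
  · rw [h4, h6]
    simp only [h4, endRep, ContinuousLinearMap.comp_apply, map_smul, dchartSymm_dchart hq]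

lemma IsTotalData.totalEnd_eq_of_coframe (T : IsTotalData g J pr θ)
    {u v : TangentSpace (𝓘(ℝ, ℝ).prod I') q}
    (h : totalCoframe I pr θ (totalProj pr q) q u = totalCoframe I pr θ (totalProj pr q) q v) :
    u = v := by
  have hq := mem_chart_source H (totalProj pr q)
  rw [← T.totalFrame_totalCoframe hq u, h, T.totalFrame_totalCoframe hq]

lemma IsTotalData.totalEnd_sq (T : IsTotalData g J pr θ) (hL : ∀ w, L (L w) = -w)
    (hK : ∀ y v, K y (K y v) = -v) (q : ℝ × B) (v : TangentSpace (𝓘(ℝ, ℝ).prod I') q) :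
    totalEnd pr θ L K q (totalEnd pr θ L K q v) = -v := by
  have hq := mem_chart_source H (totalProj pr q)
  refine T.totalEnd_eq_of_coframe ?_
  rw [T.totalCoframe_totalEnd hq, T.totalCoframe_totalEnd hq, modelEnd_apply, modelEnd_apply]
  simp only [hL, Prod.mk.eta, endRep, ContinuousLinearMap.comp_apply, dchartSymm_dchart hq, hK,
    map_neg, dchart_dchartSymm hq]
  rfl

lemma IsTotalData.totalEnd_comp (T : IsTotalData g J pr θ)
    {L₁ L₂ L₃ : (ℝ × (Fin k → ℝ)) →L[ℝ] (ℝ × (Fin k → ℝ))} {K₁ K₂ K₃ : EndField I M}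
    (hL : ∀ w, L₁ (L₂ w) = L₃ w) (hK : ∀ y v, K₁ y (K₂ y v) = K₃ y v) (q : ℝ × B)
    (v : TangentSpace (𝓘(ℝ, ℝ).prod I') q) :
    totalEnd pr θ L₁ K₁ q (totalEnd pr θ L₂ K₂ q v) = totalEnd pr θ L₃ K₃ q v := by
  have hq := mem_chart_source H (totalProj pr q)
  refine T.totalEnd_eq_of_coframe ?_
  rw [T.totalCoframe_totalEnd hq, T.totalCoframe_totalEnd hq, T.totalCoframe_totalEnd hq,
    modelEnd_apply, modelEnd_apply, modelEnd_apply]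
  simp only [hL, Prod.mk.eta, endRep, ContinuousLinearMap.comp_apply, dchartSymm_dchart hq, hK]

lemma totalEnd_neg (q : ℝ × B) (v : TangentSpace (𝓘(ℝ, ℝ).prod I') q) :
    totalEnd pr θ (-L) (fun y => -K y) q v = -totalEnd pr θ L K q v := by
  have e : ∀ u : TotalModel k E, modelEnd (-L) (endRep (fun y => -K y) (totalProj pr q)
      (totalProj pr q)) u = -modelEnd L (endRep K (totalProj pr q) (totalProj pr q)) u := fun u => by
    rw [modelEnd_apply, modelEnd_apply]
    simp [endRep]
    rfl
  simp only [totalEnd, ContinuousLinearMap.comp_apply, e, map_neg]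

variable [T2Space M] [T2Space B]

lemma IsTotalData.totalEnd_orthogonal (T : IsTotalData g J pr θ)
    (hL : ∀ u w, (L u).1 * (L w).1 + ∑ j, (L u).2 j * (L w).2 j = u.1 * w.1 + ∑ j, u.2 j * w.2 j)
    (hK : ∀ y u v, g.inner y (K y u) (K y v) = g.inner y u v) (q : ℝ × B)
    (u v : TangentSpace (𝓘(ℝ, ℝ).prod I') q) :
    T.riem.inner q (totalEnd pr θ L K q u) (totalEnd pr θ L K q v) = T.riem.inner q u v := by
  have hq := mem_chart_source H (totalProj pr q)
  have h := (T.isConnCoframe hq).metric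
  rw [T.riem_inner, h, h, T.totalCoframe_totalEnd hq, T.totalCoframe_totalEnd hq, totalMetricRep,
    totalForm_apply, totalForm_apply, modelEnd_apply, modelEnd_apply]
  dsimp only
  rw [hL]
  congr 1
  simp only [tensorRep_apply, endRep, ContinuousLinearMap.comp_apply, dchartSymm_dchart hq, hK]

lemma IsTotalData.fundForm_totalEnd (T : IsTotalData g J pr θ) (q : ℝ × B)
    (u v : TangentSpace (𝓘(ℝ, ℝ).prod I') q) :
    fundForm T.riem.inner (totalEnd pr θ L K) q u v =
      (L (dt q u, fun j => scaledForm (θ j) q u)).1 * dt q v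
        + ∑ j, (L (dt q u, fun j => scaledForm (θ j) q u)).2 j * scaledForm (θ j) q v
        + baseForm pr (fundForm g.inner K) q u v := by
  have hq := mem_chart_source H (totalProj pr q)
  have h := (T.isConnCoframe hq).metric
  change T.riem.inner q (totalEnd pr θ L K q u) v = _
  rw [T.riem_inner, h, T.totalCoframe_totalEnd hq, totalMetricRep, totalForm_apply, modelEnd_apply]
  congr 1
  have e2 : Real.exp (2 * q.1) * (Real.exp (-q.1) * Real.exp (-q.1)) = 1 := by
    rw [← Real.exp_add, ← Real.exp_add]; ring_nf; exact Real.exp_zero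
  change _ = Real.exp (2 * q.1) * g.inner (totalProj pr q)
    (K _ (mfderiv (𝓘(ℝ, ℝ).prod I') I (totalProj pr) q u))
    (mfderiv (𝓘(ℝ, ℝ).prod I') I (totalProj pr) q v)
  rw [mfderiv_totalProj_eq (θ := θ) T.bundle hq u, mfderiv_totalProj_eq (θ := θ) T.bundle hq v]
  simp only [map_smul, smul_apply, smul_eq_mul, tensorRep_apply, endRep,
    ContinuousLinearMap.comp_apply, dchartSymm_dchart hq]
  linear_combination (-g.inner (totalProj pr q) (K _ (dchartSymm I _ (totalProj pr q)
    (totalCoframe I pr θ (totalProj pr q) q u).2.2)) (dchartSymm I _ (totalProj pr q)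
      (totalCoframe I pr θ (totalProj pr q) q v).2.2)) * e2

lemma IsTotalData.contMDiffAt_modelEnd (T : IsTotalData g J pr θ)
    (hK : IsSmoothEndOn K Set.univ) (hq : totalProj pr q ∈ (chartAt H x).source) :
    ContMDiffAt (𝓘(ℝ, ℝ).prod I') 𝓘(ℝ, TotalModel k E →L[ℝ] TotalModel k E) ∞
      (fun z => modelEnd L (endRep K x (totalProj pr z))) q := by
  have h1 : ContMDiffAt (𝓘(ℝ, ℝ).prod I') 𝓘(ℝ, E →L[ℝ] E) ∞
      (fun z => endRep K x (totalProj pr z)) q :=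
    (contMDiffAt_endRep (n := ⊤) hq
      ((hK _ (Set.mem_univ _)).contMDiffAt Filter.univ_mem)).comp q (T.bundle.contMDiff_totalProj q)
  have h2 : ContMDiffAt (𝓘(ℝ, ℝ).prod I') 𝓘(ℝ, TotalModel k E →L[ℝ] TotalModel k E) ∞
      (fun z => baseEnd (k := k) (endRep K x (totalProj pr z))) q :=
    contMDiffAt_const.clm_comp (h1.clm_comp contMDiffAt_const)
  exact contMDiffAt_const.add h2

lemma IsTotalData.eventually_totalEnd (T : IsTotalData g J pr θ)
    (hq : totalProj pr q ∈ (chartAt H x).source) : ∀ᶠ z in 𝓝 q, ∀ v,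
    totalCoframe I pr θ x z (totalEnd pr θ L K z v) =
      modelEnd L (endRep K x (totalProj pr z)) (totalCoframe I pr θ x z v) := by
  filter_upwards [(T.bundle.contMDiff_totalProj q).continuousAt.preimage_mem_nhds
    ((chartAt H x).open_source.mem_nhds hq)] with z hz using T.totalCoframe_totalEnd hz

lemma IsTotalData.smooth_totalEnd (T : IsTotalData g J pr θ) (hK : IsSmoothEndOn K Set.univ) :
    IsSmoothEndOn (totalEnd pr θ L K) Set.univ := fun q _ => by
  have hq := mem_chart_source H (totalProj pr q)
  exact (smoothEnd_of_coframe (n := ⊤) (T.eventually_isConnCoframe hq)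
    (T.contMDiffAt_modelEnd hK hq) (T.eventually_totalEnd hq)).contMDiffWithinAt

/-- The covariant derivative of `totalEnd` only depends on the part of the connection form which
does not involve the Christoffel symbols of the base. -/
lemma IsTotalData.hasEndCov_totalEnd (T : IsTotalData g J pr θ) (hK : IsComplexStructure K)
    (hherm : ∀ x u v, g.inner x (K x u) (K x v) = g.inner x u v)
    (hclosed : IsClosedForm₂ (fundForm g.inner K)) (q : ℝ × B) :
    HasEndCov T.connection (totalEnd pr θ L K) q fun v y =>
      totalFrame I pr θ (totalProj pr q) q
        (connForm (tensorRep g.inner (totalProj pr q) (totalProj pr q))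
          (fun j => (tensorRep g.inner (totalProj pr q) (totalProj pr q)).comp
            (endRep (J j) (totalProj pr q) (totalProj pr q)))
          (fun j => endRep (J j) (totalProj pr q) (totalProj pr q)) 0
          (totalCoframe I pr θ (totalProj pr q) q v)
          (modelEnd L (endRep K (totalProj pr q) (totalProj pr q))
            (totalCoframe I pr θ (totalProj pr q) q y))
        - modelEnd L (endRep K (totalProj pr q) (totalProj pr q))
          (connForm (tensorRep g.inner (totalProj pr q) (totalProj pr q))
          (fun j => (tensorRep g.inner (totalProj pr q) (totalProj pr q)).comp
            (endRep (J j) (totalProj pr q) (totalProj pr q)))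
          (fun j => endRep (J j) (totalProj pr q) (totalProj pr q)) 0
          (totalCoframe I pr θ (totalProj pr q) q v)
          (totalCoframe I pr θ (totalProj pr q) q y))) := by
  have hq := mem_chart_source H (totalProj pr q)
  have hj := (T.contMDiffAt_modelEnd (L := L) hK.smooth hq).mdifferentiableAt (by simp)
  have h := hasEndCov_coframeConnection (fun p => T.eventually_isConnCoframe
    (mem_chart_source H (totalProj pr p))) T.totalMetric_symm (RiemMetric_nondeg T.riem)
    (T.eventually_isConnCoframe hq) hj (T.eventually_totalEnd hq)
  convert h using 1
  · rfl
  funext v y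
  congr 1
  set u := totalCoframe I pr θ (totalProj pr q) q v with hu
  set w := totalCoframe I pr θ (totalProj pr q) q y with hw
  have hKr := contMDiffAt_endRep (n := ⊤) hq
      ((hK.smooth _ (Set.mem_univ _)).contMDiffAt Filter.univ_mem)
  obtain ⟨a1, a2⟩ := mvfderiv_clm_apply (hKr.mdifferentiableAt (by simp))
    (mdifferentiableAt_const (c := w.2.2))
  have hv : totalFrame I pr θ (totalProj pr q) q u = v := T.totalFrame_totalCoframe hq v
  obtain ⟨b1, b2⟩ := mvfderiv_comp_totalProj_totalFrame T hq a1 u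
  have d := (mvfderiv_clm_apply hj (mdifferentiableAt_const (c := w))).2 v
  rw [mvfderiv_const, zero_apply, map_zero, add_zero] at d
  have e : (fun z => modelEnd L (endRep K (totalProj pr q) (totalProj pr z)) w) =
      (fun _ => ((L (w.1, w.2.1)).1, (L (w.1, w.2.1)).2, (0 : E))) +
        fun z : ℝ × B => (baseIncl (endRep K (totalProj pr q) (totalProj pr z) w.2.2) :
          TotalModel k E) := by
    funext z
    rw [modelEnd_apply]
    simp
  rw [e, mvfderiv_add mdifferentiableAt_const
    (mdifferentiableAt_comp_differentiableAt (baseIncl (k := k) (E := E)).differentiableAt b1), mvfderiv_const,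
    zero_add, mvfderiv_clm_comp _ b1, ContinuousLinearMap.comp_apply, ← hv, b2, a2, mvfderiv_const,
    zero_apply, map_zero, add_zero, endRep_parallel hK hherm hclosed hq, hv] at d
  rw [← d]
  have hsplit : ∀ u w : TotalModel k E, totalConn g J pr (totalProj pr q) q u w =
      connForm (tensorRep g.inner (totalProj pr q) (totalProj pr q))
          (fun j => (tensorRep g.inner (totalProj pr q) (totalProj pr q)).comp
            (endRep (J j) (totalProj pr q) (totalProj pr q)))
          (fun j => endRep (J j) (totalProj pr q) (totalProj pr q)) 0 u w
        + baseIncl (christoffel I g.inner (totalProj pr q) (totalProj pr q)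
          (Real.exp (-q.1) • u.2.2) w.2.2) := fun u w => by
    rw [totalConn, connForm_apply, connForm_apply]
    simp
  have hj2 : ∀ X : E, modelEnd L (endRep K (totalProj pr q) (totalProj pr q)) (baseIncl X) =
      baseIncl (endRep K (totalProj pr q) (totalProj pr q) X) := fun X => by
    rw [modelEnd_apply]
    simp only [baseIncl_apply]
    rw [show ((0 : ℝ), (0 : Fin k → ℝ)) = 0 from rfl, map_zero]
    rfl
  have hj3 : (modelEnd L (endRep K (totalProj pr q) (totalProj pr q)) w).2.2 =
    endRep K (totalProj pr q) (totalProj pr q) w.2.2 := by rw [modelEnd_apply]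
  rw [hsplit, hsplit, map_add, hj2, hj3, map_sub]
  abel

end TotalEnd

section FibreAlgebra

variable {E : Type*} [NormedAddCommGroup E] [NormedSpace ℝ E] [FiniteDimensional ℝ E]

/-- The complex structure `(a, b) ↦ (-b, a)`. -/
noncomputable def kahlerFibre : (ℝ × (Fin 1 → ℝ)) →L[ℝ] (ℝ × (Fin 1 → ℝ)) :=
  LinearMap.toContinuousLinearMap
    { toFun := fun u => (-u.2 0, fun _ => u.1)
      map_add' := fun u v => Prod.ext (by simp [add_comm]) rfl
      map_smul' := fun c u => Prod.ext (by simp) rfl }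

lemma kahlerFibre_apply (u : ℝ × (Fin 1 → ℝ)) : kahlerFibre u = (-u.2 0, fun _ => u.1) := rfl

/-- The quaternionic triple on the span of `dt` and the three connection forms. -/
noncomputable def quatFibre : Fin 3 → (ℝ × (Fin 3 → ℝ)) →L[ℝ] (ℝ × (Fin 3 → ℝ)) :=
  ![LinearMap.toContinuousLinearMap
    { toFun := fun u => (-u.2 0, ![u.1, -u.2 2, u.2 1])
      map_add' := fun u v => Prod.ext (by simp [add_comm]) (by ext i; fin_cases i <;> simp [add_comm])
      map_smul' := fun c u => Prod.ext (by simp) (by ext i; fin_cases i <;> simp) },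
  LinearMap.toContinuousLinearMap
    { toFun := fun u => (u.2 1, ![-u.2 2, -u.1, u.2 0])
      map_add' := fun u v => Prod.ext (by simp [add_comm]) (by ext i; fin_cases i <;> simp [add_comm])
      map_smul' := fun c u => Prod.ext (by simp) (by ext i; fin_cases i <;> simp) },
  LinearMap.toContinuousLinearMap
    { toFun := fun u => (u.2 2, ![u.2 1, -u.2 0, -u.1])
      map_add' := fun u v => Prod.ext (by simp [add_comm]) (by ext i; fin_cases i <;> simp [add_comm])
      map_smul' := fun c u => Prod.ext (by simp) (by ext i; fin_cases i <;> simp) }]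

lemma quatFibre_zero (u : ℝ × (Fin 3 → ℝ)) :
    quatFibre 0 u = (-u.2 0, ![u.1, -u.2 2, u.2 1]) := rfl

lemma quatFibre_one (u : ℝ × (Fin 3 → ℝ)) :
    quatFibre 1 u = (u.2 1, ![-u.2 2, -u.1, u.2 0]) := rfl

lemma quatFibre_two (u : ℝ × (Fin 3 → ℝ)) :
    quatFibre 2 u = (u.2 2, ![u.2 1, -u.2 0, -u.1]) := rfl

lemma quatFibre_sq (i : Fin 3) (u : ℝ × (Fin 3 → ℝ)) : quatFibre i (quatFibre i u) = -u := by
  fin_cases i <;> refine Prod.ext ?_ (funext fun j => ?_) <;>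
    (try fin_cases j) <;> simp [quatFibre_zero, quatFibre_one, quatFibre_two]

lemma quatFibre_comp (i : Fin 3) (u : ℝ × (Fin 3 → ℝ)) :
    quatFibre i (quatFibre (i + 1) u) = quatFibre (i + 2) u := by
  fin_cases i <;> refine Prod.ext ?_ (funext fun j => ?_) <;>
    (try fin_cases j) <;> simp [quatFibre_zero, quatFibre_one, quatFibre_two]

lemma quatFibre_comp' (i : Fin 3) (u : ℝ × (Fin 3 → ℝ)) :
    quatFibre (i + 1) (quatFibre i u) = (-quatFibre (i + 2)) u := by
  fin_cases i <;> refine Prod.ext ?_ (funext fun j => ?_) <;>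
    (try fin_cases j) <;> simp [quatFibre_zero, quatFibre_one, quatFibre_two]

lemma quatFibre_orthogonal (i : Fin 3) (u w : ℝ × (Fin 3 → ℝ)) :
    (quatFibre i u).1 * (quatFibre i w).1 + ∑ j, (quatFibre i u).2 j * (quatFibre i w).2 j =
      u.1 * w.1 + ∑ j, u.2 j * w.2 j := by
  fin_cases i <;> simp [quatFibre_zero, quatFibre_one, quatFibre_two, Fin.sum_univ_three] <;> ring

/-- The coefficients of the covariant derivatives of the quaternionic triple. -/
def quatCoeff (b : Fin 3 → ℝ) : Fin 3 → Fin 3 → ℝ :=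
  ![![0, -2 * b 2, 2 * b 1], ![2 * b 2, 0, 2 * b 0], ![-2 * b 1, -2 * b 0, 0]]

lemma quatCoeff_skew (b : Fin 3 → ℝ) (i j : Fin 3) : quatCoeff b i j = -quatCoeff b j i := by
  fin_cases i <;> fin_cases j <;> simp [quatCoeff]

lemma connForm_kahler {h : E →L[ℝ] E →L[ℝ] ℝ} {J : Fin 1 → E →L[ℝ] E} (H : IsCliffordTriple h J)
    (u w : TotalModel 1 E) :
    connForm h (fun j => h.comp (J j)) J 0 u (modelEnd kahlerFibre (J 0) w) =
      modelEnd kahlerFibre (J 0) (connForm h (fun j => h.comp (J j)) J 0 u w) := by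
  rw [connForm_apply, connForm_apply, modelEnd_apply, modelEnd_apply]
  have h1 : ∀ x y, h x (J 0 y) = -h (J 0 x) y := fun x y => by rw [H.skew, neg_neg]
  simp only [kahlerFibre_apply, Fin.sum_univ_one, Fin.isValue, h1, ContinuousLinearMap.comp_apply, H.sq,
    map_add, map_smul, zero_apply, add_zero]
  refine Prod.ext ?_ (Prod.ext (funext fun j => ?_) ?_)
  · simp; ring
  · fin_cases j; simp [H.sq]; ring
  · simp only []; module

/-- The base parts of the quaternionic triple. -/
def quatBase (J : Fin 3 → E →L[ℝ] E) : Fin 3 → E →L[ℝ] E := ![J 0, -J 1, -J 2]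

lemma connForm_quat {h : E →L[ℝ] E →L[ℝ] ℝ} {J : Fin 3 → E →L[ℝ] E} (H : IsCliffordTriple h J)
    (h01 : ∀ x, J 0 (J 1 x) = J 2 x) (h12 : ∀ x, J 1 (J 2 x) = J 0 x)
    (h20 : ∀ x, J 2 (J 0 x) = J 1 x) (i : Fin 3) (u w : TotalModel 3 E) :
    connForm h (fun j => h.comp (J j)) J 0 u (modelEnd (quatFibre i) (quatBase J i) w)
      - modelEnd (quatFibre i) (quatBase J i) (connForm h (fun j => h.comp (J j)) J 0 u w) =
    ∑ j, quatCoeff u.2.1 i j • modelEnd (quatFibre j) (quatBase J j) w := by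
  have h10 : ∀ x, J 1 (J 0 x) = -J 2 x := fun x => by rw [H.anti 1 0 (by decide), h01]
  have h21 : ∀ x, J 2 (J 1 x) = -J 0 x := fun x => by rw [H.anti 2 1 (by decide), h12]
  have h02 : ∀ x, J 0 (J 2 x) = -J 1 x := fun x => by rw [H.anti 0 2 (by decide), h20]
  have h1 : ∀ j x y, h x (J j y) = -h (J j x) y := fun j x y => by rw [H.skew, neg_neg]
  simp only [connForm_apply, modelEnd_apply, Fin.sum_univ_three, zero_apply, add_zero,
    ContinuousLinearMap.comp_apply]
  fin_cases i
  all_goals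
    simp only [quatFibre_zero, quatFibre_one, quatFibre_two, quatBase, quatCoeff, Fin.zero_eta,
      Fin.mk_one, Fin.reduceFinMk, Fin.isValue, Matrix.cons_val_zero, Matrix.cons_val_one,
      Matrix.cons_val, neg_apply, map_neg, map_add, map_smul, h1, H.sq, h01, h12, h20, h10, h21,
      h02]
    refine Prod.ext ?_ (Prod.ext (funext fun j => ?_) ?_)
    · simp [h1]; ring
    · fin_cases j <;> simp [Matrix.vecHead, Matrix.vecTail, h1, H.sq, h01, h12, h20, h10, h21, h02] <;> ring
    · simp only [Prod.snd_sub, Prod.snd_add, Prod.smul_snd, Prod.fst_sub]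
      module

end FibreAlgebra

section Kahler

variable {E : Type*} [NormedAddCommGroup E] [NormedSpace ℝ E] [FiniteDimensional ℝ E]
  {H : Type*} [TopologicalSpace H] {I : ModelWithCorners ℝ E H} [I.Boundaryless]
  {M : Type*} [TopologicalSpace M] [ChartedSpace H M] [IsManifold I ∞ M]
  {E' : Type*} [NormedAddCommGroup E'] [NormedSpace ℝ E'] [FiniteDimensional ℝ E']
  {H' : Type*} [TopologicalSpace H'] {I' : ModelWithCorners ℝ E' H'} [I'.Boundaryless]
  {B : Type*} [TopologicalSpace B] [ChartedSpace H' B] [IsManifold I' ∞ B]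
  [MulAction (Torus 1) B]
  {g : RiemMetric I M} {J : Fin 1 → EndField I M} {pr : B → M} {θ : Fin 1 → OneForm I' B}
  {x : M} {q : ℝ × B}

variable [T2Space M] [T2Space B]

lemma IsTotalData.hasEndCov_kahler (T : IsTotalData g J pr θ) (q : ℝ × B) :
    HasEndCov T.connection (totalEnd pr θ kahlerFibre (J 0)) q fun _ _ => 0 := by
  have h := T.hasEndCov_totalEnd (L := kahlerFibre) (T.complex 0) (T.hermitian 0) (T.closed 0) q
  convert h using 1
  funext v y
  rw [connForm_kahler (J := fun j => endRep (J j) (totalProj pr q) (totalProj pr q))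
    (T.isCliffordTriple (mem_chart_source H _)), sub_self, map_zero]

lemma IsTotalData.isKahlerWith (T : IsTotalData g J pr θ) :
    IsKahlerWith T.riem (totalEnd pr θ kahlerFibre (J 0))
      (fundForm T.riem.inner (totalEnd pr θ kahlerFibre (J 0))) := by
  have hsq := T.totalEnd_sq (L := kahlerFibre) (K := J 0)
    (fun w => Prod.ext rfl (funext fun j => by rw [Subsingleton.elim j 0]; rfl)) (T.complex 0).sq
  have horth := T.totalEnd_orthogonal (L := kahlerFibre) (K := J 0)
    (fun u w => by simp [kahlerFibre_apply]; ring) (T.hermitian 0)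
  refine ⟨⟨T.smooth_totalEnd (T.complex 0).smooth, hsq, fun X Y hX hY q => ?_⟩, horth,
    fun _ _ _ => rfl, isClosedForm₂_of_parallel T.connection_at T.hasEndCov_kahler
      fun q u v => ?_⟩
  · rw [nijenhuis_eq (T.connection_at q) (hsq q) (T.hasEndCov_kahler q) (hX.mdiff q) (hY.mdiff q)]
    simp
  · simp only [fundForm, ContinuousLinearMap.comp_apply]
    rw [← horth q (totalEnd pr θ kahlerFibre (J 0) q u) v, hsq, T.riem.symm q, map_neg]

end Kahler

section Quaternionic

variable {E : Type*} [NormedAddCommGroup E] [NormedSpace ℝ E] [FiniteDimensional ℝ E]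
  {H : Type*} [TopologicalSpace H] {I : ModelWithCorners ℝ E H} [I.Boundaryless]
  {M : Type*} [TopologicalSpace M] [ChartedSpace H M] [IsManifold I ∞ M]
  {E' : Type*} [NormedAddCommGroup E'] [NormedSpace ℝ E'] [FiniteDimensional ℝ E']
  {H' : Type*} [TopologicalSpace H'] {I' : ModelWithCorners ℝ E' H'} [I'.Boundaryless]
  {B : Type*} [TopologicalSpace B] [ChartedSpace H' B] [IsManifold I' ∞ B]
  [MulAction (Torus 3) B]
  {g : RiemMetric I M} {J : Fin 3 → EndField I M} {pr : B → M} {θ : Fin 3 → OneForm I' B}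
  {x : M} {q : ℝ × B}

variable [T2Space M] [T2Space B]

/-- The base parts of the quaternionic triple on the total space. -/
noncomputable def quatBaseField (J : Fin 3 → EndField I M) : Fin 3 → EndField I M :=
  ![J 0, fun y => -J 1 y, fun y => -J 2 y]

lemma endRep_quatBaseField (J : Fin 3 → EndField I M) (i : Fin 3) (x y : M) :
    endRep (quatBaseField J i) x y = quatBase (fun j => endRep (J j) x y) i := by
  fin_cases i
  · rfl
  · exact ContinuousLinearMap.ext fun v => map_neg (dchart I x y) _
  · exact ContinuousLinearMap.ext fun v => map_neg (dchart I x y) _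

/-- The quaternionic triple on the total space. -/
noncomputable def quatField (pr : B → M) (θ : Fin 3 → OneForm I' B) (J : Fin 3 → EndField I M)
    (i : Fin 3) : EndField (𝓘(ℝ, ℝ).prod I') (ℝ × B) :=
  totalEnd pr θ (quatFibre i) (quatBaseField J i)

/-- The connection forms of the quaternionic triple. -/
noncomputable def quatConn (θ : Fin 3 → OneForm I' B) (q : ℝ × B)
    (v : TangentSpace (𝓘(ℝ, ℝ).prod I') q) : Fin 3 → Fin 3 → ℝ :=
  quatCoeff fun j => scaledForm (θ j) q v

lemma IsTotalData.hasEndCov_quatField (T : IsTotalData g J pr θ)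
    (hJ : ∀ i y v, J i y (J (i + 1) y v) = J (i + 2) y v)
    (hc : ∀ i, IsComplexStructure (quatBaseField J i))
    (hherm : ∀ i x u v, g.inner x (quatBaseField J i x u) (quatBaseField J i x v) = g.inner x u v)
    (hclosed : ∀ i, IsClosedForm₂ (fundForm g.inner (quatBaseField J i))) (i : Fin 3) (q : ℝ × B) :
    HasEndCov T.connection (quatField pr θ J i) q fun v y =>
      ∑ j, quatConn θ q v i j • quatField pr θ J j q y := by
  have hq := mem_chart_source H (totalProj pr q)
  have h := T.hasEndCov_totalEnd (L := quatFibre i) (hc i) (hherm i) (hclosed i) q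
  have hrel : ∀ i X, endRep (J i) (totalProj pr q) (totalProj pr q)
      (endRep (J (i + 1)) (totalProj pr q) (totalProj pr q) X) =
      endRep (J (i + 2)) (totalProj pr q) (totalProj pr q) X := fun i X => by
    simp only [endRep, ContinuousLinearMap.comp_apply, dchartSymm_dchart hq, hJ]
  convert h using 1
  · rfl
  funext v y
  rw [endRep_quatBaseField, connForm_quat
    (J := fun j => endRep (J j) (totalProj pr q) (totalProj pr q)) (T.isCliffordTriple hq)
    (hrel 0) (hrel 1) (hrel 2), map_sum]
  refine Finset.sum_congr rfl fun j _ => ?_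
  rw [map_smul, ← endRep_quatBaseField]
  rfl

lemma quatFibre_coeff (i : Fin 3) (u : ℝ × (Fin 3 → ℝ)) : quatCoeff (quatFibre i u).2 i =
    ![![0, -2 * u.2 1, -2 * u.2 2], ![2 * u.2 0, 0, -2 * u.2 2], ![2 * u.2 0, -2 * u.2 1, 0]] i := by
  fin_cases i <;> ext j <;> fin_cases j <;>
    simp [quatCoeff, quatFibre_zero, quatFibre_one, quatFibre_two]

lemma IsTotalData.quatConn_quatField (T : IsTotalData g J pr θ) (i : Fin 3) (q : ℝ × B)
    (v : TangentSpace (𝓘(ℝ, ℝ).prod I') q) : quatConn θ q (quatField pr θ J i q v) i =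
    quatCoeff (quatFibre i (dt q v, fun j => scaledForm (θ j) q v)).2 i := by
  have h := T.totalCoframe_totalEnd (L := quatFibre i) (K := quatBaseField J i)
    (mem_chart_source H (totalProj pr q)) v
  rw [modelEnd_apply] at h
  exact congrArg (fun u : TotalModel 3 E => quatCoeff u.2.1 i) h

lemma IsTotalData.quatField_quaternion (T : IsTotalData g J pr θ)
    (hrel : ∀ y, QuaternionRelations (quatBaseField J) y) (q : ℝ × B) :
    QuaternionRelations (quatField pr θ J) q := by
  intro i v
  refine ⟨T.totalEnd_sq (quatFibre_sq i) (fun y w => (hrel y i w).1) q v,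
    T.totalEnd_comp (quatFibre_comp i) (fun y w => (hrel y i w).2.1) q v, ?_⟩
  refine (T.totalEnd_comp (quatFibre_comp' i) (K₃ := fun y => -quatBaseField J (i + 2) y)
    (fun y w => (hrel y i w).2.2) q v).trans (totalEnd_neg q v)

lemma IsTotalData.isHypercomplex (T : IsTotalData g J pr θ)
    (hJ : ∀ i y v, J i y (J (i + 1) y v) = J (i + 2) y v)
    (hc : ∀ i, IsComplexStructure (quatBaseField J i))
    (hherm : ∀ i x u v, g.inner x (quatBaseField J i x u) (quatBaseField J i x v) = g.inner x u v)
    (hclosed : ∀ i, IsClosedForm₂ (fundForm g.inner (quatBaseField J i)))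
    (hrel : ∀ y, QuaternionRelations (quatBaseField J) y) : IsHypercomplex (quatField pr θ J) := by
  refine ⟨fun i => ⟨T.smooth_totalEnd (hc i).smooth, fun q v => (T.quatField_quaternion hrel q i v).1,
    fun X Y hX hY q => ?_⟩, T.quatField_quaternion hrel⟩
  have hquat := T.quatField_quaternion hrel q
  rw [nijenhuis_eq (T.connection_at q) (fun v => (hquat i v).1)
    (T.hasEndCov_quatField hJ hc hherm hclosed i q) (hX.mdiff q) (hY.mdiff q)]
  have key : ∀ v y, ∑ j, quatConn θ q (quatField pr θ J i q v) i j • quatField pr θ J j q y =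
      quatField pr θ J i q (∑ j, quatConn θ q v i j • quatField pr θ J j q y) := by
    intro v y
    rw [T.quatConn_quatField, quatFibre_coeff]
    have a0 := fun w => hquat 0 w
    have a1 := fun w => hquat 1 w
    have a2 := fun w => hquat 2 w
    simp only [Fin.isValue, zero_add, Fin.reduceAdd] at a0 a1 a2
    simp only [map_sum, map_smul, Fin.sum_univ_three]
    fin_cases i <;> simp [quatConn, quatCoeff, a0, a1, a2] <;> module
  rw [key, key, map_sub, sub_self]

lemma IsTotalData.isParallel₄ (T : IsTotalData g J pr θ)
    (hJ : ∀ i y v, J i y (J (i + 1) y v) = J (i + 2) y v)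
    (hc : ∀ i, IsComplexStructure (quatBaseField J i))
    (hherm : ∀ i x u v, g.inner x (quatBaseField J i x u) (quatBaseField J i x v) = g.inner x u v)
    (hclosed : ∀ i, IsClosedForm₂ (fundForm g.inner (quatBaseField J i))) :
    IsParallel₄ T.riem (quatForm fun i => fundForm T.riem.inner (quatField pr θ J i)) :=
  ⟨T.connection, T.isLeviCivita, fun X _ _ _ _ _ ha hb hc' hd q =>
    mvfderiv_quatForm (T.connection_at q) (fun _ => quatCoeff_skew _)
      (fun i => T.hasEndCov_quatField hJ hc hherm hclosed i q) (ha.mdiff q) (hb.mdiff q)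
      (hc'.mdiff q) (hd.mdiff q) (X q)⟩

end Quaternionic

section Signs

variable {E : Type*} [NormedAddCommGroup E] [NormedSpace ℝ E] [FiniteDimensional ℝ E]
  {H : Type*} [TopologicalSpace H] {I : ModelWithCorners ℝ E H} [I.Boundaryless]
  {M : Type*} [TopologicalSpace M] [ChartedSpace H M] [IsManifold I ∞ M] [T2Space M]
  {J : EndField I M} {g : RiemMetric I M}

lemma IsComplexStructure.neg (h : IsComplexStructure J) : IsComplexStructure fun x => -J x where
  smooth x hx := by
    have h1 := end_smooth_iff (n := ⊤).1 ((h.smooth x hx).contMDiffAt Filter.univ_mem)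
    refine (end_smooth_iff (n := ⊤).2 ?_).contMDiffWithinAt
    refine h1.neg.congr_of_eventuallyEq (Filter.Eventually.of_forall fun y => ?_)
    exact ContinuousLinearMap.ext fun v => map_neg (dchart I x y) _
  sq x v := by simp [h.sq]
  integrable X Y hX hY x := by
    have e : ∀ Z : VField I M, (fun y => (-J y) (Z y)) = (-1 : ℝ) • fun y => J y (Z y) := fun Z => by
      funext y; simp
    have mX := (h.smooth.smooth_apply hX).mdiff x
    have mY := (h.smooth.smooth_apply hY).mdiff x
    have := h.integrable X Y hX hY x
    rw [nijenhuis] at this ⊢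
    rw [e, e, VectorField.mlieBracket_const_smul_left mX, VectorField.mlieBracket_const_smul_right mY,
      VectorField.mlieBracket_const_smul_left mX, VectorField.mlieBracket_const_smul_right mY, ← this]
    simp

lemma isClosedForm₂_neg (h : IsClosedForm₂ (fundForm g.inner J)) :
    IsClosedForm₂ (fundForm g.inner fun x => -J x) := by
  intro X Y Z hX hY hZ x
  have e : ∀ U V : VField I M, (fun y => fundForm g.inner (fun x => -J x) y (U y) (V y)) =
      -fun y => fundForm g.inner J y (U y) (V y) := fun U V => by
    funext y; simp [fundForm]
  have e2 : ∀ u v, fundForm g.inner (fun x => -J x) x u v = -fundForm g.inner J x u v := fun u v => by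
    simp [fundForm]
  have := h X Y Z hX hY hZ x
  rw [extDeriv₂] at this ⊢
  rw [e, e, e, e2, e2, e2, mvfderiv_neg, mvfderiv_neg, mvfderiv_neg]
  simp only [neg_apply]
  linarith

lemma isComplexStructure_quatBaseField {J : Fin 3 → EndField I M}
    (h : ∀ i, IsComplexStructure (J i)) (i : Fin 3) : IsComplexStructure (quatBaseField J i) := by
  fin_cases i
  exacts [h 0, (h 1).neg, (h 2).neg]

lemma isClosedForm₂_quatBaseField {J : Fin 3 → EndField I M}
    (h : ∀ i, IsClosedForm₂ (fundForm g.inner (J i))) (i : Fin 3) :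
    IsClosedForm₂ (fundForm g.inner (quatBaseField J i)) := by
  fin_cases i
  exacts [h 0, isClosedForm₂_neg (h 1), isClosedForm₂_neg (h 2)]

lemma hermitian_quatBaseField {J : Fin 3 → EndField I M}
    (h : ∀ i x u v, g.inner x (J i x u) (J i x v) = g.inner x u v) (i : Fin 3) (x : M)
    (u v : TangentSpace I x) :
    g.inner x (quatBaseField J i x u) (quatBaseField J i x v) = g.inner x u v := by
  fin_cases i
  · exact h 0 x u v
  · change g.inner x (-J 1 x u) (-J 1 x v) = _
    rw [map_neg, map_neg, neg_apply, neg_neg, h]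
  · change g.inner x (-J 2 x u) (-J 2 x v) = _
    rw [map_neg, map_neg, neg_apply, neg_neg, h]

lemma quatBaseField_quatBaseField (J : Fin 3 → EndField I M) :
    quatBaseField (quatBaseField J) = J := by
  funext i y
  fin_cases i
  · rfl
  · exact neg_neg (J 1 y)
  · exact neg_neg (J 2 y)

lemma quatBaseField_mul {J : Fin 3 → EndField I M} (h : ∀ x, QuaternionRelations J x) (i : Fin 3)
    (x : M) (v : TangentSpace I x) :
    quatBaseField J i x (quatBaseField J (i + 1) x v) = quatBaseField J (i + 2) x v := by
  have a0 := (h x 0 v).2.1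
  have a1 := (h x 1 v).2.1
  have a2 := (h x 2 v).2.1
  simp only [Fin.isValue, zero_add, Fin.reduceAdd] at a0 a1 a2
  fin_cases i
  · exact (map_neg (J 0 x) _).trans (congrArg Neg.neg a0)
  · refine (congrArg Neg.neg (map_neg (J 1 x) (J 2 x v))).trans ((neg_neg _).trans a1)
  · exact congrArg Neg.neg a2

lemma quatBaseField_anti {J : Fin 3 → EndField I M} (h : ∀ x, QuaternionRelations J x)
    {i j : Fin 3} (hij : i ≠ j) (x : M) (v : TangentSpace I x) :
    quatBaseField J i x (quatBaseField J j x v) = -quatBaseField J j x (quatBaseField J i x v) := by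
  have key : ∀ i j, i ≠ j → ∀ v, J i x (J j x v) = -J j x (J i x v) := by
    have h1 : ∀ i v, J i x (J (i + 1) x v) = -J (i + 1) x (J i x v) := fun i v => by
      rw [(h x i v).2.1, (h x i v).2.2, neg_neg]
    intro i j hij v
    have : j = i + 1 ∨ i = j + 1 := by revert i j; decide
    rcases this with rfl | rfl
    · exact h1 i v
    · rw [h1 j v, neg_neg]
  have sgn : ∀ i : Fin 3, ∃ s : ℝ, ∀ w, quatBaseField J i x w = s • J i x w := fun i => by
    fin_cases i
    · exact ⟨1, fun w => (one_smul ℝ _).symm⟩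
    · exact ⟨-1, fun w => (neg_one_smul ℝ (J 1 x w)).symm⟩
    · exact ⟨-1, fun w => (neg_one_smul ℝ (J 2 x w)).symm⟩
  obtain ⟨s, hs⟩ := sgn i
  obtain ⟨r, hr⟩ := sgn j
  simp only [hs, hr, map_smul, key i j hij v, smul_neg, smul_smul, mul_comm s r]

end Signs

section Data

variable {k : ℕ} {E : Type*} [NormedAddCommGroup E] [NormedSpace ℝ E] [FiniteDimensional ℝ E]
  {H : Type*} [TopologicalSpace H] {I : ModelWithCorners ℝ E H} [I.Boundaryless]
  {M : Type*} [TopologicalSpace M] [ChartedSpace H M] [IsManifold I ∞ M]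
  {E' : Type*} [NormedAddCommGroup E'] [NormedSpace ℝ E'] [FiniteDimensional ℝ E']
  {H' : Type*} [TopologicalSpace H'] {I' : ModelWithCorners ℝ E' H'} [I'.Boundaryless]
  {B : Type*} [TopologicalSpace B] [ChartedSpace H' B] [IsManifold I' ∞ B]
  [MulAction (Torus k) B]
  {g : RiemMetric I M} {J : Fin k → EndField I M} {pr : B → M} {θ : Fin k → OneForm I' B}
  {x : M} {q : ℝ × B}

variable [T2Space M] [T2Space B]

lemma HyperKahlerStructure.isTotalData (S : HyperKahlerStructure I M) {ι : Fin k → Fin 3}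
    (hι : Function.Injective ι) (hb : IsPrincipalTorusBundle I I' k pr)
    (hθ : IsTorusConnection I' θ)
    (hd : ∀ j, HasExtDeriv₁ (θ j) (pullback₂ pr (fundForm S.g.inner (quatBaseField S.J (ι j)))))
    (hrank : Module.finrank ℝ E' = Module.finrank ℝ E + k) :
    IsTotalData S.g (fun j => quatBaseField S.J (ι j)) pr θ where
  bundle := hb
  conn := hθ
  complex _ := isComplexStructure_quatBaseField S.hypercomplex.complex _
  hermitian _ := hermitian_quatBaseField S.hermitian _
  closed _ := isClosedForm₂_quatBaseField S.closed _
  anti _ _ hij x v := quatBaseField_anti S.hypercomplex.quaternion (hι.ne hij) x v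
  extDeriv := hd
  rank := hrank

end Data

section Forms

variable {E : Type*} [NormedAddCommGroup E] [NormedSpace ℝ E] [FiniteDimensional ℝ E]
  {H : Type*} [TopologicalSpace H] {I : ModelWithCorners ℝ E H} [I.Boundaryless]
  {M : Type*} [TopologicalSpace M] [ChartedSpace H M] [IsManifold I ∞ M]
  {E' : Type*} [NormedAddCommGroup E'] [NormedSpace ℝ E'] [FiniteDimensional ℝ E']
  {H' : Type*} [TopologicalSpace H'] {I' : ModelWithCorners ℝ E' H'} [I'.Boundaryless]
  {B : Type*} [TopologicalSpace B] [ChartedSpace H' B] [IsManifold I' ∞ B]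
  [T2Space M] [T2Space B] {pr : B → M} {α ξ η : OneForm I' B} {S : HyperKahlerStructure I M}

lemma pullback₂_fundForm_neg (g : RiemMetric I M) (K : EndField I M) :
    pullback₂ (I := I') pr (fundForm g.inner fun x => -K x) =
      -pullback₂ (I := I') pr (fundForm g.inner K) := by
  funext b
  refine ContinuousLinearMap.ext fun u => ContinuousLinearMap.ext fun v => ?_
  simp [pullback₂, fundForm]

lemma fundForm_kahler [MulAction (Torus 1) B] {J : Fin 1 → EndField I M}
    (T : IsTotalData S.g J pr ![α]) :
    fundForm T.riem.inner (totalEnd pr ![α] kahlerFibre (S.J 0)) = omegaP S pr α := by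
  funext q
  refine ContinuousLinearMap.ext fun u => ContinuousLinearMap.ext fun v => ?_
  rw [T.fundForm_totalEnd, kahlerFibre_apply]
  have : omegaP S pr α q u v = dt q u * scaledForm α q v - scaledForm α q u * dt q v
    + baseForm pr (S.σ 0) q u v := rfl
  rw [this, Fin.sum_univ_one]
  simp only [Matrix.cons_val_zero, HyperKahlerStructure.σ]
  ring

lemma fundForm_quat [MulAction (Torus 3) B] {J : Fin 3 → EndField I M}
    (T : IsTotalData S.g J pr ![α, ξ, η]) (hJ : quatBaseField J = S.J) (i : Fin 3) :
    fundForm T.riem.inner (quatField pr ![α, ξ, η] J i) = omegaN S pr α ξ η i := by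
  funext q
  refine ContinuousLinearMap.ext fun u => ContinuousLinearMap.ext fun v => ?_
  rw [quatField, T.fundForm_totalEnd, hJ, Fin.sum_univ_three]
  fin_cases i
  · have : omegaN S pr α ξ η 0 q u v = baseForm pr (S.σ 0) q u v
      + (scaledForm ξ q u * scaledForm η q v - scaledForm η q u * scaledForm ξ q v)
      + (dt q u * scaledForm α q v - scaledForm α q u * dt q v) := rfl
    refine Eq.trans ?_ this.symm
    change -(scaledForm α q u) * dt q v + (dt q u * scaledForm α q v
      + (-(scaledForm η q u)) * scaledForm ξ q v + scaledForm ξ q u * scaledForm η q v)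
      + baseForm pr (S.σ 0) q u v = _
    ring
  · have : omegaN S pr α ξ η 1 q u v = baseForm pr (S.σ 1) q u v
      + (scaledForm ξ q u * dt q v - dt q u * scaledForm ξ q v)
      + (scaledForm α q u * scaledForm η q v - scaledForm η q u * scaledForm α q v) := rfl
    refine Eq.trans ?_ this.symm
    change (scaledForm ξ q u) * dt q v + (-(scaledForm η q u) * scaledForm α q v
      + (-(dt q u)) * scaledForm ξ q v + scaledForm α q u * scaledForm η q v)
      + baseForm pr (S.σ 1) q u v = _
    ring
  · have : omegaN S pr α ξ η 2 q u v = baseForm pr (S.σ 2) q u v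
      + (scaledForm ξ q u * scaledForm α q v - scaledForm α q u * scaledForm ξ q v)
      + (scaledForm η q u * dt q v - dt q u * scaledForm η q v) := rfl
    refine Eq.trans ?_ this.symm
    change (scaledForm η q u) * dt q v + (scaledForm ξ q u * scaledForm α q v
      + (-(scaledForm α q u)) * scaledForm ξ q v + (-(dt q u)) * scaledForm η q v)
      + baseForm pr (S.σ 2) q u v = _
    ring

end Forms

section Distance

open Filter MeasureTheory

variable {E : Type*} [NormedAddCommGroup E] [NormedSpace ℝ E] [FiniteDimensional ℝ E]
  {H : Type*} [TopologicalSpace H] {I : ModelWithCorners ℝ E H}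
  {M : Type*} [TopologicalSpace M] [ChartedSpace H M] [IsManifold I ∞ M]
  (g : RiemMetric I M)

/-- The norm of a tangent vector. -/
noncomputable def riemNorm (x : M) (v : TangentSpace I x) : ENNReal :=
  ENNReal.ofReal √(g.inner x v v)

/-- The length of a path. -/
noncomputable def pathLength (γ : ℝ → M) (a b : ℝ) : ENNReal :=
  letI : Bundle.RiemannianBundle (fun x : M => TangentSpace I x) := ⟨g.toRiemannianMetric⟩
  Manifold.pathELength I γ a b

lemma enorm_eq_riemNorm (x : M) (v : TangentSpace I x) :
    letI : Bundle.RiemannianBundle (fun x : M => TangentSpace I x) := ⟨g.toRiemannianMetric⟩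
    ‖v‖ₑ = riemNorm g x v := by
  let : Bundle.RiemannianBundle (fun x : M => TangentSpace I x) := ⟨g.toRiemannianMetric⟩
  rw [← ofReal_norm, norm_eq_sqrt_real_inner]
  rfl

lemma pathLength_eq (γ : ℝ → M) (a b : ℝ) :
    pathLength g γ a b = ∫⁻ t in Set.Ioo a b, riemNorm g (γ t) (mfderiv 𝓘(ℝ, ℝ) I γ t (1 : ℝ)) := by
  let : Bundle.RiemannianBundle (fun x : M => TangentSpace I x) := ⟨g.toRiemannianMetric⟩
  rw [pathLength, Manifold.pathELength_eq_lintegral_mfderiv_Ioo]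
  exact lintegral_congr fun t => enorm_eq_riemNorm g _ _

lemma pathLength_add (γ : ℝ → M) {a b c : ℝ} (h : a ≤ b) (h' : b ≤ c) :
    pathLength g γ a b + pathLength g γ b c = pathLength g γ a c := by
  let : Bundle.RiemannianBundle (fun x : M => TangentSpace I x) := ⟨g.toRiemannianMetric⟩
  exact Manifold.pathELength_add h h'

lemma riemDist_self (x : M) : riemDist g x x = 0 := by
  let : Bundle.RiemannianBundle (fun x : M => TangentSpace I x) := ⟨g.toRiemannianMetric⟩
  exact Manifold.riemannianEDist_self

lemma riemDist_triangle (x y z : M) : riemDist g x z ≤ riemDist g x y + riemDist g y z := by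
  let : Bundle.RiemannianBundle (fun x : M => TangentSpace I x) := ⟨g.toRiemannianMetric⟩
  exact Manifold.riemannianEDist_triangle

lemma riemDist_le_pathLength {γ : ℝ → M} {a b : ℝ} (hγ : ContMDiffOn 𝓘(ℝ, ℝ) I 1 γ (Set.Icc a b))
    (hab : a ≤ b) : riemDist g (γ a) (γ b) ≤ pathLength g γ a b := by
  let : Bundle.RiemannianBundle (fun x : M => TangentSpace I x) := ⟨g.toRiemannianMetric⟩
  exact Manifold.riemannianEDist_le_pathELength hγ rfl rfl hab

variable {g}

lemma exists_path_of_riemDist_lt {x y : M} {r : ENNReal} (h : riemDist g x y < r) :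
    ∃ γ : ℝ → M, γ 0 = x ∧ γ 1 = y ∧ ContMDiff 𝓘(ℝ, ℝ) I 1 γ ∧ pathLength g γ 0 1 < r := by
  let : Bundle.RiemannianBundle (fun x : M => TangentSpace I x) := ⟨g.toRiemannianMetric⟩
  obtain ⟨γ, h0, h1, h2, h3, -, -⟩ :=
    Manifold.exists_lt_locally_constant_of_riemannianEDist_lt h zero_lt_one
  exact ⟨γ, h0, h1, h2, h3⟩

variable (g) [T2Space M]

/-- The distance of a Riemannian metric, as a pseudo-metric compatible with the topology. -/
@[reducible] noncomputable def riemPseudoEMetric : PseudoEMetricSpace M :=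
  letI : Bundle.RiemannianBundle (fun x : M => TangentSpace I x) := ⟨g.toRiemannianMetric⟩
  haveI : IsContinuousRiemannianBundle E (fun x : M => TangentSpace I x) :=
    ⟨⟨g.inner, g.contMDiff.continuous, fun _ _ _ => rfl⟩⟩
  haveI : LocallyCompactSpace M := Manifold.locallyCompact_of_finiteDimensional I
  PseudoEMetricSpace.ofRiemannianMetric I M

lemma cauchySeq_iff_riemDist (u : ℕ → M) :
    letI := riemPseudoEMetric g
    CauchySeq u ↔ ∀ ε : ENNReal, 0 < ε → ∃ K, ∀ m ≥ K, ∀ l ≥ K, riemDist g (u m) (u l) < ε := by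
  let := riemPseudoEMetric g
  exact EMetric.cauchySeq_iff

lemma tendsto_of_subseq_tendsto {u : ℕ → M}
    (hu : ∀ ε : ENNReal, 0 < ε → ∃ K, ∀ m ≥ K, ∀ l ≥ K, riemDist g (u m) (u l) < ε)
    {φ : ℕ → ℕ} (hφ : Tendsto φ atTop atTop) {x : M} (hx : Tendsto (u ∘ φ) atTop (𝓝 x)) :
    Tendsto u atTop (𝓝 x) := by
  let := riemPseudoEMetric g
  exact tendsto_nhds_of_cauchySeq_of_subseq ((cauchySeq_iff_riemDist g u).2 hu) hφ hx

lemma IsCompleteMetric.exists_tendsto {g : RiemMetric I M} (hg : IsCompleteMetric g) {u : ℕ → M}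
    (hu : ∀ n, riemDist g (u n) (u (n + 1)) ≤ 2⁻¹ ^ n) : ∃ x, Tendsto u atTop (𝓝 x) := by
  let := riemPseudoEMetric g
  refine hg u ((cauchySeq_iff_riemDist g u).1 ?_)
  refine cauchySeq_of_edist_le_geometric 2⁻¹ 1 (by simp) (by simp) fun n => ?_
  rw [one_mul]
  exact hu n

lemma exists_subseq_riemDist_le {u : ℕ → M}
    (hu : ∀ ε : ENNReal, 0 < ε → ∃ K, ∀ m ≥ K, ∀ l ≥ K, riemDist g (u m) (u l) < ε) :
    ∃ φ : ℕ → ℕ, StrictMono φ ∧ ∀ n, riemDist g (u (φ n)) (u (φ (n + 1))) < 2⁻¹ ^ n := by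
  choose K hK using fun n : ℕ => hu (2⁻¹ ^ n) (ENNReal.pow_pos (by simp) n)
  have : ∀ n : ℕ, ∀ᶠ m in atTop, ∀ l ≥ m, riemDist g (u l) (u m) < 2⁻¹ ^ n := fun n => by
    filter_upwards [eventually_ge_atTop (K n)] with m hm l hl using hK n l (hm.trans hl) m hm
  obtain ⟨φ, hφ, h⟩ := extraction_forall_of_eventually this
  have comm : ∀ x y, riemDist g x y = riemDist g y x := fun x y => by
    let := riemPseudoEMetric g
    exact edist_comm x y
  exact ⟨φ, hφ, fun n => by rw [comm]; exact h n _ (hφ.monotone (Nat.le_succ n))⟩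

end Distance

section CompletenessOfTotal

open Filter MeasureTheory

variable {k : ℕ} {E : Type*} [NormedAddCommGroup E] [NormedSpace ℝ E] [FiniteDimensional ℝ E]
  {H : Type*} [TopologicalSpace H] {I : ModelWithCorners ℝ E H} [I.Boundaryless]
  {M : Type*} [TopologicalSpace M] [ChartedSpace H M] [IsManifold I ∞ M]
  {E' : Type*} [NormedAddCommGroup E'] [NormedSpace ℝ E'] [FiniteDimensional ℝ E']
  {H' : Type*} [TopologicalSpace H'] {I' : ModelWithCorners ℝ E' H'} [I'.Boundaryless]
  {B : Type*} [TopologicalSpace B] [ChartedSpace H' B] [IsManifold I' ∞ B]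
  [MulAction (Torus k) B]
  {g : RiemMetric I M} {J : Fin k → EndField I M} {pr : B → M} {θ : Fin k → OneForm I' B}
  {x : M} {q : ℝ × B}

variable [T2Space M] [T2Space B]

lemma totalMetric_self (u : TangentSpace (𝓘(ℝ, ℝ).prod I') q) :
    totalMetric pr g θ q u u = dt q u ^ 2 + ∑ j, scaledForm (θ j) q u ^ 2 +
      Real.exp (2 * q.1) * g.inner (pr q.2) (mfderiv (𝓘(ℝ, ℝ).prod I') I (totalProj pr) q u)
        (mfderiv (𝓘(ℝ, ℝ).prod I') I (totalProj pr) q u) := by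
  have h1 : totalMetric pr g θ q u u = dt q u * dt q u
      + (4 * Real.exp (4 * q.1)) * (∑ j, tensor (liftForm (θ j)) (liftForm (θ j)) q) u u +
      Real.exp (2 * q.1) * g.inner (pr q.2) (mfderiv (𝓘(ℝ, ℝ).prod I') I (totalProj pr) q u)
        (mfderiv (𝓘(ℝ, ℝ).prod I') I (totalProj pr) q u) := rfl
  rw [h1, sum_apply, sum_apply, Finset.mul_sum, pow_two]
  congr 2
  refine Finset.sum_congr rfl fun j _ => ?_
  have h2 : tensor (liftForm (θ j)) (liftForm (θ j)) q u u =
    liftForm (θ j) q u * liftForm (θ j) q u := rfl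
  have h3 : scaledForm (θ j) q u = 2 * Real.exp (2 * q.1) * liftForm (θ j) q u := rfl
  rw [h2, h3, show 4 * q.1 = 2 * q.1 + 2 * q.1 by ring, Real.exp_add]
  ring

lemma inner_self_nonneg' (g : RiemMetric I M) (x : M) (v : TangentSpace I x) :
    0 ≤ g.inner x v v := by
  rcases eq_or_ne v 0 with rfl | hv
  · simp
  · exact (g.pos x v hv).le

lemma IsTotalData.enorm_dt_le (T : IsTotalData g J pr θ) (u : TangentSpace (𝓘(ℝ, ℝ).prod I') q) :
    ‖dt q u‖ₑ ≤ riemNorm T.riem q u := by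
  rw [riemNorm, T.riem_inner, totalMetric_self,
    Real.enorm_eq_ofReal_abs]
  refine ENNReal.ofReal_le_ofReal (Real.abs_le_sqrt ?_)
  have h1 := inner_self_nonneg' g (pr q.2) (mfderiv (𝓘(ℝ, ℝ).prod I') I (totalProj pr) q u)
  have h2 : 0 ≤ ∑ j, scaledForm (θ j) q u ^ 2 := Finset.sum_nonneg fun j _ => sq_nonneg _
  have h3 := mul_nonneg (Real.exp_pos (2 * q.1)).le h1
  linarith

lemma IsTotalData.riemNorm_totalProj_le (T : IsTotalData g J pr θ)
    (u : TangentSpace (𝓘(ℝ, ℝ).prod I') q) :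
    riemNorm g (totalProj pr q) (mfderiv (𝓘(ℝ, ℝ).prod I') I (totalProj pr) q u) ≤
      ENNReal.ofReal (Real.exp (-q.1)) * riemNorm T.riem q u := by
  rw [riemNorm, riemNorm, ← ENNReal.ofReal_mul (Real.exp_pos _).le, T.riem_inner,
    totalMetric_self]
  refine ENNReal.ofReal_le_ofReal (Real.sqrt_le_iff.2 ⟨by positivity, ?_⟩)
  have h1 := inner_self_nonneg' g (pr q.2) (mfderiv (𝓘(ℝ, ℝ).prod I') I (totalProj pr) q u)
  have h2 : 0 ≤ ∑ j, scaledForm (θ j) q u ^ 2 := Finset.sum_nonneg fun j _ => sq_nonneg _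
  have h3 := mul_nonneg (Real.exp_pos (2 * q.1)).le h1
  rw [mul_pow, Real.sq_sqrt (by positivity), ← Real.exp_nat_mul]
  have e : Real.exp ((2 : ℕ) * -q.1) * Real.exp (2 * q.1) = 1 := by
    rw [← Real.exp_add]; simp
  calc g.inner (totalProj pr q) _ _ = Real.exp ((2 : ℕ) * -q.1) * (Real.exp (2 * q.1) *
        g.inner (pr q.2) (mfderiv (𝓘(ℝ, ℝ).prod I') I (totalProj pr) q u)
        (mfderiv (𝓘(ℝ, ℝ).prod I') I (totalProj pr) q u)) := by
        rw [← mul_assoc, e, one_mul]; rfl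
    _ ≤ _ := by
        refine mul_le_mul_of_nonneg_left ?_ (Real.exp_pos _).le
        nlinarith [sq_nonneg (dt q u)]

lemma IsTotalData.enorm_fst_sub_le (T : IsTotalData g J pr θ) {γ : ℝ → ℝ × B}
    (hγ : ContMDiff 𝓘(ℝ, ℝ) (𝓘(ℝ, ℝ).prod I') 1 γ) {a b : ℝ} (hab : a ≤ b) :
    ‖(γ b).1 - (γ a).1‖ₑ ≤ pathLength T.riem γ a b := by
  have h1 : ContMDiff 𝓘(ℝ, ℝ) 𝓘(ℝ, ℝ) 1 (fun s => (γ s).1) := contMDiff_fst.comp hγ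
  refine (enorm_sub_le_lintegral_deriv_of_contDiffOn_Icc
    (contMDiff_iff_contDiff.1 h1).contDiffOn hab).trans ?_
  rw [pathLength_eq, restrict_Ioo_eq_restrict_Icc]
  refine lintegral_mono fun s => ?_
  refine le_trans (le_of_eq ?_) (T.enorm_dt_le _)
  congr 1
  have h2 := mvfderiv_comp_mfderiv (g := (Prod.fst : ℝ × B → ℝ)) (f := γ) (p := s)
    (mdifferentiableAt_fst (I := 𝓘(ℝ, ℝ)) (I' := I')) ((hγ s).mdifferentiableAt one_ne_zero)
  let L : ℝ →L[ℝ] ℝ := mvfderiv 𝓘(ℝ, ℝ) (fun s => (γ s).1) s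
  have h3 : HasFDerivAt (fun s => (γ s).1) L s :=
    (hasMFDerivAt_mvfderiv ((h1 s).mdifferentiableAt one_ne_zero)).hasFDerivAt
  rw [h3.hasDerivAt.deriv]
  exact congrArg (fun L => L (1 : ℝ)) h2

lemma IsTotalData.enorm_fst_sub_le_riemDist (T : IsTotalData g J pr θ) (q p : ℝ × B) :
    ‖p.1 - q.1‖ₑ ≤ riemDist T.riem q p := by
  refine le_of_forall_gt fun r hr => ?_
  obtain ⟨γ, rfl, rfl, hγ, hlen⟩ := exists_path_of_riemDist_lt hr
  exact (T.enorm_fst_sub_le hγ zero_le_one).trans_lt hlen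

lemma IsTotalData.riemDist_totalProj_le (T : IsTotalData g J pr θ) {p : ℝ × B} {r : ENNReal}
    (h : riemDist T.riem q p < r) (hr : r ≤ 1) :
    riemDist g (totalProj pr q) (totalProj pr p) ≤ ENNReal.ofReal (Real.exp (1 - q.1)) * r := by
  obtain ⟨γ, rfl, rfl, hγ, hlen⟩ := exists_path_of_riemDist_lt h
  have hpr := T.bundle.contMDiff_totalProj
  have h1 : ContMDiff 𝓘(ℝ, ℝ) I 1 (totalProj pr ∘ γ) := (hpr.of_le (by simp)).comp hγ
  refine (riemDist_le_pathLength g h1.contMDiffOn zero_le_one).trans ?_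
  refine le_trans ?_ (mul_le_mul_right hlen.le _)
  rw [pathLength_eq, pathLength_eq, ← lintegral_const_mul' _ _ ENNReal.ofReal_ne_top]
  refine setLIntegral_mono' measurableSet_Ioo fun s hs => ?_
  have h2 := mfderiv_comp s ((hpr (γ s)).mdifferentiableAt (by simp))
    ((hγ s).mdifferentiableAt one_ne_zero)
  rw [h2]
  refine (T.riemNorm_totalProj_le _).trans (mul_le_mul_left (ENNReal.ofReal_le_ofReal ?_) _)
  have h3 := (T.enorm_fst_sub_le hγ hs.1.le).trans (le_self_add.trans
    ((pathLength_add T.riem γ hs.1.le hs.2.le).trans_le (hlen.le.trans hr)))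
  rw [Real.enorm_eq_ofReal_abs, ENNReal.ofReal_le_one] at h3
  exact Real.exp_le_exp.2 (by linarith [(abs_le.1 h3).1])

lemma IsPrincipalTorusBundle.exists_subseq_tendsto (h : IsPrincipalTorusBundle I I' k pr)
    {b : ℕ → B} {x : M} (hb : Tendsto (fun n => pr (b n)) atTop (𝓝 x)) :
    ∃ φ : ℕ → ℕ, StrictMono φ ∧ ∃ b₀, Tendsto (b ∘ φ) atTop (𝓝 b₀) := by
  obtain ⟨U, hU, hx, e, hsrc, htgt, hfst, -, -, -⟩ := h.locally_trivial x
  obtain ⟨τ, φ, hφ, hτ⟩ := CompactSpace.tendsto_subseq fun n => (e (b n)).2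
  refine ⟨φ, hφ, e.symm (x, τ), ?_⟩
  have hmem : ((x, τ) : M × Torus k) ∈ e.target := by rw [htgt]; exact ⟨hx, Set.mem_univ _⟩
  have h1 : Tendsto (fun n => (pr (b (φ n)), (e (b (φ n))).2)) atTop (𝓝 (x, τ)) :=
    (hb.comp hφ.tendsto_atTop).prodMk_nhds hτ
  refine ((e.continuousAt_symm hmem).tendsto.comp h1).congr' ?_
  filter_upwards [(hb.comp hφ.tendsto_atTop).eventually (hU.mem_nhds hx)] with n hn
  have hs : b (φ n) ∈ e.source := by rw [hsrc]; exact hn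
  have : (pr (b (φ n)), (e (b (φ n))).2) = e (b (φ n)) := Prod.ext (hfst _ hs).symm rfl
  simp only [Function.comp_apply, this, e.left_inv hs]

lemma IsTotalData.isCompleteMetric_riem (T : IsTotalData g J pr θ) (hg : IsCompleteMetric g) :
    IsCompleteMetric T.riem := by
  intro u hu
  obtain ⟨t, ht⟩ : ∃ t, Tendsto (fun n => (u n).1) atTop (𝓝 t) := by
    refine cauchySeq_tendsto_of_complete (EMetric.cauchySeq_iff.2 fun ε hε => ?_)
    obtain ⟨K, hK⟩ := hu ε hε
    refine ⟨K, fun m hm l hl => ?_⟩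
    rw [edist_eq_enorm_sub]
    exact (T.enorm_fst_sub_le_riemDist _ _).trans_lt (hK l hl m hm)
  obtain ⟨c, hc⟩ := ht.bddBelow_range
  have hc' : ∀ n, c ≤ (u n).1 := fun n => hc ⟨n, rfl⟩
  obtain ⟨x, hx⟩ := hg (fun n => totalProj pr (u n)) fun ε hε => by
    obtain ⟨δ, hδ, hδε⟩ := exists_between hε
    set C := ENNReal.ofReal (Real.exp (1 - c))
    obtain ⟨K, hK⟩ := hu (min 1 (δ / C))
      (lt_min one_pos (ENNReal.div_pos hδ.ne' ENNReal.ofReal_ne_top))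
    refine ⟨K, fun m hm l hl => ?_⟩
    calc riemDist g (totalProj pr (u m)) (totalProj pr (u l))
        ≤ ENNReal.ofReal (Real.exp (1 - (u m).1)) * min 1 (δ / C) :=
          T.riemDist_totalProj_le (hK m hm l hl) (min_le_left _ _)
      _ ≤ C * (δ / C) := by
          gcongr
          · exact ENNReal.ofReal_le_ofReal (Real.exp_le_exp.2 (by linarith [hc' m]))
          · exact min_le_right _ _
      _ ≤ δ := ENNReal.mul_div_le
      _ < ε := hδε
  obtain ⟨φ, hφ, b, hb⟩ := T.bundle.exists_subseq_tendsto (b := fun n => (u n).2) hx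
  exact ⟨(t, b), tendsto_of_subseq_tendsto T.riem hu hφ.tendsto_atTop
    ((ht.comp hφ.tendsto_atTop).prodMk_nhds hb)⟩

end CompletenessOfTotal

section TorusSections

open Filter

lemma contMDiffAt_torus {k : ℕ} {E : Type*} [NormedAddCommGroup E] [NormedSpace ℝ E]
    {H : Type*} [TopologicalSpace H] {I : ModelWithCorners ℝ E H}
    {M : Type*} [TopologicalSpace M] [ChartedSpace H M] {f : M → Torus k} {x : M} {n : ℕ∞ω}
    (hf : ∀ i, ContMDiffAt I (𝓡 1) n (fun y => f y i) x) :
    ContMDiffAt I (torusModel k) n f x := by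
  rw [contMDiffAt_iff_target]
  refine ⟨tendsto_pi_nhds.2 fun i => (hf i).continuousAt, ?_⟩
  rw [contMDiffAt_pi_space]
  exact fun i => (contMDiffAt_iff_target.1 (hf i)).2

/-- The exponential map of the torus. -/
noncomputable def torusExp {k : ℕ} (φ : Fin k → ℝ) : Torus k := fun i => Circle.exp (φ i)

lemma torusExp_zero {k : ℕ} : torusExp (0 : Fin k → ℝ) = 1 := funext fun _ => Circle.exp_zero

lemma torusExp_add_single {k : ℕ} (φ : Fin k → ℝ) (i : Fin k) (s : ℝ) :
    torusExp (φ + s • Pi.single i 1) = (Pi.mulSingle i (Circle.exp s) : Torus k) * torusExp φ := by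
  funext j
  rcases eq_or_ne j i with rfl | hj
  · simp [torusExp, Circle.exp_add, mul_comm]
  · simp [torusExp, hj]

variable {k : ℕ} {E : Type*} [NormedAddCommGroup E] [NormedSpace ℝ E] [FiniteDimensional ℝ E]
  {H : Type*} [TopologicalSpace H] {I : ModelWithCorners ℝ E H} [I.Boundaryless]
  {M : Type*} [TopologicalSpace M] [ChartedSpace H M] [IsManifold I ∞ M]
  {E' : Type*} [NormedAddCommGroup E'] [NormedSpace ℝ E'] [FiniteDimensional ℝ E']
  {H' : Type*} [TopologicalSpace H'] {I' : ModelWithCorners ℝ E' H'} [I'.Boundaryless]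
  {B : Type*} [TopologicalSpace B] [ChartedSpace H' B] [IsManifold I' ∞ B]
  [MulAction (Torus k) B]
  {g : RiemMetric I M} {J : Fin k → EndField I M} {pr : B → M} {θ : Fin k → OneForm I' B}
  {x : M} {q : ℝ × B}

/-- Local sections together with their translates under the torus. -/
lemma IsPrincipalTorusBundle.exists_sections (h : IsPrincipalTorusBundle I I' k pr) (x : M) :
    ∃ U : Set M, IsOpen U ∧ x ∈ U ∧ ∀ b, pr b ∈ U → ∃ s : M → B, s (pr b) = b ∧
      (∀ y ∈ U, pr (s y) = y) ∧
      ContMDiffOn (𝓘(ℝ, Fin k → ℝ).prod I) I' ∞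
        (fun z : (Fin k → ℝ) × M => torusExp z.1 • s z.2) (Set.univ ×ˢ U) := by
  obtain ⟨U, hU, hx, e, hsrc, htgt, hfst, hsmul, -, hsymm⟩ := h.locally_trivial x
  refine ⟨U, hU, hx, fun b hb => ?_⟩
  have hb' : b ∈ e.source := by rw [hsrc]; exact hb
  have hmem : ∀ y ∈ U, ∀ τ : Torus k, ((y, τ) : M × Torus k) ∈ e.target := fun y hy τ => by
    rw [htgt]; exact ⟨hy, Set.mem_univ _⟩
  have hpr : ∀ y ∈ U, ∀ τ : Torus k, pr (e.symm (y, τ)) = y := fun y hy τ => by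
    rw [← hfst _ (e.map_target (hmem y hy τ)), e.right_inv (hmem y hy τ)]
  refine ⟨fun y => e.symm (y, (e b).2), ?_, fun y hy => hpr y hy _, ?_⟩
  · have : (pr b, (e b).2) = e b := Prod.ext (hfst b hb').symm rfl
    simp only [this, e.left_inv hb']
  · have h1 : ContMDiff (𝓘(ℝ, Fin k → ℝ).prod I) (I.prod (torusModel k)) ∞
        (fun z : (Fin k → ℝ) × M => (z.2, torusExp z.1 * (e b).2)) := by
      refine contMDiff_snd.prodMk fun z => contMDiffAt_torus fun i => ?_
      have h2 : ContMDiff (𝓘(ℝ, Fin k → ℝ).prod I) 𝓘(ℝ, ℝ) ∞ fun z : (Fin k → ℝ) × M => z.1 i :=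
        (contMDiff_pi_space.1 contMDiff_fst) i
      exact (contMDiff_mul_right (a := (e b).2 i)).comp (contMDiff_circleExp.comp h2) z
    refine (hsymm.comp h1.contMDiffOn fun z hz => hmem z.2 hz.2 _).congr fun z hz => ?_
    have h3 := e.map_target (hmem z.2 hz.2 (e b).2)
    have h4 : torusExp z.1 • e.symm (z.2, (e b).2) ∈ e.source := by
      rw [hsrc, Set.mem_preimage, h.proj_smul, hpr z.2 hz.2]
      exact hz.2
    change torusExp z.1 • e.symm (z.2, (e b).2) = e.symm (z.2, torusExp z.1 * (e b).2)
    rw [← e.left_inv h4, hsmul _ h3, e.right_inv (hmem z.2 hz.2 _)]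

lemma IsTorusConnection.mdifferentiableAt_smul (hb : IsPrincipalTorusBundle I I' k pr)
    (hθ : IsTorusConnection I' θ) (j : Fin k) (a : Torus k) (b : B) :
    MDifferentiableAt I' I' (fun b : B => a • b) b := by
  by_contra hd
  obtain ⟨V, hV, -⟩ := hθ.exists_vertical hb b j
  have h1 := congrFun (hθ.invariant j a) b
  rw [pullback₁, mfderiv_zero_of_not_mdifferentiableAt hd, ContinuousLinearMap.comp_zero] at h1
  have h2 := hV j
  rw [← h1, if_pos rfl] at h2
  exact zero_ne_one h2

lemma IsTorusConnection.apply_mfderiv_torusExp_single (hθ : IsTorusConnection I' θ) {b : B}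
    (hd : MDifferentiable 𝓘(ℝ, Fin k → ℝ) I' fun φ : Fin k → ℝ => torusExp φ • b)
    (φ : Fin k → ℝ) (i j : Fin k) :
    θ j (torusExp φ • b) (mfderiv 𝓘(ℝ, Fin k → ℝ) I' (fun φ : Fin k → ℝ => torusExp φ • b) φ
      (Pi.single i 1 : Fin k → ℝ)) = if i = j then 1 else 0 := by
  set G : (Fin k → ℝ) → B := fun φ => torusExp φ • b
  set l : ℝ → (Fin k → ℝ) := fun s => φ + s • Pi.single i 1 with hl
  have hl0 : l 0 = φ := by simp [hl]
  have hld : ∀ s, HasDerivAt l (Pi.single i 1) s := fun s => by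
    have := ((hasDerivAt_id s).smul_const (Pi.single i 1 : Fin k → ℝ)).const_add φ
    rwa [one_smul] at this
  have key : θ j (G (l 0)) (mfderiv 𝓘(ℝ, Fin k → ℝ) I' G (l 0) (Pi.single i 1 : Fin k → ℝ)) =
      if i = j then 1 else 0 := by
    have e : G ∘ l = fun s : ℝ => (Pi.mulSingle i (Circle.exp s) : Torus k) • (torusExp φ • b) :=
      funext fun s => by
        simp only [Function.comp_apply, G, hl, torusExp_add_single, mul_smul]
    have h1 := hθ.vertical i j (torusExp φ • b) 0
    rw [← e] at h1
    have h2 := mfderiv_comp (0 : ℝ) (hd (l 0)) (hld 0).hasFDerivAt.differentiableAt.mdifferentiableAt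
    rw [← h1, pullback₁]
    refine congrArg (θ j (G (l 0))) ?_
    refine Eq.trans ?_ (congrArg (fun L => L (1 : ℝ)) h2).symm
    refine congrArg (mfderiv 𝓘(ℝ, Fin k → ℝ) I' G (l 0)) ?_
    rw [mfderiv_eq_fderiv, (hld 0).hasFDerivAt.fderiv]
    exact (one_smul ℝ _).symm
  rwa [hl0] at key

lemma IsTorusConnection.apply_mfderiv_torusExp (hθ : IsTorusConnection I' θ) {b : B}
    (hd : MDifferentiable 𝓘(ℝ, Fin k → ℝ) I' fun φ : Fin k → ℝ => torusExp φ • b)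
    (φ w : Fin k → ℝ) (j : Fin k) :
    θ j (torusExp φ • b) (mfderiv 𝓘(ℝ, Fin k → ℝ) I' (fun φ : Fin k → ℝ => torusExp φ • b) φ w) =
      w j := by
  have h := fun i => hθ.apply_mfderiv_torusExp_single hd φ i j
  let L : (Fin k → ℝ) →L[ℝ] ℝ := (θ j (torusExp φ • b)).comp
    (mfderiv 𝓘(ℝ, Fin k → ℝ) I' (fun φ : Fin k → ℝ => torusExp φ • b) φ)
  change L w = w j
  have h' : ∀ i, L (Pi.single i 1) = if i = j then 1 else 0 := h
  conv_lhs => rw [pi_eq_sum_univ' w]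
  simp [map_sum, h']

lemma IsTorusConnection.apply_mfderiv_translates (hb : IsPrincipalTorusBundle I I' k pr)
    (hθ : IsTorusConnection I' θ) {s : M → B} {U : Set M} (hU : IsOpen U)
    (hs : ContMDiffOn (𝓘(ℝ, Fin k → ℝ).prod I) I' ∞
      (fun z : (Fin k → ℝ) × M => torusExp z.1 • s z.2) (Set.univ ×ˢ U))
    {y : M} (hy : y ∈ U) (φ w : Fin k → ℝ) (v : TangentSpace I y) (j : Fin k) :
    θ j (torusExp φ • s y) (mfderiv (𝓘(ℝ, Fin k → ℝ).prod I) I'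
      (fun z : (Fin k → ℝ) × M => torusExp z.1 • s z.2) (φ, y) (w, v)) =
      w j + θ j (s y) (mfderiv I I' s y v) := by
  have hF : ∀ φ : Fin k → ℝ, MDifferentiableAt (𝓘(ℝ, Fin k → ℝ).prod I) I'
      (fun z : (Fin k → ℝ) × M => torusExp z.1 • s z.2) (φ, y) := fun φ =>
    (hs.contMDiffAt ((isOpen_univ.prod hU).mem_nhds ⟨Set.mem_univ φ, hy⟩)).mdifferentiableAt
      (by simp)
  have hd : MDifferentiable 𝓘(ℝ, Fin k → ℝ) I' fun φ : Fin k → ℝ => torusExp φ • s y := fun φ =>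
    (hF φ).comp φ (mdifferentiableAt_id.prodMk mdifferentiableAt_const)
  have hsd : MDifferentiableAt I I' s y := by
    have := (hF 0).comp y ((mdifferentiableAt_const (c := (0 : Fin k → ℝ))).prodMk
      mdifferentiableAt_id)
    refine this.congr_of_eventuallyEq (Eventually.of_forall fun y => ?_)
    simp [torusExp_zero]
  let V : TangentSpace (𝓘(ℝ, Fin k → ℝ).prod I) ((φ, y) : (Fin k → ℝ) × M) :=
    ((w, v) : (Fin k → ℝ) × E)
  have h1 := mfderiv_prod_eq_add_apply (hF φ) (v := V)
  have h2 := mfderiv_comp y (hθ.mdifferentiableAt_smul hb j (torusExp φ) (s y)) hsd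
  have h3 := congrFun (hθ.invariant j (torusExp φ)) (s y)
  refine (congrArg (θ j (torusExp φ • s y)) h1).trans ?_
  rw [map_add]
  refine congrArg₂ (· + ·) (hθ.apply_mfderiv_torusExp hd φ w j) ?_
  refine (congrArg (θ j (torusExp φ • s y)) (congrArg (fun L => L v) h2)).trans ?_
  exact congrArg (fun L => L (mfderiv I I' s y v)) h3

end TorusSections

section HorizontalLift

open Filter MeasureTheory

variable {k : ℕ} {E : Type*} [NormedAddCommGroup E] [NormedSpace ℝ E] [FiniteDimensional ℝ E]
  {H : Type*} [TopologicalSpace H] {I : ModelWithCorners ℝ E H} [I.Boundaryless]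
  {M : Type*} [TopologicalSpace M] [ChartedSpace H M] [IsManifold I ∞ M]
  {E' : Type*} [NormedAddCommGroup E'] [NormedSpace ℝ E'] [FiniteDimensional ℝ E']
  {H' : Type*} [TopologicalSpace H'] {I' : ModelWithCorners ℝ E' H'} [I'.Boundaryless]
  {B : Type*} [TopologicalSpace B] [ChartedSpace H' B] [IsManifold I' ∞ B]
  [MulAction (Torus k) B]
  {g : RiemMetric I M} {J : Fin k → EndField I M} {pr : B → M} {θ : Fin k → OneForm I' B}
  {x : M} {q : ℝ × B}

lemma IsSmoothOneForm.continuousAt_velocity {α : OneForm I' B} (hα : IsSmoothOneForm α) {c : ℝ → B}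
    {r : ℝ} (hc : ContMDiffAt 𝓘(ℝ, ℝ) I' 1 c r) :
    ContinuousAt (fun s => α (c s) (mfderiv 𝓘(ℝ, ℝ) I' c s (1 : ℝ))) r := by
  have h1 : ContMDiffAt 𝓘(ℝ, ℝ) 𝓘(ℝ, E') 1 (fun s => extChartAt I' (c r) (c s)) r :=
    ((contMDiffAt_extChartAt (n := 1)).comp r hc)
  have h2 : ContinuousAt (fun s => fderiv ℝ (fun s => extChartAt I' (c r) (c s)) s (1 : ℝ)) r :=
    ((contMDiffAt_iff_contDiffAt.1 h1).fderiv_right (m := 0) (by simp)).continuousAt.clm_apply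
      continuousAt_const
  have h3 : ContinuousAt (fun s => formRep α (c r) (c s)) r :=
    ContinuousAt.comp (f := c)
      (ContMDiffAt.continuousAt (oneForm_smooth_iff (n := ⊤).1 (hα (c r)))) hc.continuousAt
  refine (h3.clm_apply h2).congr ?_
  filter_upwards [(contMDiffAt_iff_contMDiffAt_nhds (by simp)).1 hc,
    hc.continuousAt.eventually (chart_source_mem_nhds H' (c r))] with s hs hs'
  have h4 := mvfderiv_comp_mfderiv (p := s) (mdifferentiableAt_chart hs')
    (hs.mdifferentiableAt one_ne_zero)
  have h5 : fderiv ℝ (fun s => extChartAt I' (c r) (c s)) s (1 : ℝ) =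
      dchart I' (c r) (c s) (mfderiv 𝓘(ℝ, ℝ) I' c s (1 : ℝ)) := by
    rw [← mfderiv_eq_fderiv]
    exact congrArg (fun L => L (1 : ℝ)) h4
  rw [h5, formRep_dchart α hs']

lemma exists_primitive {k : ℕ} {h : Fin k → ℝ → ℝ} {a b : ℝ} (hab : a ≤ b)
    (hh : ∀ j, ContinuousOn (h j) (Set.Icc a b)) : ∃ ψ : ℝ → Fin k → ℝ, ψ a = 0 ∧ ContDiff ℝ 1 ψ ∧
      ∀ r ∈ Set.Icc a b, HasDerivAt ψ (fun j => h j r) r := by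
  set f : Fin k → ℝ → ℝ := fun j => Set.IccExtend hab ((Set.Icc a b).domRestrict (h j)) with hf
  have hc : ∀ j, Continuous (f j) := fun j => (continuousOn_iff_continuous_domRestrict.1 (hh j)).Icc_extend'
  have hd : ∀ j r, HasDerivAt (fun r => ∫ x in a..r, f j x) (f j r) r := fun j r =>
    ((hc j).integral_hasStrictDerivAt a r).hasDerivAt
  refine ⟨fun r j => ∫ x in a..r, f j x, funext fun j => intervalIntegral.integral_same,
    contDiff_pi.2 fun j => ?_, fun r hr => hasDerivAt_pi.2 fun j => ?_⟩
  · rw [contDiff_one_iff_deriv]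
    refine ⟨fun r => (hd j r).differentiableAt, ?_⟩
    rw [show deriv (fun r => ∫ x in a..r, f j x) = f j from funext fun r => (hd j r).deriv]
    exact hc j
  · have := hd j r
    rwa [show f j r = h j r from Set.IccExtend_of_mem hab _ hr] at this

variable [T2Space M] [T2Space B]

lemma IsTotalData.riemNorm_horizontal (T : IsTotalData g J pr θ) {σ : ℝ → B} {γ : ℝ → M} {r : ℝ}
    (hσ : MDifferentiableAt 𝓘(ℝ, ℝ) I' σ r)
    (hθ : ∀ j, θ j (σ r) (mfderiv 𝓘(ℝ, ℝ) I' σ r (1 : ℝ)) = 0)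
    (hγ : (fun s => pr (σ s)) =ᶠ[𝓝 r] γ) :
    riemNorm T.riem ((0, σ r) : ℝ × B) (mfderiv 𝓘(ℝ, ℝ) (𝓘(ℝ, ℝ).prod I')
      (fun s => ((0, σ s) : ℝ × B)) r (1 : ℝ)) =
      riemNorm g (γ r) (mfderiv 𝓘(ℝ, ℝ) I γ r (1 : ℝ)) := by
  have hq : MDifferentiableAt 𝓘(ℝ, ℝ) (𝓘(ℝ, ℝ).prod I') (fun s => ((0, σ s) : ℝ × B)) r :=
    mdifferentiableAt_const.prodMk hσ
  have h1 := mvfderiv_comp_mfderiv (g := (Prod.fst : ℝ × B → ℝ)) (p := r)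
    (f := fun s => ((0, σ s) : ℝ × B)) (mdifferentiableAt_fst (I := 𝓘(ℝ, ℝ)) (I' := I')) hq
  have h1' : dt ((0, σ r) : ℝ × B) (mfderiv 𝓘(ℝ, ℝ) (𝓘(ℝ, ℝ).prod I')
      (fun s => ((0, σ s) : ℝ × B)) r (1 : ℝ)) = 0 := by
    refine (congrArg (fun L => L (1 : ℝ)) h1).symm.trans ?_
    rw [mvfderiv_const]
    rfl
  have h2 := mfderiv_comp r (g := (Prod.snd : ℝ × B → B)) (f := fun s => ((0, σ s) : ℝ × B))
    (mdifferentiableAt_snd (I := 𝓘(ℝ, ℝ)) (I' := I')) hq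
  have h2' : ∀ j, scaledForm (θ j) ((0, σ r) : ℝ × B) (mfderiv 𝓘(ℝ, ℝ) (𝓘(ℝ, ℝ).prod I')
      (fun s => ((0, σ s) : ℝ × B)) r (1 : ℝ)) = 0 := fun j => by
    have : liftForm (θ j) ((0, σ r) : ℝ × B) (mfderiv 𝓘(ℝ, ℝ) (𝓘(ℝ, ℝ).prod I')
      (fun s => ((0, σ s) : ℝ × B)) r (1 : ℝ)) = 0 :=
      (congrArg (fun L => θ j (σ r) (L (1 : ℝ))) h2).symm.trans (hθ j)
    rw [scaledForm, smul_apply, this, smul_zero]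
  have h3 := mfderiv_comp r (g := totalProj pr) (f := fun s => ((0, σ s) : ℝ × B))
    ((T.bundle.contMDiff_totalProj _).mdifferentiableAt (by simp)) hq
  have h3' : mfderiv 𝓘(ℝ, ℝ) I (fun s => pr (σ s)) r (1 : ℝ) =
      mfderiv (𝓘(ℝ, ℝ).prod I') I (totalProj pr) ((0, σ r) : ℝ × B)
        (mfderiv 𝓘(ℝ, ℝ) (𝓘(ℝ, ℝ).prod I') (fun s => ((0, σ s) : ℝ × B)) r (1 : ℝ)) :=
    congrArg (fun L => L (1 : ℝ)) h3
  rw [riemNorm, T.riem_inner, totalMetric_self, h1']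
  simp only [h2', ← h3', mul_zero, Real.exp_zero, one_mul, ne_eq, OfNat.ofNat_ne_zero,
    not_false_eq_true, zero_pow, Finset.sum_const_zero, add_zero, zero_add]
  change riemNorm g (pr (σ r)) (mfderiv 𝓘(ℝ, ℝ) I (fun s => pr (σ s)) r (1 : ℝ)) = _
  have e : ∀ δ : ℝ → M, δ =ᶠ[𝓝 r] γ → riemNorm g (δ r) (mfderiv 𝓘(ℝ, ℝ) I δ r (1 : ℝ)) =
      riemNorm g (γ r) (mfderiv 𝓘(ℝ, ℝ) I γ r (1 : ℝ)) := fun δ h => by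
    rw [h.mfderiv_eq]
    have := h.eq_of_nhds
    congr 1
  exact e _ hγ

lemma IsTotalData.exists_local_lift (T : IsTotalData g J pr θ) (x : M) :
    ∃ U : Set M, IsOpen U ∧ x ∈ U ∧ ∀ {γ : ℝ → M} {a b : ℝ}, ContMDiff 𝓘(ℝ, ℝ) I 1 γ → a ≤ b →
      (∀ r ∈ Set.Icc a b, γ r ∈ U) → ∀ b₀, pr b₀ = γ a → ∃ b₁, pr b₁ = γ b ∧
        riemDist T.riem (0, b₀) (0, b₁) ≤ pathLength g γ a b := by
  obtain ⟨U, hU, hx, hsec⟩ := T.bundle.exists_sections x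
  refine ⟨U, hU, hx, fun {γ a b} hγ hab hγU b₀ hb₀ => ?_⟩
  have ha := hγU a ⟨le_rfl, hab⟩
  obtain ⟨s, hsb, hprs, hF⟩ := hsec b₀ (hb₀ ▸ ha)
  rw [hb₀] at hsb
  have hFat : ∀ (φ : Fin k → ℝ) {y : M}, y ∈ U → ContMDiffAt (𝓘(ℝ, Fin k → ℝ).prod I) I' 1
      (fun z : (Fin k → ℝ) × M => torusExp z.1 • s z.2) (φ, y) := fun φ y hy =>
    (hF.contMDiffAt ((isOpen_univ.prod hU).mem_nhds ⟨Set.mem_univ φ, hy⟩)).of_le (by simp)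
  have hsat : ∀ {y : M}, y ∈ U → ContMDiffAt I I' 1 s y := fun {y} hy => by
    have := (hFat 0 hy).comp y ((contMDiffAt_const (c := (0 : Fin k → ℝ))).prodMk contMDiffAt_id)
    refine this.congr_of_eventuallyEq (Eventually.of_forall fun y => ?_)
    simp [torusExp_zero]
  have hc : ∀ r ∈ Set.Icc a b, ContMDiffAt 𝓘(ℝ, ℝ) I' 1 (s ∘ γ) r := fun r hr =>
    (hsat (hγU r hr)).comp r (hγ r)
  obtain ⟨ψ, hψa, hψ, hψd⟩ := exists_primitive hab
    (h := fun j r => -θ j (s (γ r)) (mfderiv 𝓘(ℝ, ℝ) I' (s ∘ γ) r (1 : ℝ)))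
    fun j r hr => ((T.conn.smooth j).continuousAt_velocity (hc r hr)).neg.continuousWithinAt
  set σ : ℝ → B := fun r => torusExp (ψ r) • s (γ r) with hσ
  have hψγ : ContMDiff 𝓘(ℝ, ℝ) (𝓘(ℝ, Fin k → ℝ).prod I) 1 fun r => (ψ r, γ r) :=
    (contMDiff_iff_contDiff.2 hψ).prodMk hγ
  have hσat : ∀ r ∈ Set.Icc a b, ContMDiffAt 𝓘(ℝ, ℝ) I' 1 σ r := fun r hr =>
    ContMDiffAt.comp (f := fun r => (ψ r, γ r)) r (hFat (ψ r) (hγU r hr)) (hψγ r)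
  have hprσ : ∀ r, γ r ∈ U → pr (σ r) = γ r := fun r hr => by
    rw [hσ]; simp only [T.bundle.proj_smul, hprs _ hr]
  have hσ0 : σ a = b₀ := by rw [hσ]; simp only [hψa, torusExp_zero, one_smul, hsb]
  refine ⟨σ b, hprσ b (hγU b ⟨hab, le_rfl⟩), ?_⟩
  have h1 : ContMDiffOn 𝓘(ℝ, ℝ) (𝓘(ℝ, ℝ).prod I') 1 (fun r => ((0, σ r) : ℝ × B)) (Set.Icc a b) :=
    contMDiffOn_const.prodMk fun r hr => (hσat r hr).contMDiffWithinAt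
  have h2 := riemDist_le_pathLength T.riem h1 hab
  rw [hσ0] at h2
  refine h2.trans (le_of_eq ?_)
  rw [pathLength_eq, pathLength_eq]
  refine setLIntegral_congr_fun measurableSet_Ioo fun r hr => ?_
  have hr' := Set.Ioo_subset_Icc_self hr
  refine T.riemNorm_horizontal ((hσat r hr').mdifferentiableAt one_ne_zero) (fun j => ?_) ?_
  · have h3 := mfderiv_comp r (f := fun r => (ψ r, γ r))
      ((hFat (ψ r) (hγU r hr')).mdifferentiableAt one_ne_zero)
      ((hψγ r).mdifferentiableAt one_ne_zero)
    have hψm : MDifferentiableAt 𝓘(ℝ, ℝ) 𝓘(ℝ, Fin k → ℝ) ψ r :=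
      (hψd r hr').differentiableAt.mdifferentiableAt
    have h4 := hψm.mfderiv_prod ((hγ r).mdifferentiableAt one_ne_zero)
    have h5 := mfderiv_comp r ((hsat (hγU r hr')).mdifferentiableAt one_ne_zero)
      ((hγ r).mdifferentiableAt one_ne_zero)
    have h6 := T.conn.apply_mfderiv_translates T.bundle hU hF (hγU r hr') (ψ r)
      (fun j => -θ j (s (γ r)) (mfderiv 𝓘(ℝ, ℝ) I' (s ∘ γ) r (1 : ℝ)))
      (mfderiv 𝓘(ℝ, ℝ) I γ r (1 : ℝ)) j
    have h7 : mfderiv 𝓘(ℝ, ℝ) 𝓘(ℝ, Fin k → ℝ) ψ r (1 : ℝ) =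
        fun j => -θ j (s (γ r)) (mfderiv 𝓘(ℝ, ℝ) I' (s ∘ γ) r (1 : ℝ)) := by
      rw [mfderiv_eq_fderiv, (hψd r hr').hasFDerivAt.fderiv]
      exact one_smul ℝ _
    have h8 : θ j (s (γ r)) (mfderiv I I' s (γ r) (mfderiv 𝓘(ℝ, ℝ) I γ r (1 : ℝ))) =
        θ j (s (γ r)) (mfderiv 𝓘(ℝ, ℝ) I' (s ∘ γ) r (1 : ℝ)) :=
      (congrArg (fun L => θ j (s (γ r)) (L (1 : ℝ))) h5).symm
    rw [h8, neg_add_cancel] at h6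
    refine Eq.trans ?_ h6
    refine (congrArg (fun L => θ j (σ r) (L (1 : ℝ))) h3).trans ?_
    rw [h4]
    exact congrArg (fun w : Fin k → ℝ => θ j (σ r) (mfderiv (𝓘(ℝ, Fin k → ℝ).prod I) I'
      (fun z : (Fin k → ℝ) × M => torusExp z.1 • s z.2) (ψ r, γ r)
        (w, mfderiv 𝓘(ℝ, ℝ) I γ r (1 : ℝ)))) h7
  · filter_upwards [hγ.continuous.continuousAt.preimage_mem_nhds (hU.mem_nhds (hγU r hr'))]
      with s hs using hprσ s hs

lemma IsTotalData.exists_lift (T : IsTotalData g J pr θ) {γ : ℝ → M} (hγ : ContMDiff 𝓘(ℝ, ℝ) I 1 γ)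
    {a b : ℝ} (hab : a ≤ b) (b₀ : B) (hb₀ : pr b₀ = γ a) : ∃ b₁, pr b₁ = γ b ∧
      riemDist T.riem (0, b₀) (0, b₁) ≤ pathLength g γ a b := by
  choose U hU hx hlift using T.exists_local_lift
  obtain ⟨t, ht0, htm, ⟨m, hm⟩, ht⟩ := exists_monotone_Icc_subset_open_cover_Icc hab
    (c := fun x : M => {r : Set.Icc a b | γ r ∈ U x})
    (fun x => (hU x).preimage (hγ.continuous.comp continuous_subtype_val))
    fun r _ => Set.mem_iUnion.2 ⟨γ r, hx (γ r)⟩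
  have key : ∀ n, ∃ b₁, pr b₁ = γ (t n) ∧
      riemDist T.riem (0, b₀) (0, b₁) ≤ pathLength g γ a (t n) := fun n => by
    induction n with
    | zero =>
      rw [ht0]
      exact ⟨b₀, hb₀, by rw [riemDist_self]; exact zero_le⟩
    | succ n ih =>
      obtain ⟨b₁, hb₁, h1⟩ := ih
      obtain ⟨x, hx'⟩ := ht n
      obtain ⟨b₂, hb₂, h2⟩ := hlift x hγ (htm (Nat.le_succ n)) (fun r hr =>
        hx' (a := ⟨r, (t n).2.1.trans hr.1, hr.2.trans (t (n + 1)).2.2⟩) ⟨hr.1, hr.2⟩) b₁ hb₁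
      refine ⟨b₂, hb₂, (riemDist_triangle _ _ _ _).trans ((add_le_add h1 h2).trans_eq ?_)⟩
      exact pathLength_add g γ (t n).2.1 (htm (Nat.le_succ n))
  have := key m
  rwa [hm m le_rfl] at this

lemma IsTotalData.exists_lift_of_riemDist_lt (T : IsTotalData g J pr θ) {b : B} {y : M}
    {r : ENNReal} (h : riemDist g (pr b) y < r) :
    ∃ b', pr b' = y ∧ riemDist T.riem (0, b) (0, b') < r := by
  obtain ⟨γ, h0, h1, hγ, hlen⟩ := exists_path_of_riemDist_lt h
  obtain ⟨b', hb', h2⟩ := T.exists_lift hγ zero_le_one b h0.symm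
  exact ⟨b', hb'.trans h1, h2.trans_lt hlen⟩

lemma IsPrincipalTorusBundle.surjective (h : IsPrincipalTorusBundle I I' k pr) :
    Function.Surjective pr := fun x => by
  obtain ⟨U, hU, hx, e, hsrc, htgt, hfst, -, -, -⟩ := h.locally_trivial x
  have hmem : ((x, 1) : M × Torus k) ∈ e.target := by rw [htgt]; exact ⟨hx, Set.mem_univ _⟩
  exact ⟨e.symm (x, 1), by rw [← hfst _ (e.map_target hmem), e.right_inv hmem]⟩

lemma IsTotalData.isCompleteMetric_of_riem (T : IsTotalData g J pr θ)
    (hT : IsCompleteMetric T.riem) : IsCompleteMetric g := by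
  intro u hu
  obtain ⟨φ, hφ, hdist⟩ := exists_subseq_riemDist_le g hu
  choose next hnext hnextd using fun (n : ℕ) (z : {b : B // pr b = u (φ n)}) =>
    T.exists_lift_of_riemDist_lt (b := z.1) (y := u (φ (n + 1))) (r := 2⁻¹ ^ n)
      (by rw [z.2]; exact hdist n)
  obtain ⟨b₀, hb₀⟩ := T.bundle.surjective (u (φ 0))
  let c : ∀ n, {b : B // pr b = u (φ n)} := fun n =>
    Nat.rec ⟨b₀, hb₀⟩ (fun n z => ⟨next n z, hnext n z⟩) n
  obtain ⟨q, hq⟩ := hT.exists_tendsto (u := fun n => ((0, (c n).1) : ℝ × B))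
    fun n => (hnextd n (c n)).le
  refine ⟨totalProj pr q, tendsto_of_subseq_tendsto g hu hφ.tendsto_atTop ?_⟩
  refine ((T.bundle.contMDiff_totalProj.continuous.tendsto q).comp hq).congr fun n => ?_
  exact (c n).2

lemma IsTotalData.isCompleteMetric_iff (T : IsTotalData g J pr θ) :
    IsCompleteMetric T.riem ↔ IsCompleteMetric g :=
  ⟨T.isCompleteMetric_of_riem, T.isCompleteMetric_riem⟩

end HorizontalLift

section QuaternionKahler

variable {E : Type*} [NormedAddCommGroup E] [NormedSpace ℝ E] [FiniteDimensional ℝ E]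
  {H : Type*} [TopologicalSpace H] {I : ModelWithCorners ℝ E H} [I.Boundaryless]
  {M : Type*} [TopologicalSpace M] [ChartedSpace H M] [IsManifold I ∞ M]
  {E' : Type*} [NormedAddCommGroup E'] [NormedSpace ℝ E'] [FiniteDimensional ℝ E']
  {H' : Type*} [TopologicalSpace H'] {I' : ModelWithCorners ℝ E' H'} [I'.Boundaryless]
  {B : Type*} [TopologicalSpace B] [ChartedSpace H' B] [IsManifold I' ∞ B]
  [T2Space M] [T2Space B] {pr : B → M} {α ξ η : OneForm I' B}
  {S : HyperKahlerStructure I M}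

lemma hasExtDeriv₁_neg_fundForm {ξ : OneForm I' B} {K : EndField I M} {g : RiemMetric I M}
    (h : HasExtDeriv₁ ξ (-pullback₂ pr (fundForm g.inner K))) :
    HasExtDeriv₁ ξ (pullback₂ pr (fundForm g.inner fun y => -K y)) := by
  rw [pullback₂_fundForm_neg]
  exact h

variable [MulAction (Torus 3) B]

lemma IsTotalData.isHypercomplex_quatField
    (T : IsTotalData S.g (quatBaseField S.J) pr ![α, ξ, η]) :
    IsHypercomplex (quatField pr ![α, ξ, η] (quatBaseField S.J)) := by
  have e := quatBaseField_quatBaseField S.J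
  exact T.isHypercomplex (quatBaseField_mul S.hypercomplex.quaternion)
    (by rw [e]; exact S.hypercomplex.complex) (by rw [e]; exact S.hermitian)
    (by rw [e]; exact S.closed) (by rw [e]; exact S.hypercomplex.quaternion)

lemma IsTotalData.quatField_orthogonal (T : IsTotalData S.g (quatBaseField S.J) pr ![α, ξ, η])
    (i : Fin 3) (p : ℝ × B) (u v : TangentSpace (𝓘(ℝ, ℝ).prod I') p) :
    T.riem.inner p (quatField pr ![α, ξ, η] (quatBaseField S.J) i p u)
      (quatField pr ![α, ξ, η] (quatBaseField S.J) i p v) = T.riem.inner p u v := by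
  have e := quatBaseField_quatBaseField S.J
  exact T.totalEnd_orthogonal (quatFibre_orthogonal i) (by rw [e]; exact S.hermitian i) p u v

lemma IsTotalData.isQuaternionKahler (T : IsTotalData S.g (quatBaseField S.J) pr ![α, ξ, η])
    {n : ℕ} (hn : 0 < n) (hE : Module.finrank ℝ E = 4 * n) :
    IsQuaternionKahler T.riem (quatForm (omegaN S pr α ξ η)) := by
  have e := quatBaseField_quatBaseField S.J
  have hquat : quatForm (omegaN S pr α ξ η) = quatForm (fun i => fundForm T.riem.inner
      (quatField pr ![α, ξ, η] (quatBaseField S.J) i)) :=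
    congrArg _ (funext fun i => (fundForm_quat T e i).symm)
  have hyper := T.isHypercomplex_quatField
  refine ⟨⟨n + 1, by lia, ?_⟩, fun x₀ => ⟨Set.univ, isOpen_univ, Set.mem_univ _,
    quatField pr ![α, ξ, η] (quatBaseField S.J), fun i => (hyper.complex i).smooth,
    fun x _ => hyper.quaternion x, fun x _ i => T.quatField_orthogonal i x,
    fun x _ a b c d => by rw [hquat]⟩, ?_, _, ?_, T.isEinsteinWith⟩
  · rw [Module.finrank_prod, Module.finrank_self, T.rank, hE]
    lia
  · rw [hquat]
    exact T.isParallel₄ (quatBaseField_mul S.hypercomplex.quaternion)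
      (by rw [e]; exact S.hypercomplex.complex) (by rw [e]; exact S.hermitian)
      (by rw [e]; exact S.closed)
  · exact neg_ne_zero.2 (by positivity)

end QuaternionKahler

end HKBundle

end Development

theorem theorem1p1 (n : ℕ) (hn : 0 < n)
    {M : Type*} [TopologicalSpace M] [T2Space M] [SecondCountableTopology M]
    [ChartedSpace (EuclideanSpace ℝ (Fin (4 * n))) M] [IsManifold (𝓡 (4 * n)) ∞ M]
    (S : HKBundle.HyperKahlerStructure (𝓡 (4 * n)) M) :
    -- the circle bundle with connection form `α`, `dα = σ₁`
    (∀ {B : Type*} [TopologicalSpace B] [T2Space B]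
      [ChartedSpace (EuclideanSpace ℝ (Fin (4 * n + 1))) B] [IsManifold (𝓡 (4 * n + 1)) ∞ B]
      [MulAction (HKBundle.Torus 1) B] (pr : B → M) (α : HKBundle.OneForm (𝓡 (4 * n + 1)) B),
      HKBundle.IsPrincipalTorusBundle (𝓡 (4 * n)) (𝓡 (4 * n + 1)) 1 pr →
      HKBundle.IsTorusConnection (𝓡 (4 * n + 1)) ![α] →
      HKBundle.HasExtDeriv₁ α (HKBundle.pullback₂ pr (S.σ 0)) →
      ∃ g : HKBundle.RiemMetric (𝓘(ℝ, ℝ).prod (𝓡 (4 * n + 1))) (ℝ × B),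
        g.inner = HKBundle.totalMetric pr S.g ![α] ∧
        (∃ J, HKBundle.IsKahlerWith g J (HKBundle.omegaP S pr α)) ∧
        HKBundle.IsEinstein g ∧
        HKBundle.HasNegativeScalarCurvature g ∧
        (HKBundle.IsCompleteMetric g ↔ HKBundle.IsCompleteMetric S.g)) ∧
    -- the 2-torus bundle with connection forms `α`, `ξ`, `dα = σ₁`, `dξ = -σ₂`
    (∀ {B : Type*} [TopologicalSpace B] [T2Space B]
      [ChartedSpace (EuclideanSpace ℝ (Fin (4 * n + 2))) B] [IsManifold (𝓡 (4 * n + 2)) ∞ B]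
      [MulAction (HKBundle.Torus 2) B] (pr : B → M) (α ξ : HKBundle.OneForm (𝓡 (4 * n + 2)) B),
      HKBundle.IsPrincipalTorusBundle (𝓡 (4 * n)) (𝓡 (4 * n + 2)) 2 pr →
      HKBundle.IsTorusConnection (𝓡 (4 * n + 2)) ![α, ξ] →
      HKBundle.HasExtDeriv₁ α (HKBundle.pullback₂ pr (S.σ 0)) →
      HKBundle.HasExtDeriv₁ ξ (-HKBundle.pullback₂ pr (S.σ 1)) →
      ∃ g : HKBundle.RiemMetric (𝓘(ℝ, ℝ).prod (𝓡 (4 * n + 2))) (ℝ × B),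
        g.inner = HKBundle.totalMetric pr S.g ![α, ξ] ∧
        HKBundle.IsEinstein g ∧
        HKBundle.HasNegativeScalarCurvature g ∧
        (HKBundle.IsCompleteMetric g ↔ HKBundle.IsCompleteMetric S.g)) ∧
    -- the 3-torus bundle with connection forms `α`, `ξ`, `η`,
    -- `dα = σ₁`, `dξ = -σ₂`, `dη = -σ₃`
    (∀ {B : Type*} [TopologicalSpace B] [T2Space B]
      [ChartedSpace (EuclideanSpace ℝ (Fin (4 * n + 3))) B] [IsManifold (𝓡 (4 * n + 3)) ∞ B]
      [MulAction (HKBundle.Torus 3) B] (pr : B → M) (α ξ η : HKBundle.OneForm (𝓡 (4 * n + 3)) B),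
      HKBundle.IsPrincipalTorusBundle (𝓡 (4 * n)) (𝓡 (4 * n + 3)) 3 pr →
      HKBundle.IsTorusConnection (𝓡 (4 * n + 3)) ![α, ξ, η] →
      HKBundle.HasExtDeriv₁ α (HKBundle.pullback₂ pr (S.σ 0)) →
      HKBundle.HasExtDeriv₁ ξ (-HKBundle.pullback₂ pr (S.σ 1)) →
      HKBundle.HasExtDeriv₁ η (-HKBundle.pullback₂ pr (S.σ 2)) →
      ∃ g : HKBundle.RiemMetric (𝓘(ℝ, ℝ).prod (𝓡 (4 * n + 3))) (ℝ × B),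
        g.inner = HKBundle.totalMetric pr S.g ![α, ξ, η] ∧
        HKBundle.IsQuaternionKahler g (HKBundle.quatForm (HKBundle.omegaN S pr α ξ η)) ∧
        (∃ J : Fin 3 → HKBundle.EndField (𝓘(ℝ, ℝ).prod (𝓡 (4 * n + 3))) (ℝ × B),
          (∀ i, HKBundle.fundForm g.inner (J i) = HKBundle.omegaN S pr α ξ η i) ∧
          HKBundle.IsHypercomplex J ∧
          (∀ i p u v, g.inner p (J i p u) (J i p v) = g.inner p u v)) ∧
        HKBundle.IsEinstein g ∧
        HKBundle.HasNegativeScalarCurvature g ∧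
        (HKBundle.IsCompleteMetric g ↔ HKBundle.IsCompleteMetric S.g)) := by
  refine ⟨?_, ?_, ?_⟩
  · intro B _ _ _ _ _ pr α hb hθ hα
    have hd : ∀ j : Fin 1, HKBundle.HasExtDeriv₁ (![α] j) (HKBundle.pullback₂ pr
        (HKBundle.fundForm S.g.inner (HKBundle.quatBaseField S.J (Fin.castLE (by lia) j)))) := by
      intro j
      rw [Subsingleton.elim j 0]
      exact hα
    have T := S.isTotalData (Fin.castLE_injective _) hb hθ hd (by simp)
    refine ⟨T.riem, T.riem_inner, ⟨HKBundle.totalEnd pr ![α] HKBundle.kahlerFibre (S.J 0), ?_⟩,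
      ⟨_, T.isEinsteinWith⟩, T.hasNegativeScalarCurvature one_pos, T.isCompleteMetric_iff⟩
    rw [← HKBundle.fundForm_kahler T]
    exact T.isKahlerWith
  · intro B _ _ _ _ _ pr α ξ hb hθ hα hξ
    have hd : ∀ j : Fin 2, HKBundle.HasExtDeriv₁ (![α, ξ] j) (HKBundle.pullback₂ pr
        (HKBundle.fundForm S.g.inner (HKBundle.quatBaseField S.J (Fin.castLE (by lia) j)))) := by
      intro j
      fin_cases j
      · exact hα
      · exact HKBundle.hasExtDeriv₁_neg_fundForm hξ
    have T := S.isTotalData (Fin.castLE_injective _) hb hθ hd (by simp)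
    exact ⟨T.riem, T.riem_inner, ⟨_, T.isEinsteinWith⟩,
      T.hasNegativeScalarCurvature two_pos, T.isCompleteMetric_iff⟩
  · intro B _ _ _ _ _ pr α ξ η hb hθ hα hξ hη
    have hd : ∀ j : Fin 3, HKBundle.HasExtDeriv₁ (![α, ξ, η] j) (HKBundle.pullback₂ pr
        (HKBundle.fundForm S.g.inner (HKBundle.quatBaseField S.J (id j)))) := by
      intro j
      fin_cases j
      · exact hα
      · exact HKBundle.hasExtDeriv₁_neg_fundForm hξ
      · exact HKBundle.hasExtDeriv₁_neg_fundForm hη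
    have T : HKBundle.IsTotalData S.g (HKBundle.quatBaseField S.J) pr ![α, ξ, η] :=
      S.isTotalData Function.injective_id hb hθ hd (by simp)
    exact ⟨T.riem, T.riem_inner, T.isQuaternionKahler hn (by simp),
      ⟨_, HKBundle.fundForm_quat T (HKBundle.quatBaseField_quatBaseField S.J),
        T.isHypercomplex_quatField, T.quatField_orthogonal⟩, ⟨_, T.isEinsteinWith⟩,
      T.hasNegativeScalarCurvature three_pos, T.isCompleteMetric_iff⟩
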